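/- **Conventions.** Quantum circuits are built from a fixed universal finite gate set (NOT, Hadamard, $T=\mathrm{diag}(1,e^{i\pi/4})$, CNOT, Toffoli), use ancillas $|0\rangle$, and have designated output qubits, the other qubits being traced out. A *family of polynomial-size quantum circuits with quantum advice* is a sequence $\{C_n,|a_n\rangle\}_n$ of circuits of size polynomial in $n$ and arbitrary pure states $|a_n\rangle$ of polynomially many qubits. A function $\mu$ is *negligible* if for every positive polynomial $p$ one has $\mu(n)<1/p(n)$ for all sufficiently large $n$. $\mathcal H^*$ denotes the pure states of finitely many qubits (states of different lengths being orthogonal), and a function $f:\{0,1\}^*\to\mathcal H^*$ is *polynomially bounded* if $f(x)$ has at most $q(|x|)$ qubits for some polynomial $q$. **The cryptosystem (Kawachi–Koshiba–Nishimura–Yamakami).** For the security parameter $n$ put $N=4n+2$. The decryption key is a uniformly random $\pi\in S_N$ with $\pi^2=\mathrm{id}$ and without fixed points. The encryption key is $$e=\rho_\pi^+=\frac1{2\,N!}\sum_{\sigma\in S_N}\bigl(|\sigma\rangle+|\sigma\pi\rangle\bigr)\bigl(\langle\sigma|+\langle\sigma\pi|\bigr),$$ a permutation being written on qubits as its permutation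 matrix; any number of independent copies of $e$ can be issued for the same $\pi$. The message space is $M_n=\{0,1\}$. To encrypt $0$ one sends one copy of $e$; to encrypt $1$ one applies $|\sigma\rangle\mapsto\mathrm{sgn}(\sigma)|\sigma\rangle$ to one copy of $e$ and sends the result $$\rho_\pi^-=\frac1{2\,N!}\sum_{\sigma\in S_N}\bigl(|\sigma\rangle-|\sigma\pi\rangle\bigr)\bigl(\langle\sigma|-\langle\sigma\pi|\bigr).$$ Decryption measures the eigenvalue of $|\sigma\rangle\mapsto|\sigma\pi\rangle$. **Hypothesis.** Graph automorphism (given a graph, does it have a non-trivial automorphism?) is almost everywhere hard: for every family $\{C_m,|a_m\rangle\}_m$ of polynomial-size quantum circuits with quantum advice and for all sufficiently large $m$, there is a graph $\Gamma$ on $m$ vertices on which $C_m$, given the adjacency matrix of $\Gamma$ and $|a_m\rangle$, outputs the correct answer with probability less than $2/3$. **Conclusion (Corollary 4.1).** Under this hypothesis the cryptosystem is semantically q-secure against chosen plaintext attack. That is: there is a polynomial-time computable uniform quantum transformation $T$, which (in general probabilistically) maps a circuit with advice $(C_n,|a_n\rangle)$ to a circuit with advice $(C_n',|a_n'\rangle)$,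 such that for every polynomial $k$ there is a polynomial $k'$ for which the following holds. For every family $\{C_n,|a_n\rangle\}$ of polynomial-size quantum circuits with quantum advice, every family of distributions $X_n$ on $M_n$, and every pair of polynomially bounded functions $f,h:\{0,1\}^*\to\mathcal H^*$, the quantity $$\sum_{(e,d),\,\alpha}\bigl|\langle C_n(e^{\otimes k(n)},E_e(\alpha),h(\alpha),|a_n\rangle)\,|\,f(\alpha)\rangle\bigr|^2\Pr[G(1^n)=(e,d)\wedge X_n=\alpha]$$ $$-\sum_{(e,d),\,\alpha,\,(C_n',|a_n'\rangle)}\bigl|\langle C_n'(e^{\otimes k'(n)},h(\alpha),|a_n'\rangle)\,|\,f(\alpha)\rangle\bigr|^2\Pr[G(1^n)=(e,d)\wedge X_n=\alpha]\,\Pr[T(C_n,|a_n\rangle)=(C_n',|a_n'\rangle)]$$ is negligible. Here $\alpha$ ranges over $M_n$, $(e,d)$ over the key pairs, and $(C_n',|a_n'\rangle)$ over the possible outputs of $T(C_n,|a_n\rangle)$; when the output of a circuit is a mixed state $\rho$, $|\langle\cdot|f(\alpha)\rangle|^2$ stands for $\langle f(\alpha)|\rho|f(\alpha)\rangle$ (which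 is $0$ if $\rho$ and $f(\alpha)$ have different numbers of qubits). -/

import Mathlib

namespace QPK

open scoped ComplexOrder

/-! ### Quantum registers -/

/-- Computational basis labels of a register of `n` qubits. -/
abbrev Bits (n : ℕ) : Type := Fin n → Bool

/-- Linear operators on a register of `n` qubits. -/
abbrev OpMat (n : ℕ) : Type := Matrix (Bits n) (Bits n) ℂ

/-- An operator on a register of some finite number of qubits. Mixed states are represented by
their density operators; an unnormalised density operator `p • ρ` records a state `ρ` that
occurs with probability `p`. -/
structure QOp where
  qubits : ℕ
  mat : OpMat qubits

/-- A pure state of a register of some finite number of qubits: an element of norm one of the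
space `⋃ₙ (ℂ²)^{⊗ n}` of quantum strings. -/
structure Ket where
  qubits : ℕ
  amp : Bits qubits → ℂ
  norm_one : ∑ x, ‖amp x‖ ^ 2 = 1

/-- The density operator `|ψ⟩⟨ψ|`. -/
def Ket.toOp (ψ : Ket) : QOp where
  qubits := ψ.qubits
  mat := Matrix.vecMulVec ψ.amp (star ψ.amp)

/-- The computational basis state `|w⟩` of a bit string `w`. -/
def Ket.ofBits (w : List Bool) : Ket where
  qubits := w.length
  amp := Pi.single w.get 1
  norm_one := by
    rw [Finset.sum_eq_single w.get]
    · simp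
    · intro b _ hb
      simp [hb]
    · simp

/-- The tensor product; the qubits of `ρ` come first. -/
def QOp.tensor (ρ τ : QOp) : QOp where
  qubits := ρ.qubits + τ.qubits
  mat := fun x y =>
    ρ.mat (fun i => x (Fin.castAdd τ.qubits i)) (fun i => y (Fin.castAdd τ.qubits i)) *
      τ.mat (fun i => x (Fin.natAdd ρ.qubits i)) (fun i => y (Fin.natAdd ρ.qubits i))

/-- The tensor power `ρ^{⊗ k}`. -/
def QOp.tensorPow (ρ : QOp) : ℕ → QOp
  | 0 => ⟨0, 1⟩
  | k + 1 => (ρ.tensorPow k).tensor ρ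

/-- Joins a label of the first `k` qubits and a label of the other qubits of a `w`-qubit register
(meant for `k ≤ w`). -/
def Bits.join {k w : ℕ} (x : Bits k) (z : Bits (w - k)) : Bits w := fun i =>
  if h : i.val < k then x ⟨i.val, h⟩ else z ⟨i.val - k, by omega⟩

/-- The reduced operator on the first `m` qubits (on all qubits if there are fewer than `m`):
partial trace over the others. -/
def QOp.takeFirst (ρ : QOp) (m : ℕ) : QOp where
  qubits := min m ρ.qubits
  mat := fun x y => ∑ z : Bits (ρ.qubits - min m ρ.qubits), ρ.mat (x.join z) (y.join z)

/-- The unnormalised state of the remaining qubits after a measurement of the first `m` qubits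
(of all qubits if there are fewer than `m`) in the computational basis with outcome `y`. Its trace
is the probability of the outcome `y`. -/
def QOp.afterMeasure (ρ : QOp) (m : ℕ) (y : Bits (min m ρ.qubits)) : QOp where
  qubits := ρ.qubits - min m ρ.qubits
  mat := fun z z' => ρ.mat (y.join z) (y.join z')

/-- The quantity `⟨ψ|ρ|ψ⟩`. States of registers of different lengths are orthogonal. For
`ρ = |φ⟩⟨φ|` it equals `|⟨φ|ψ⟩|²`. -/
noncomputable def QOp.overlap (ρ : QOp) (ψ : Ket) : ℝ :=
  if h : ψ.qubits = ρ.qubits then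
    (∑ x : Bits ψ.qubits, ∑ y : Bits ψ.qubits, star (ψ.amp x) *
      ρ.mat (fun i => x (Fin.cast h.symm i)) (fun i => y (Fin.cast h.symm i)) * ψ.amp y).re
  else 0

/-! ### Quantum circuits -/

/-- Elementary gates, with the numbers of the wires they act on: negation, the Hadamard gate, the
`π/8` gate, the controlled negation (control first) and the Toffoli gate (controls first). -/
inductive Gate where
  | not (i : ℕ)
  | had (i : ℕ)
  | tee (i : ℕ)
  | cnot (i j : ℕ)
  | toffoli (i j k : ℕ)

/-- The Hadamard matrix. -/
noncomputable def hadMat : Matrix Bool Bool ℂ := fun a b =>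
  (if a && b then -1 else 1) / (Real.sqrt 2 : ℂ)

/-- The matrix `diag(1, e^{iπ/4})`. -/
noncomputable def teeMat : Matrix Bool Bool ℂ := Matrix.diagonal fun a =>
  if a then Complex.exp (Complex.I * (Real.pi / 4)) else 1

/-- The operator on `n` qubits that applies a one-qubit operator `A` to qubit `i`. -/
def oneQubit {n : ℕ} (A : Matrix Bool Bool ℂ) (i : Fin n) : OpMat n := fun x y =>
  if ∀ j, j ≠ i → x j = y j then A (x i) (y i) else 0

/-- The operator on `n` qubits that maps the basis state `|y⟩` to `|F y⟩`. -/
def basisMap {n : ℕ} (F : Bits n → Bits n) : OpMat n := fun x y => if x = F y then 1 else 0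

/-- The unitary operator of a gate on a register of `n` qubits. A gate whose wires are not distinct
wires of the register acts as the identity. -/
noncomputable def Gate.op (n : ℕ) : Gate → OpMat n
  | .not i =>
      if h : i < n then basisMap fun y => Function.update y ⟨i, h⟩ (!(y ⟨i, h⟩)) else 1
  | .had i => if h : i < n then oneQubit hadMat ⟨i, h⟩ else 1
  | .tee i => if h : i < n then oneQubit teeMat ⟨i, h⟩ else 1
  | .cnot i j =>
      if h : i < n ∧ j < n ∧ i ≠ j then
        basisMap fun y => Function.update y ⟨j, h.2.1⟩ ((y ⟨j, h.2.1⟩).xor (y ⟨i, h.1⟩))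
      else 1
  | .toffoli i j k =>
      if h : i < n ∧ j < n ∧ k < n ∧ i ≠ j ∧ i ≠ k ∧ j ≠ k then
        basisMap fun y => Function.update y ⟨k, h.2.2.1⟩
          ((y ⟨k, h.2.2.1⟩).xor (y ⟨i, h.1⟩ && y ⟨j, h.2.1⟩))
      else 1

/-- A quantum circuit: it adds `anc` ancilla qubits in state `|0⟩` behind its input, applies its
gates in order, and designates the first `out` wires as its output. -/
structure Circuit where
  anc : ℕ
  out : ℕ
  gates : List Gate

/-- The unitary operator on `n` qubits of a sequence of gates, the first gate applied first. -/
noncomputable def gatesOp (n : ℕ) (gs : List Gate) : OpMat n :=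
  gs.foldl (fun V g => g.op n * V) 1

/-- Adds `m` ancilla qubits in state `|0⟩` behind the register. -/
def QOp.addAncillas (ρ : QOp) (m : ℕ) : QOp where
  qubits := ρ.qubits + m
  mat := fun x y =>
    if (∀ i, x (Fin.natAdd ρ.qubits i) = false) ∧ (∀ i, y (Fin.natAdd ρ.qubits i) = false) then
      ρ.mat (fun i => x (Fin.castAdd m i)) (fun i => y (Fin.castAdd m i))
    else 0

/-- Applies a sequence of gates to a register. -/
noncomputable def QOp.applyGates (ρ : QOp) (gs : List Gate) : QOp where
  qubits := ρ.qubits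
  mat := gatesOp ρ.qubits gs * ρ.mat * (gatesOp ρ.qubits gs).conjTranspose

/-- The final state of all wires of the circuit on input `ρ`. -/
noncomputable def Circuit.final (c : Circuit) (ρ : QOp) : QOp :=
  (ρ.addAncillas c.anc).applyGates c.gates

/-- The state of the output wires of the circuit on input `ρ`, the other wires traced out. -/
noncomputable def Circuit.output (c : Circuit) (ρ : QOp) : QOp := (c.final ρ).takeFirst c.out

/-! ### Descriptions of circuits by bit strings -/

/-- The string `1^{a₁} 0 1^{a₂} 0 ⋯ 1^{aₘ} 0`. -/
def encodeNats (l : List ℕ) : List Bool := l.flatMap fun a => List.replicate a true ++ [false]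

/-- Reads a string `1^{a₁} 0 ⋯ 1^{aₘ} 0`, where `a` ones have been read already; a trailing block
of ones is ignored. -/
def decodeNatsAux : ℕ → List Bool → List ℕ
  | _, [] => []
  | a, true :: l => decodeNatsAux (a + 1) l
  | a, false :: l => a :: decodeNatsAux 0 l

def Gate.toNats : Gate → List ℕ
  | .not i => [0, i]
  | .had i => [1, i]
  | .tee i => [2, i]
  | .cnot i j => [3, i, j]
  | .toffoli i j k => [4, i, j, k]

/-- Reads a list of gates, up to the first place that is not of the form written by
`Gate.toNats`. -/
def readGates : List ℕ → List Gate
  | 0 :: i :: l => .not i :: readGates l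
  | 1 :: i :: l => .had i :: readGates l
  | 2 :: i :: l => .tee i :: readGates l
  | 3 :: i :: j :: l => .cnot i j :: readGates l
  | 4 :: i :: j :: k :: l => .toffoli i j k :: readGates l
  | _ => []

/-- The description of a circuit as a bit string; all numbers are written in unary. -/
def Circuit.encode (c : Circuit) : List Bool :=
  encodeNats (c.anc :: c.out :: c.gates.flatMap Gate.toNats)

/-- The circuit described by a bit string; every string describes some circuit. -/
def Circuit.decode (w : List Bool) : Circuit :=
  match decodeNatsAux 0 w with
  | a :: o :: l => ⟨a, o, readGates l⟩
  | _ => ⟨0, 0, []⟩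

theorem decodeNatsAux_replicate (m a : ℕ) (w : List Bool) :
    decodeNatsAux a (List.replicate m true ++ false :: w) = (a + m) :: decodeNatsAux 0 w := by
  induction m generalizing a with
  | zero => simp [decodeNatsAux]
  | succ m ih =>
      rw [List.replicate_succ, List.cons_append, decodeNatsAux, ih, Nat.add_right_comm,
        Nat.add_assoc]

theorem decodeNatsAux_encodeNats (l : List ℕ) : decodeNatsAux 0 (encodeNats l) = l := by
  induction l with
  | nil => rfl
  | cons a l ih =>
      have : encodeNats (a :: l) = List.replicate a true ++ false :: encodeNats l := by
        simp [encodeNats]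
      rw [this, decodeNatsAux_replicate, ih, Nat.zero_add]

theorem readGates_toNats (gs : List Gate) : readGates (gs.flatMap Gate.toNats) = gs := by
  induction gs with
  | nil => simp [readGates]
  | cons g gs ih => cases g <;> simpa [Gate.toNats, readGates] using ih

theorem Circuit.decode_encode (c : Circuit) : Circuit.decode c.encode = c := by
  simp [Circuit.decode, Circuit.encode, decodeNatsAux_encodeNats, readGates_toNats]

/-- The size of a circuit is the length of its description. Up to a polynomial this is the number
of gates, ancillas and outputs, for circuits whose gates act on existing wires. -/
def Circuit.size (c : Circuit) : ℕ := c.encode.length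

/-- `{Cₙ, |aₙ⟩}` is a family of polynomial-size quantum circuits with quantum advice. -/
def PolySizeFamily (C : ℕ → Circuit) (a : ℕ → Ket) : Prop :=
  ∃ p : Polynomial ℕ, ∀ n, (C n).size ≤ p.eval n ∧ (a n).qubits ≤ p.eval n

/-- A quantum function `{0,1}* → ℋ*` is polynomially bounded. -/
def PolyBounded (f : List Bool → Ket) : Prop :=
  ∃ p : Polynomial ℕ, ∀ x, (f x).qubits ≤ p.eval x.length

/-- `μ` is negligible: `μ n < 1 / p(n)` for every positive polynomial `p` and all sufficiently
large `n`. -/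
def Negligible (μ : ℕ → ℝ) : Prop :=
  ∀ p : Polynomial ℝ, (∀ n : ℕ, 0 < p.eval (n : ℝ)) →
    ∀ᶠ n : ℕ in Filter.atTop, μ n < 1 / p.eval (n : ℝ)

/-! ### Uniform quantum transformations of adversaries -/

/-- A polynomial-time computable uniform quantum transformation, given by a polynomial-time Turing
machine that produces, from its classical input, the description of the quantum circuit to run. -/
structure Transformation where
  gen : List Bool → List Bool
  polyTime : Nonempty (Turing.TM2ComputableInPolyTime (αΓ := Bool) (βΓ := Bool) id id gen)

/-- The quantum circuit that the transformation runs on the input `(C, |a⟩)`, for the security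
parameter `n`, when the circuit `C` is made for `k` copies of the public key. The classical
input of the Turing machine consists of `n`, `k`, the number of qubits of `|a⟩`, all in unary,
and the description of `C`. -/
def Transformation.circuit (T : Transformation) (n k : ℕ) (C : Circuit) (a : Ket) : Circuit :=
  Circuit.decode (T.gen (encodeNats [n, k, a.qubits] ++ C.encode))

/-- The state of that quantum circuit, run on the description of `C` and on `|a⟩`, before the final
measurement. -/
noncomputable def Transformation.state (T : Transformation) (n k : ℕ) (C : Circuit) (a : Ket) :
    QOp :=
  (T.circuit n k C a).final ((Ket.ofBits C.encode).toOp.tensor a.toOp)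

/-- The possible outcomes of the measurement of the output wires. -/
abbrev Transformation.Outcome (T : Transformation) (n k : ℕ) (C : Circuit) (a : Ket) : Type :=
  Bits (min (T.circuit n k C a).out (T.state n k C a).qubits)

/-- The circuit `C'` produced by the transformation when the outcome is `y`: the one that `y`
describes. -/
noncomputable def Transformation.newCircuit {T : Transformation} {n k : ℕ} {C : Circuit} {a : Ket}
    (y : T.Outcome n k C a) : Circuit :=
  Circuit.decode (List.ofFn y)

/-- The advice `|a'⟩` produced when the outcome is `y`: the state of the wires that have not
been measured. It is weighted with the probability of `y`, i.e. this is `Pr[y] • |a'⟩⟨a'|`. -/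
noncomputable def Transformation.newAdvice {T : Transformation} {n k : ℕ} {C : Circuit} {a : Ket}
    (y : T.Outcome n k C a) : QOp :=
  (T.state n k C a).afterMeasure (T.circuit n k C a).out y

/-! ### Quantum public-key cryptosystems -/

/-- The quantum operation with Kraus operators `Ks`. -/
noncomputable def applyKraus {p c : ℕ} (Ks : List (Matrix (Bits c) (Bits p) ℂ)) (ρ : OpMat p) :
    OpMat c :=
  (Ks.map fun K : Matrix (Bits c) (Bits p) ℂ => K * ρ * K.conjTranspose).sum

/-- A quantum public-key cryptosystem `(G, M, E, D)` with classical messages, classical decryption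
keys and quantum encryption keys, as a family of quantum operations. Key generation draws a
decryption key `d` and then prepares any number of independent copies of the encryption
key `e = pub n d`. Encryption of `α` consumes one copy of `e` and is a quantum channel, given by
Kraus operators. Decryption is a quantum measurement and is always correct. The running times of
these operations play no part in the security notions below. -/
structure Cryptosystem where
  SecretKey : ℕ → Type
  secretFintype : ∀ n, Fintype (SecretKey n)
  /-- distribution of the decryption key -/
  keyDist : ∀ n, PMF (SecretKey n)
  /-- number of qubits of an encryption key -/
  pubQubits : ℕ → ℕ
  /-- the encryption key that belongs to a decryption key -/
  pub : ∀ n, SecretKey n → OpMat (pubQubits n)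
  pub_posSemidef : ∀ n d, (pub n d).PosSemidef
  pub_trace : ∀ n d, (pub n d).trace = 1
  /-- message spaces -/
  msgs : ℕ → Finset (List Bool)
  /-- number of qubits of a ciphertext -/
  ctQubits : ℕ → ℕ
  /-- Kraus operators of the encryption of a message -/
  kraus : ∀ n, List Bool → List (Matrix (Bits (ctQubits n)) (Bits (pubQubits n)) ℂ)
  kraus_sum : ∀ n α, ((kraus n α).map fun K => K.conjTranspose * K).sum = 1
  /-- the measurement operators of decryption: `dec n d α` belongs to the outcome `α` -/
  dec : ∀ n, SecretKey n → List Bool → OpMat (ctQubits n)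
  dec_posSemidef : ∀ n d α, (dec n d α).PosSemidef
  dec_sum : ∀ n d, ∑ α ∈ msgs n, dec n d α = 1
  /-- perfect correctness -/
  correct : ∀ n d, d ∈ (keyDist n).support → ∀ α ∈ msgs n,
    (dec n d α * applyKraus (kraus n α) (pub n d)).trace = 1

attribute [instance] Cryptosystem.secretFintype

/-- The encryption key `e`, as a state. -/
def Cryptosystem.key (S : Cryptosystem) (n : ℕ) (d : S.SecretKey n) : QOp :=
  ⟨S.pubQubits n, S.pub n d⟩

/-- The ciphertext `E_e(α)`. -/
noncomputable def Cryptosystem.cipher (S : Cryptosystem) (n : ℕ) (d : S.SecretKey n) (α : List Bool) : QOp :=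
  ⟨S.ctQubits n, applyKraus (S.kraus n α) (S.pub n d)⟩

/-- The average, over keys and messages, of `|⟨C(e^{⊗k}, E_e(α), h(α), |a⟩) | f(α)⟩|²`. In the
input register `h(α)`, whose length may depend on `α`, comes last. -/
noncomputable def Cryptosystem.realSuccess (S : Cryptosystem) (n k : ℕ) (C : Circuit) (a : Ket)
    (X : PMF (S.msgs n)) (f h : List Bool → Ket) : ℝ :=
  ∑ d : S.SecretKey n, ∑ α : S.msgs n,
    (C.output ((((S.key n d).tensorPow k).tensor (S.cipher n d α)).tensor
        (a.toOp.tensor (h α).toOp))).overlap (f α) *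
      ((S.keyDist n d).toReal * (X α).toReal)

/-- The average, over keys, messages and outcomes `(C', |a'⟩)` of `T(C, |a⟩)`, of
`|⟨C'(e^{⊗k'}, h(α), |a'⟩) | f(α)⟩|²`, where `C` is made for `k` copies of the public key. The
probability of `(C', |a'⟩)` is contained in the weight of the new advice. -/
noncomputable def Cryptosystem.idealSuccess (S : Cryptosystem) (T : Transformation) (n k k' : ℕ)
    (C : Circuit) (a : Ket) (X : PMF (S.msgs n)) (f h : List Bool → Ket) : ℝ :=
  ∑ d : S.SecretKey n, ∑ α : S.msgs n, ∑ y : T.Outcome n k C a,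
    ((Transformation.newCircuit y).output (((S.key n d).tensorPow k').tensor
        ((Transformation.newAdvice y).tensor (h α).toOp))).overlap (f α) *
      ((S.keyDist n d).toReal * (X α).toReal)

/-- Semantic q-security against chosen plaintext attack: the adversary holds polynomially many
copies `e^{⊗ k(n)}` of the public key, and the transformed adversary, which does not see the
ciphertext, polynomially many copies `e^{⊗ k'(n)}`. -/
def Cryptosystem.SemanticallyQSecure (S : Cryptosystem) : Prop :=
  ∃ T : Transformation, ∀ k : Polynomial ℕ, ∃ k' : Polynomial ℕ,
    ∀ (C : ℕ → Circuit) (a : ℕ → Ket), PolySizeFamily C a →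
    ∀ X : ∀ n, PMF (S.msgs n),
    ∀ f h : List Bool → Ket, PolyBounded f → PolyBounded h →
      Negligible fun n =>
        S.realSuccess n (k.eval n) (C n) (a n) (X n) f h -
          S.idealSuccess T n (k.eval n) (k'.eval n) (C n) (a n) (X n) f h

/-! ### Graph automorphism -/

/-- The basis state of the adjacency matrix of a graph, row by row. -/
noncomputable def graphState {m : ℕ} (G : SimpleGraph (Fin m)) : QOp :=
  open Classical in
  (Ket.ofBits (List.ofFn fun t : Fin (m * m) =>
    decide (G.Adj (finProdFinEquiv.symm t).1 (finProdFinEquiv.symm t).2))).toOp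

/-- The graph automorphism problem: does the graph have a non-trivial automorphism? -/
def HasNontrivialAut {m : ℕ} (G : SimpleGraph (Fin m)) : Prop :=
  ∃ φ : G ≃g G, ∃ v, φ v ≠ v

/-- The circuit `C` with advice `|a⟩` solves graph automorphism on all graphs with `m` vertices, with
error probability at most `1/3`. -/
def SolvesGA (m : ℕ) (C : Circuit) (a : Ket) : Prop :=
  open Classical in
  ∀ G : SimpleGraph (Fin m),
    2 / 3 ≤ (C.output ((graphState G).tensor a.toOp)).overlap
      (Ket.ofBits [decide (HasNontrivialAut G)])

/-- Graph automorphism is almost everywhere hard to compute by polynomial-size quantum circuits with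
quantum advice: every such family fails in the worst case on all sufficiently large sizes. -/
def GAHardAE : Prop :=
  ∀ (C : ℕ → Circuit) (a : ℕ → Ket), PolySizeFamily C a →
    ∀ᶠ m in Filter.atTop, ¬ SolvesGA m (C m) (a m)

/-! ### The Kawachi–Koshiba–Nishimura–Yamakami cryptosystem -/

namespace KKNY

open Equiv

/-- The degree of the symmetric group for the security parameter `n`; the degrees are the positive
numbers congruent to `2` modulo `4`. -/
abbrev deg (n : ℕ) : ℕ := 4 * n + 2

/-- Decryption keys: the involutions without fixed points. -/
abbrev Secret (n : ℕ) : Type := {π : Perm (Fin (deg n)) // π * π = 1 ∧ ∀ i, π i ≠ i}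

/-- A permutation of `N` points, written as its permutation matrix, row by row. -/
def bits {N : ℕ} (σ : Perm (Fin N)) : Bits (N * N) := fun t =>
  decide (σ (finProdFinEquiv.symm t).1 = (finProdFinEquiv.symm t).2)

/-- The vector `|σ⟩`. -/
def ket {N : ℕ} (σ : Perm (Fin N)) : Bits (N * N) → ℂ := Pi.single (bits σ) 1

/-- The encryption key `ρ_π⁺ = 1/(2·N!) ∑_σ (|σ⟩ + |σπ⟩)(⟨σ| + ⟨σπ|)`. -/
noncomputable def pubMat {N : ℕ} (π : Perm (Fin N)) : OpMat (N * N) :=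
  (1 / (2 * (Nat.factorial N : ℂ))) •
    ∑ σ : Perm (Fin N), Matrix.vecMulVec (ket σ + ket (σ * π)) (star (ket σ + ket (σ * π)))

/-- The unitary operator `|σ⟩ ↦ sgn(σ) |σ⟩`; it fixes the basis states that are not
permutations. -/
noncomputable def signOp (N : ℕ) : OpMat (N * N) :=
  open Classical in
  Matrix.diagonal fun x => if ∃ σ : Perm (Fin N), Perm.sign σ = -1 ∧ bits σ = x then -1 else 1

/-- Encryption: the bit `0` leaves the public key `ρ_π⁺` as it is, the bit `1` applies the sign
operator, which turns it into
`ρ_π⁻ = 1/(2·N!) ∑_σ (|σ⟩ - |σπ⟩)(⟨σ| - ⟨σπ|)`. -/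
noncomputable def encOp (N : ℕ) (α : List Bool) : OpMat (N * N) :=
  if α = [true] then signOp N else 1

/-- Permutes the rows of a matrix of bits: row `i` of the result is row `π i` of `y`. -/
def permRows {N : ℕ} (π : Perm (Fin N)) (y : Bits (N * N)) : Bits (N * N) := fun t =>
  y (finProdFinEquiv (π (finProdFinEquiv.symm t).1, (finProdFinEquiv.symm t).2))

/-- The unitary operator `|σ⟩ ↦ |σπ⟩`, extended to all basis states. -/
def rightMul {N : ℕ} (π : Perm (Fin N)) : OpMat (N * N) := basisMap (permRows π)

/-- Decryption: the controlled-`π` test, i.e. the measurement of the eigenvalue of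
`|σ⟩ ↦ |σπ⟩`. -/
noncomputable def decOp {N : ℕ} (π : Perm (Fin N)) (α : List Bool) : OpMat (N * N) :=
  if α = [false] then (1 / 2 : ℂ) • (1 + rightMul π)
  else if α = [true] then (1 / 2 : ℂ) • (1 - rightMul π)
  else 0

open Matrix in
theorem signOp_conjTranspose_mul (N : ℕ) : (signOp N).conjTranspose * signOp N = 1 := by
  classical
  rw [signOp, diagonal_conjTranspose, diagonal_mul_diagonal, ← diagonal_one]
  congr 1
  funext x
  simp only [Pi.star_apply]
  split_ifs <;> simp

theorem bits_injective {N : ℕ} : Function.Injective (bits (N := N)) := by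
  intro σ τ h
  ext i
  have := congrFun h (finProdFinEquiv (i, τ i))
  simp [bits] at this
  rw [this]

theorem signOp_mulVec_ket {N : ℕ} (σ : Perm (Fin N)) :
    (signOp N).mulVec (ket σ) = (((Perm.sign σ : ℤˣ) : ℤ) : ℂ) • ket σ := by
  classical
  funext x
  rw [signOp, Matrix.mulVec_diagonal]
  by_cases hx : x = bits σ
  · subst hx
    rcases Int.units_eq_one_or (Perm.sign σ) with h | h
    · rw [if_neg]
      · simp [h]
      · rintro ⟨τ, hτ, e⟩
        rw [bits_injective e, h] at hτ
        exact absurd hτ (by decide)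
    · rw [if_pos ⟨σ, h, rfl⟩]
      simp [h]
  · simp [ket, hx]

theorem permRows_bits {N : ℕ} (π σ : Perm (Fin N)) : permRows π (bits σ) = bits (σ * π) := by
  funext t
  unfold permRows bits
  rw [decide_eq_decide, Equiv.symm_apply_apply, Perm.mul_apply]

theorem permRows_permRows {N : ℕ} {π : Perm (Fin N)} (hπ : π * π = 1) (y : Bits (N * N)) :
    permRows π (permRows π y) = y := by
  have hp : ∀ i, π (π i) = i := fun i => by
    rw [← Perm.mul_apply, hπ, Perm.one_apply]
  funext t
  simp only [permRows, Equiv.symm_apply_apply, hp, Prod.mk.eta, Equiv.apply_symm_apply]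

theorem rightMul_mulVec_ket {N : ℕ} (π σ : Perm (Fin N)) :
    (rightMul π).mulVec (ket σ) = ket (σ * π) := by
  funext x
  rw [ket, Matrix.mulVec_single_one]
  simp only [rightMul, basisMap, Matrix.col_apply, ket, Pi.single_apply, permRows_bits]

theorem basisMap_mul {n : ℕ} (F G : Bits n → Bits n) :
    basisMap F * basisMap G = basisMap (F ∘ G) := by
  ext x y
  simp [basisMap, Matrix.mul_apply]

theorem rightMul_mul_self {N : ℕ} {π : Perm (Fin N)} (hπ : π * π = 1) :
    rightMul π * rightMul π = 1 := by
  rw [rightMul, basisMap_mul]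
  ext x y
  simp [basisMap, Matrix.one_apply, permRows_permRows hπ]

theorem rightMul_conjTranspose {N : ℕ} {π : Perm (Fin N)} (hπ : π * π = 1) :
    (rightMul π).conjTranspose = rightMul π := by
  ext x y
  have h : (y = permRows π x) = (x = permRows π y) := by
    refine propext ⟨?_, ?_⟩ <;> rintro rfl <;> rw [permRows_permRows hπ]
  simp only [Matrix.conjTranspose_apply, rightMul, basisMap, h]
  split_ifs <;> simp

theorem posSemidef_half {N : ℕ} {A : OpMat N} (hA : A.conjTranspose = A) (h : A * A = A + A) :
    ((1 / 2 : ℂ) • A).PosSemidef := by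
  have e : (1 / 2 : ℂ) • A = ((1 / 2 : ℂ) • A).conjTranspose * ((1 / 2 : ℂ) • A) := by
    rw [Matrix.conjTranspose_smul, hA, Matrix.smul_mul, Matrix.mul_smul, h, ← two_smul ℂ A,
      smul_smul, smul_smul]
    norm_num
  rw [e]
  exact Matrix.posSemidef_conjTranspose_mul_self _

theorem decOp_posSemidef {N : ℕ} {π : Perm (Fin N)} (hπ : π * π = 1) (α : List Bool) :
    (decOp π α).PosSemidef := by
  unfold decOp
  split_ifs
  · apply posSemidef_half
    · rw [Matrix.conjTranspose_add, rightMul_conjTranspose hπ, Matrix.conjTranspose_one]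
    · rw [mul_add, add_mul, add_mul, rightMul_mul_self hπ]
      simp only [mul_one, one_mul]
      abel
  · apply posSemidef_half
    · rw [Matrix.conjTranspose_sub, rightMul_conjTranspose hπ, Matrix.conjTranspose_one]
    · rw [mul_sub, sub_mul, sub_mul, rightMul_mul_self hπ]
      simp only [mul_one, one_mul]
      abel
  · exact Matrix.PosSemidef.zero

theorem decOp_sum {N : ℕ} (π : Perm (Fin N)) :
    ∑ α ∈ ({[false], [true]} : Finset (List Bool)), decOp π α = 1 := by
  rw [Finset.sum_pair (by decide)]
  simp only [decOp, if_true]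
  rw [if_neg (by decide), ← smul_add]
  rw [show (1 + rightMul π) + (1 - rightMul π) = (2 : ℂ) • (1 : OpMat (N * N)) by
    rw [two_smul]; abel, smul_smul]
  norm_num

theorem pubMat_posSemidef {N : ℕ} (π : Perm (Fin N)) : (pubMat π).PosSemidef := by
  unfold pubMat
  refine Matrix.PosSemidef.smul (Matrix.posSemidef_sum _ fun σ _ =>
    Matrix.posSemidef_vecMulVec_self_star _) ?_
  have : (1 / (2 * (Nat.factorial N : ℂ))) = ((1 / (2 * (Nat.factorial N : ℝ)) : ℝ) : ℂ) := by
    push_cast; rfl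
  rw [this]
  exact_mod_cast (by positivity : (0 : ℝ) ≤ 1 / (2 * (Nat.factorial N : ℝ)))

theorem pubMat_trace {N : ℕ} {π : Perm (Fin N)} (hπ : π ≠ 1) : (pubMat π).trace = 1 := by
  have h : ∀ σ : Perm (Fin N),
      (Matrix.vecMulVec (ket σ + ket (σ * π)) (star (ket σ + ket (σ * π)))).trace = 2 := by
    intro σ
    have hne : bits σ ≠ bits (σ * π) := fun e => hπ (by simpa using bits_injective e)
    rw [Matrix.trace_vecMulVec, star_add, dotProduct_add, add_dotProduct, add_dotProduct]
    simp [ket, hne, hne.symm]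
    norm_num
  rw [pubMat, Matrix.trace_smul, Matrix.trace_sum, Finset.sum_congr rfl fun σ _ => h σ]
  have : (Nat.factorial N : ℂ) ≠ 0 := by exact_mod_cast Nat.factorial_ne_zero N
  simp [Fintype.card_perm]
  field_simp

/-- The key is invariant under `|σ⟩ ↦ |σπ⟩`. -/
theorem rightMul_mul_pubMat {N : ℕ} {π : Perm (Fin N)} (hπ : π * π = 1) :
    rightMul π * pubMat π = pubMat π := by
  rw [pubMat, Matrix.mul_smul, Matrix.mul_sum]
  congr 1
  refine Finset.sum_congr rfl fun σ _ => ?_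
  rw [Matrix.mul_vecMulVec, Matrix.mulVec_add, rightMul_mulVec_ket, rightMul_mulVec_ket, mul_assoc,
    hπ, mul_one, add_comm (ket (σ * π))]

/-- The sign operator turns `ρ_π⁺` into `ρ_π⁻` if `π` is odd. -/
theorem signOp_conj_pubMat {N : ℕ} {π : Perm (Fin N)} (hs : Perm.sign π = -1) :
    signOp N * pubMat π * (signOp N).conjTranspose = (1 / (2 * (Nat.factorial N : ℂ))) •
      ∑ σ : Perm (Fin N),
        Matrix.vecMulVec (ket σ - ket (σ * π)) (star (ket σ - ket (σ * π))) := by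
  rw [pubMat, Matrix.mul_smul, Matrix.smul_mul, Matrix.mul_sum, Matrix.sum_mul]
  congr 1
  refine Finset.sum_congr rfl fun σ _ => ?_
  have h : (signOp N).mulVec (ket σ + ket (σ * π)) =
      (((Perm.sign σ : ℤˣ) : ℤ) : ℂ) • (ket σ - ket (σ * π)) := by
    rw [Matrix.mulVec_add, signOp_mulVec_ket, signOp_mulVec_ket, Perm.sign_mul, hs]
    simp [sub_eq_add_neg]
  rw [Matrix.mul_vecMulVec, Matrix.vecMulVec_mul, ← Matrix.star_mulVec, h]
  rcases Int.units_eq_one_or (Perm.sign σ) with e | e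
  · simp [e]
  · ext x y
    simp [e, Matrix.vecMulVec_apply]
    ring

theorem rightMul_mul_signOp_conj {N : ℕ} {π : Perm (Fin N)} (hπ : π * π = 1)
    (hs : Perm.sign π = -1) :
    rightMul π * (signOp N * pubMat π * (signOp N).conjTranspose) =
      -(signOp N * pubMat π * (signOp N).conjTranspose) := by
  rw [signOp_conj_pubMat hs, Matrix.mul_smul, Matrix.mul_sum, ← smul_neg, ← Finset.sum_neg_distrib]
  congr 1
  refine Finset.sum_congr rfl fun σ _ => ?_
  rw [Matrix.mul_vecMulVec, Matrix.mulVec_sub, rightMul_mulVec_ket, rightMul_mulVec_ket, mul_assoc,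
    hπ, mul_one, ← neg_sub, Matrix.neg_vecMulVec]

theorem secret_ne_one {n : ℕ} (π : Secret n) : π.1 ≠ 1 := by
  intro h
  have := π.2.2 0
  rw [h] at this
  exact this rfl

theorem secret_sign {n : ℕ} (π : Secret n) : Perm.sign π.1 = -1 := by
  have h0 : Fintype.card (Function.fixedPoints π.1) = 0 := by
    rw [Fintype.card_eq_zero_iff]
    exact ⟨fun x => π.2.2 x.1 x.2⟩
  rw [Perm.sign_of_pow_two_eq_one (by rw [pow_two]; exact π.2.1), h0, Fintype.card_fin]
  have : (deg n - 0) / 2 = 2 * n + 1 := by simp only [deg]; omega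
  rw [this, pow_succ, pow_mul]
  simp

instance secretNonempty (n : ℕ) : Nonempty (Secret n) := by
  refine ⟨⟨Fin.revPerm, ?_, ?_⟩⟩
  · ext i
    simp
  · intro i h
    have := congrArg Fin.val h
    simp only [Fin.revPerm_apply, Fin.val_rev, deg] at this
    omega

theorem enc_dec {n : ℕ} (π : Secret n) {α : List Bool}
    (hα : α ∈ ({[false], [true]} : Finset (List Bool))) :
    (decOp π.1 α * applyKraus [encOp (deg n) α] (pubMat π.1)).trace = 1 := by
  have hπ := π.2.1
  have tr : (signOp (deg n) * pubMat π.1 * (signOp (deg n)).conjTranspose).trace = 1 := by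
    rw [Matrix.trace_mul_comm, ← mul_assoc, signOp_conjTranspose_mul, one_mul,
      pubMat_trace (secret_ne_one π)]
  have half : ∀ A : OpMat (deg n * deg n), (1 / 2 : ℂ) • (A + A) = A := fun A => by
    rw [← two_smul ℂ A, smul_smul]; norm_num
  simp only [Finset.mem_insert, Finset.mem_singleton] at hα
  simp only [applyKraus, List.map_cons, List.map_nil, List.sum_cons, List.sum_nil, add_zero]
  rcases hα with rfl | rfl
  · simp only [decOp, encOp, if_true]
    rw [if_neg (by decide), Matrix.conjTranspose_one, Matrix.one_mul, Matrix.mul_one, Matrix.smul_mul,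
      Matrix.add_mul,
      Matrix.one_mul, rightMul_mul_pubMat hπ, half, pubMat_trace (secret_ne_one π)]
  · simp only [decOp, encOp, if_true]
    rw [if_neg (by decide), Matrix.smul_mul, Matrix.sub_mul, Matrix.one_mul,
      rightMul_mul_signOp_conj hπ (secret_sign π), sub_neg_eq_add, half, tr]

/-- The cryptosystem: the decryption key is a uniformly random involution `π` without fixed points,
the encryption key is `ρ_π⁺`, and a message is one bit. -/
noncomputable def system : Cryptosystem where
  SecretKey := Secret
  secretFintype := fun _ => inferInstance
  keyDist := fun n => PMF.uniformOfFintype (Secret n)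
  pubQubits := fun n => deg n * deg n
  pub := fun _ π => pubMat π.1
  pub_posSemidef := fun _ π => pubMat_posSemidef π.1
  pub_trace := fun _ π => pubMat_trace (secret_ne_one π)
  msgs := fun _ => {[false], [true]}
  ctQubits := fun n => deg n * deg n
  kraus := fun n α => [encOp (deg n) α]
  kraus_sum := fun n α => by
    simp only [List.map_cons, List.map_nil, List.sum_cons, List.sum_nil, add_zero, encOp]
    split_ifs
    · exact signOp_conjTranspose_mul _
    · simp
  dec := fun _ π α => decOp π.1 α
  dec_posSemidef := fun _ π α => decOp_posSemidef π.2.1 α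
  dec_sum := fun _ π => decOp_sum π.1
  correct := fun _ π _ _ hα => enc_dec π hα

end KKNY

end QPK

/-! The transformation leaves the adversary alone: it hands on `(C, a)` itself, and `k' = k + 1`,
the surplus copy of the key being fed in where `C` expects the ciphertext. An encryption of 0 is
just such a copy, so the two experiments differ only on the message 1, and their difference is `Pr[X
= 1]` times `signAdvantage`, the mean gain from seeing `ρ⁻` in place of one more `ρ⁺`
(`realSuccess_sub_idealSuccess`). If this gain is at least `1 / P(n)` for infinitely many `n`, graph
automorphism is solved on `m = 2n + 1` vertices for these `n` (`exists_solvesGA`), against the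
hypothesis.

Two copies of a graph `G` on `m` vertices have `4n + 2 = N` vertices. For a pair `i ≠ j`,
individualise by colours the vertices up to `i` in the first copy, and in the second copy the
vertices before `i` together with `j`, which gets the colour of `i`. If `G` is rigid, so is the
coloured structure, for every pair. Otherwise, for some pair, its only non-trivial automorphism is
an involution `π` without fixed points (`exists_respects_iff`). Superpose over `σ` the states
`|σ⟩|structure relabelled by στ⟩` and ignore the second register. What is left is the sum of
`|σ⟩⟨σ'| / N!` over the `σ, σ'` with equal relabellings, i.e. with `σ' ∈ σ · τ Aut τ⁻¹`
(`orbitMat`). For `Aut = {1, π}` this is `ρ⁺` for the key `τπτ⁻¹`, or `ρ⁻` if each `|σ⟩` carries the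
factor `sgn σ`, because `π` is odd; a random `τ` makes the key uniform (`sum_conjSecret`). For
trivial `Aut` the state is diagonal and the signs cancel. Thus the advantage of the adversary on
these states is exactly 0 for a rigid graph, and is `signAdvantage` for a non-rigid graph and the
right pair.

A random bit decides whether the last register carries the signs, and a swap test compares the
output of the adversary with `f(1)`, with a phase on the control wire that reverses the test when
the signs are present. The resulting bit is true with probability `1/2` for rigid graphs and `1/2 +
signAdvantage / 4` in the good case (`trueWeight_run`). For the other pairs the bias is unknown and
may have either sign. Hence two runs with the same pair are compared: they differ with probability
`2p(1 - p)`, which never exceeds `1/2`, so nothing cancels on averaging over pairs and a gap of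
`signAdvantage² / (8m²)` remains. Chebyshev's inequality detects it in polynomially many repetitions
(`exists_amplified`).

Everything random and everything that does not depend on `G` is put into one pure advice state: the
pair, `τ`, the sign bit, the permutations `σ`, the relabelled colours, and copies of the advice, of
`h(1)` and of `f(1)`. Only the relabelling of `G` is computed from the input, by reversible
classical gates, followed by the adversary, the swap test and a counter. -/

namespace QPK

/-! ### The trivial transformation -/

namespace KeepAdversary

/-- Counts the symbols of a word that follow its first `3 - c` zeros. -/
def restLength : Fin 4 → List Bool → ℕ
  | _, [] => 0
  | 3, _ :: l => restLength 3 l + 1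
  | c, b :: l => restLength (if b then c else c + 1) l

inductive Stack where
  | input
  | output
  deriving DecidableEq

instance : Fintype Stack := ⟨{Stack.input, Stack.output}, fun x => by cases x <;> simp⟩

inductive Label where
  | start
  | loop
  deriving DecidableEq

instance : Fintype Label := ⟨{Label.start, Label.loop}, fun x => by cases x <;> simp⟩

/-- Variables: the symbol that was read, and the number of zeros that have been read. -/
abbrev Vars : Type := Option Bool × Fin 4

-- The output stack is read from its top, so the word `0 1^a 0` is written backwards: its final zero
-- at the start, a one for each symbol behind the third zero of the input, and the leading zero when
-- the input is exhausted. The variables are reset before halting because the prescribed final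
-- configuration contains the initial ones.
open Turing.TM2.Stmt in
def program : Label → Turing.TM2.Stmt (fun _ : Stack => Bool) Label Vars
  | .start => push .output (fun _ => false) (goto fun _ => .loop)
  | .loop => pop .input (fun v b => (b, v.2))
      (branch (fun v => v.1.isNone)
        (push .output (fun _ => false) (load (fun _ => (none, 0)) halt))
        (branch (fun v => v.2 = 3)
          (push .output (fun _ => true) (goto fun _ => .loop))
          (load (fun v => (v.1, if v.1 = some true then v.2 else v.2 + 1)) (goto fun _ => .loop))))

def machine : Turing.FinTM2 where
  K := Stack
  k₀ := .input
  k₁ := .output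
  Γ _ := Bool
  Λ := Label
  main := .start
  σ := Vars
  initialState := (none, 0)
  Γk₀Fin := inferInstanceAs (Fintype Bool)
  m := program

def contents (l o : List Bool) : Stack → List Bool
  | .input => l
  | .output => o

theorem update_output (l o o' : List Bool) :
    Function.update (contents l o) .output o' = contents l o' := by
  funext s
  cases s <;> simp [contents]

theorem update_input (l o l' : List Bool) :
    Function.update (contents l o) .input l' = contents l' o := by
  funext s
  cases s <;> simp [contents]

theorem restLength_three (l : List Bool) : restLength 3 l = l.length := by
  induction l with
  | nil => rfl
  | cons b l ih => simp [restLength, ih]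

def loopCfg (b : Option Bool) (c : Fin 4) (l o : List Bool) : machine.Cfg :=
  ⟨some Label.loop, ((b, c) : Vars), contents l o⟩

def haltCfg (o : List Bool) : machine.Cfg := ⟨none, ((none, 0) : Vars), contents [] o⟩

theorem step_nil (b : Option Bool) (c : Fin 4) (o : List Bool) :
    machine.step (loopCfg b c [] o) = some (haltCfg (false :: o)) := by
  change some (Turing.TM2.stepAux (program .loop) ((b, c) : Vars) (contents [] o)) = _
  simp [program, update_input, update_output, contents, haltCfg]
  rfl

theorem step_cons_of_ne (b : Option Bool) (s : Bool) (c : Fin 4) (hc : c ≠ 3) (l o : List Bool) :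
    machine.step (loopCfg b c (s :: l) o) =
      some (loopCfg (some s) (if s then c else c + 1) l o) := by
  change some (Turing.TM2.stepAux (program .loop) ((b, c) : Vars) (contents (s :: l) o)) = _
  simp [program, update_input, contents, loopCfg, hc]
  rfl

theorem step_cons_three (b : Option Bool) (s : Bool) (l o : List Bool) :
    machine.step (loopCfg b 3 (s :: l) o) = some (loopCfg (some s) 3 l (true :: o)) := by
  change some (Turing.TM2.stepAux (program .loop) ((b, 3) : Vars) (contents (s :: l) o)) = _
  simp [program, update_input, update_output, contents, loopCfg]
  rfl

theorem iterate_loop (l : List Bool) (b : Option Bool) (c : Fin 4) (o : List Bool) :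
    (flip bind machine.step)^[l.length + 1] (some (loopCfg b c l o)) =
      some (haltCfg (false :: (List.replicate (restLength c l) true ++ o))) := by
  induction l generalizing b c o with
  | nil =>
      change machine.step (loopCfg b c [] o) = _
      rw [step_nil]
      cases c using Fin.cases <;> simp [restLength]
  | cons s l ih =>
      rw [List.length_cons, Function.iterate_succ_apply]
      change (flip bind machine.step)^[l.length + 1] (machine.step (loopCfg b c (s :: l) o)) = _
      by_cases hc : c = 3
      · subst hc
        rw [step_cons_three, ih]
        simp only [restLength, List.replicate_succ']
        simp
      · rw [step_cons_of_ne _ _ _ hc, ih, restLength.eq_3 _ _ _ hc]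

/-- `1^{a} 0` with `a` the number of symbols behind the third zero, and a leading zero. -/
def gen (w : List Bool) : List Bool := encodeNats [0, restLength 0 w]

theorem iterate_start (w : List Bool) :
    (flip bind machine.step)^[w.length + 2] (some (Turing.initList machine w)) =
      some (Turing.haltList machine (gen w)) := by
  have h0 : Turing.initList machine w = ⟨some Label.start, ((none, 0) : Vars), contents w []⟩ := by
    unfold Turing.initList
    congr 1
    funext k
    cases k <;> rfl
  have h1 : Turing.haltList machine (gen w) = haltCfg (gen w) := by
    unfold Turing.haltList haltCfg
    congr 1
    funext k
    cases k <;> rfl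
  have h2 : machine.step ⟨some Label.start, ((none, 0) : Vars), contents w []⟩ =
      some (loopCfg none 0 w [false]) := by
    change some (Turing.TM2.stepAux (program .start) _ (contents w [])) = _
    simp [program, update_output, loopCfg, contents]
    rfl
  rw [h0, h1, Function.iterate_succ_apply]
  refine (congrArg (flip bind machine.step)^[w.length + 1] h2).trans ?_
  rw [iterate_loop]
  simp [gen, encodeNats]

noncomputable def polyTime :
    Turing.TM2ComputableInPolyTime (αΓ := Bool) (βΓ := Bool) id id gen where
  tm := machine
  inputAlphabet := Equiv.refl Bool
  outputAlphabet := Equiv.refl Bool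
  time := Polynomial.X + 2
  outputsFun w :=
    -- One step writes the final zero, one is spent on each symbol, and one on noticing the end of
    -- the input.
    { steps := w.length + 2
      evals_in_steps := by
        convert iterate_start w
        · exact congrArg (Turing.initList machine) (List.map_id w)
        · exact congrArg (fun v => some (Turing.haltList machine v)) (List.map_id (gen w))
      steps_le_m := by simp }

end KeepAdversary

/-- The transformation that keeps the adversary: it measures the description of the circuit. -/
def keepAdversary : Transformation := ⟨KeepAdversary.gen, ⟨KeepAdversary.polyTime⟩⟩

end QPK

/-! ### The transformed adversary is the original one. -/

namespace QPK

/-- Registers built in different ways have numbers of qubits that agree only propositionally; the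
labels are compared along the cast. -/
theorem QOp.ext_cast {ρ τ : QOp} (h : ρ.qubits = τ.qubits)
    (hm : ∀ x y, ρ.mat x y = τ.mat (fun i => x (Fin.cast h.symm i)) (fun i => y (Fin.cast h.symm i))) :
    ρ = τ := by
  obtain ⟨q, A⟩ := ρ
  obtain ⟨q', B⟩ := τ
  obtain rfl : q = q' := h
  congr 1
  ext x y
  exact hm x y

theorem QOp.overlap_eq_zero {ρ : QOp} (h : ρ.mat = 0) (ψ : Ket) : ρ.overlap ψ = 0 := by
  unfold QOp.overlap
  split_ifs
  · simp [h]
  · rfl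

theorem Circuit.output_mat_eq_zero {ρ : QOp} (h : ρ.mat = 0) (C : Circuit) :
    (C.output ρ).mat = 0 := by
  ext x y
  have : (ρ.addAncillas C.anc).mat = 0 := by
    ext x y
    simp [QOp.addAncillas, h]
  simp [Circuit.output, QOp.takeFirst, Circuit.final, QOp.applyGates, this]

/-- Measuring a register in a basis state gives its label with certainty and leaves the other tensor
factor untouched. The remaining outcomes leave the zero operator, on which `F` is assumed to vanish.
-/
theorem sum_measured_description (w : List Bool) (a : Ket) (c : Circuit)
    (hc : c = ⟨0, w.length, []⟩) (F : Circuit → QOp → ℝ)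
    (hF : ∀ C ρ, ρ.mat = 0 → F C ρ = 0) :
    ∑ y : Bits (min c.out (c.final ((Ket.ofBits w).toOp.tensor a.toOp)).qubits),
      F (Circuit.decode (List.ofFn y))
        ((c.final ((Ket.ofBits w).toOp.tensor a.toOp)).afterMeasure c.out y) =
      F (Circuit.decode w) a.toOp := by
  subst hc
  set ρ := (Ket.ofBits w).toOp.tensor a.toOp
  set c : Circuit := ⟨0, w.length, []⟩
  have hq : (c.final ρ).qubits = w.length + a.qubits := rfl
  have hmin : min c.out (c.final ρ).qubits = w.length := by
    rw [hq]; exact min_eq_left (Nat.le_add_right _ _)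
  have hmat : ∀ x y : Bits (w.length + a.qubits), (c.final ρ).mat x y = ρ.mat x y := by
    intro x y
    have : (c.final ρ).mat = (ρ.addAncillas 0).mat := by
      simp [Circuit.final, QOp.applyGates, gatesOp, c]
    rw [this]
    simp [QOp.addAncillas]
  have hjoin : ∀ (y : Bits (min c.out (c.final ρ).qubits))
      (z : Bits ((c.final ρ).qubits - min c.out (c.final ρ).qubits)) (i : Fin w.length),
      (y.join z : Bits (c.final ρ).qubits) (Fin.castAdd a.qubits i) = y (Fin.cast hmin.symm i) := by
    intro y z i
    unfold Bits.join
    exact dif_pos (hmin ▸ i.2)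
  have hsub : (c.final ρ).qubits - min c.out (c.final ρ).qubits = a.qubits := by
    rw [hmin, hq]; omega
  have hjoin' : ∀ (y : Bits (min c.out (c.final ρ).qubits))
      (z : Bits ((c.final ρ).qubits - min c.out (c.final ρ).qubits)) (i : Fin a.qubits),
      (y.join z : Bits (c.final ρ).qubits) (Fin.natAdd w.length i) = z (Fin.cast hsub.symm i) := by
    intro y z i
    unfold Bits.join
    have hi : ¬ (Fin.natAdd w.length i).val < min c.out (c.final ρ).qubits := by
      rw [hmin]
      exact Nat.not_lt.2 (Nat.le_add_right _ _)
    refine (dif_neg hi).trans (congrArg z (Fin.ext ?_))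
    change w.length + i.val - min c.out (c.final ρ).qubits = i.val
    rw [hmin]
    exact Nat.add_sub_cancel_left _ _
  have hent : ∀ (y : Bits (min c.out (c.final ρ).qubits)) z z',
      ((c.final ρ).afterMeasure c.out y).mat z z' =
        (if (fun i => y (Fin.cast hmin.symm i)) = w.get then 1 else 0) *
          a.toOp.mat (fun i => z (Fin.cast hsub.symm i)) (fun i => z' (Fin.cast hsub.symm i)) := by
    intro y z z'
    change (c.final ρ).mat (y.join z) (y.join z') = _
    refine (hmat _ _).trans ?_
    simp only [ρ, QOp.tensor]
    congr 1
    · simp only [Ket.toOp, Ket.ofBits, Matrix.vecMulVec_apply, Pi.star_apply]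
      erw [funext (hjoin y z), funext (hjoin y z')]
      by_cases hw : (fun i => y (Fin.cast hmin.symm i)) = w.get
      · erw [if_pos hw, hw]
        simp
      · erw [if_neg hw, Pi.single_eq_of_ne hw]
        simp
    · congr 1
      · funext i
        exact hjoin' y z i
      · funext i
        exact hjoin' y z' i
  -- The only outcome of non-zero weight.
  let y₀ : Bits (min c.out (c.final ρ).qubits) := fun i => w.get (Fin.cast hmin i)
  rw [Finset.sum_eq_single y₀]
  · have e1 : List.ofFn y₀ = w := by
      rw [List.ofFn_congr hmin]
      simp [y₀]
    have e2 : (c.final ρ).afterMeasure c.out y₀ = a.toOp := by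
      refine QOp.ext_cast hsub fun x y => ?_
      rw [hent, if_pos (by funext i; simp [y₀]), one_mul]
      rfl
    rw [e1, e2]
  · intro y _ hy
    apply hF
    ext z z'
    rw [hent, if_neg, zero_mul]
    · rfl
    · intro h
      apply hy
      funext i
      have := congrFun h (Fin.cast hmin i)
      simpa [y₀] using this
  · simp

theorem KeepAdversary.restLength_block (c : Fin 4) (hc : c ≠ 3) (a : ℕ) (w : List Bool) :
    restLength c (List.replicate a true ++ false :: w) = restLength (c + 1) w := by
  induction a with
  | zero => simp [restLength.eq_3 _ _ _ hc]
  | succ a ih => simp [List.replicate_succ, restLength.eq_3 _ _ _ hc, ih]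

/-- The three unary numbers in front of the description of `C` contain exactly the three zeros that
are skipped, so the symbols counted are those of the description. The circuit does nothing and
measures that many wires. -/
theorem keepAdversary_circuit (n k : ℕ) (C : Circuit) (a : Ket) :
    keepAdversary.circuit n k C a = ⟨0, C.encode.length, []⟩ := by
  have : KeepAdversary.restLength 0 (encodeNats [n, k, a.qubits] ++ C.encode) =
      C.encode.length := by
    simp only [encodeNats, List.flatMap_cons, List.flatMap_nil, List.append_assoc, List.append_nil,
      List.cons_append, List.nil_append]
    rw [KeepAdversary.restLength_block _ (by decide), KeepAdversary.restLength_block _ (by decide),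
      KeepAdversary.restLength_block _ (by decide)]
    exact KeepAdversary.restLength_three _
  simp only [Transformation.circuit, keepAdversary, KeepAdversary.gen, this, Circuit.decode,
    decodeNatsAux_encodeNats, readGates]

theorem idealSuccess_keepAdversary (S : Cryptosystem) (n k k' : ℕ) (C : Circuit) (a : Ket)
    (X : PMF (S.msgs n)) (f h : List Bool → Ket) :
    S.idealSuccess keepAdversary n k k' C a X f h =
      ∑ d : S.SecretKey n, ∑ α : S.msgs n,
        (C.output (((S.key n d).tensorPow k').tensor (a.toOp.tensor (h α).toOp))).overlap (f α) *
          ((S.keyDist n d).toReal * (X α).toReal) := by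
  unfold Cryptosystem.idealSuccess
  refine Finset.sum_congr rfl fun d _ => Finset.sum_congr rfl fun α _ => ?_
  have := sum_measured_description C.encode a _ (keepAdversary_circuit n k C a)
    (fun C' ρ => (C'.output (((S.key n d).tensorPow k').tensor
      (ρ.tensor (h α).toOp))).overlap (f α) * ((S.keyDist n d).toReal * (X α).toReal))
    (fun C' ρ hρ => by
      rw [QOp.overlap_eq_zero, zero_mul]
      apply Circuit.output_mat_eq_zero
      ext x y
      simp [QOp.tensor, hρ])
  rw [Circuit.decode_encode] at this
  exact this

end QPK

namespace QPK

/-! ### Gates on wires of arbitrary type -/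

/-- Vectors of amplitudes of a register whose wires are indexed by `ι`. -/
abbrev Amp (ι : Type) : Type := (ι → Bool) → ℂ

/-- Elementary gates on wires indexed by `ι`. -/
inductive WGate (ι : Type) where
  | not (i : ι)
  | had (i : ι)
  | tee (i : ι)
  | cnot (i j : ι)
  | toffoli (i j k : ι)

namespace WGate

variable {ι κ : Type}

def map (e : ι → κ) : WGate ι → WGate κ
  | .not i => .not (e i)
  | .had i => .had (e i)
  | .tee i => .tee (e i)
  | .cnot i j => .cnot (e i) (e j)
  | .toffoli i j k => .toffoli (e i) (e j) (e k)

/-- The gates that permute the computational basis. -/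
def Classical : WGate ι → Prop
  | .had _ => False
  | .tee _ => False
  | _ => True

variable [DecidableEq ι] [DecidableEq κ]

/-- The action of a gate on the computational basis (the identity for the Hadamard and `π/8`
gates). -/
def run : WGate ι → (ι → Bool) → (ι → Bool)
  | .not i, x => Function.update x i (!(x i))
  | .had _, x => x
  | .tee _, x => x
  | .cnot i j, x => if i ≠ j then Function.update x j ((x j).xor (x i)) else x
  | .toffoli i j k, x =>
      if i ≠ j ∧ i ≠ k ∧ j ≠ k then Function.update x k ((x k).xor (x i && x j)) else x

theorem run_run (g : WGate ι) (x : ι → Bool) : g.run (g.run x) = x := by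
  cases g with
  | not i => simp [run]
  | had i => rfl
  | tee i => rfl
  | cnot i j =>
      by_cases h : i = j
      · simp [run, h]
      · simp [run, h]
  | toffoli i j k =>
      by_cases h : i ≠ j ∧ i ≠ k ∧ j ≠ k
      · simp [run, h]
      · simp [run, h]

theorem run_involutive (g : WGate ι) : Function.Involutive g.run := g.run_run

/-- The linear map that applies a one-qubit operator to one wire. -/
noncomputable def oneWire (A : Matrix Bool Bool ℂ) (i : ι) : Amp ι →ₗ[ℂ] Amp ι where
  toFun ψ x := ∑ b, A (x i) b * ψ (Function.update x i b)
  map_add' ψ φ := by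
    funext x
    simp only [Pi.add_apply, mul_add, Finset.sum_add_distrib]
  map_smul' c ψ := by
    funext x
    simp only [Pi.smul_apply, smul_eq_mul, RingHom.id_apply, Finset.mul_sum]
    exact Finset.sum_congr rfl fun b _ => by ring

/-- The unitary operator of a gate. -/
noncomputable def app : WGate ι → (Amp ι →ₗ[ℂ] Amp ι)
  | .had i => oneWire hadMat i
  | .tee i => oneWire teeMat i
  | g => LinearMap.funLeft ℂ ℂ g.run

/-- A gate moves the amplitude at `x` to its image, which means precomposition with the inverse of
`run`; as `run` is an involution, precomposition with `run` itself is correct. -/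
theorem app_of_classical {g : WGate ι} (h : g.Classical) (ψ : Amp ι) (x : ι → Bool) :
    g.app ψ x = ψ (g.run x) := by
  cases g <;> first | rfl | exact h.elim

end WGate

/-! ### Lists of gates as operators and as maps of basis labels. -/

section List

variable {ι κ : Type} [DecidableEq ι] [DecidableEq κ]

/-- Applies a list of gates in order. -/
noncomputable def appList (gs : List (WGate ι)) : Amp ι →ₗ[ℂ] Amp ι :=
  gs.foldl (fun V g => g.app ∘ₗ V) LinearMap.id

theorem foldl_app (gs : List (WGate ι)) (V : Amp ι →ₗ[ℂ] Amp ι) :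
    gs.foldl (fun V g => g.app ∘ₗ V) V = appList gs ∘ₗ V := by
  induction gs generalizing V with
  | nil => rfl
  | cons g gs ih =>
      rw [List.foldl_cons, ih]
      change _ = (List.foldl (fun V g => g.app ∘ₗ V) LinearMap.id (g :: gs)) ∘ₗ V
      rw [List.foldl_cons, ih, LinearMap.comp_id, LinearMap.comp_assoc]

@[simp]
theorem appList_nil : appList ([] : List (WGate ι)) = LinearMap.id := rfl

theorem appList_cons (g : WGate ι) (gs : List (WGate ι)) (ψ : Amp ι) :
    appList (g :: gs) ψ = appList gs (g.app ψ) := by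
  rw [appList, List.foldl_cons, foldl_app]
  rfl

theorem appList_append (gs hs : List (WGate ι)) (ψ : Amp ι) :
    appList (gs ++ hs) ψ = appList hs (appList gs ψ) := by
  induction gs generalizing ψ with
  | nil => rfl
  | cons g gs ih => rw [List.cons_append, appList_cons, ih, appList_cons]

/-- Runs a list of classical gates on a basis label. -/
def runList (gs : List (WGate ι)) (x : ι → Bool) : ι → Bool := gs.foldl (fun y g => g.run y) x

@[simp]
theorem runList_nil (x : ι → Bool) : runList [] x = x := rfl

theorem runList_cons (g : WGate ι) (gs : List (WGate ι)) (x : ι → Bool) :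
    runList (g :: gs) x = runList gs (g.run x) := rfl

theorem runList_append (gs hs : List (WGate ι)) (x : ι → Bool) :
    runList (gs ++ hs) x = runList hs (runList gs x) := by
  simp [runList]

theorem runList_bijective (gs : List (WGate ι)) : Function.Bijective (runList gs) := by
  induction gs with
  | nil => exact Function.bijective_id
  | cons g gs ih => exact ih.comp g.run_involutive.bijective

theorem appList_runList {gs : List (WGate ι)} (h : ∀ g ∈ gs, g.Classical) (ψ : Amp ι)
    (x : ι → Bool) : appList gs ψ (runList gs x) = ψ x := by
  induction gs generalizing ψ x with
  | nil => rfl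
  | cons g gs ih =>
      rw [appList_cons, runList_cons, ih fun g' hg => h g' (List.mem_cons_of_mem _ hg),
        WGate.app_of_classical (h g List.mem_cons_self), WGate.run_run]

/-- Classical gates permute the amplitudes, so measuring after a classical computation amounts to
measuring before it and computing on the outcome. -/
theorem sum_appList_of_classical [Fintype ι] {gs : List (WGate ι)} (h : ∀ g ∈ gs, g.Classical)
    (ψ : Amp ι) (p : (ι → Bool) → ℝ → ℝ) :
    ∑ x, p x (‖appList gs ψ x‖ ^ 2) = ∑ x, p (runList gs x) (‖ψ x‖ ^ 2) := by
  rw [← (runList_bijective gs).sum_comp]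
  simp only [appList_runList h]

/-- Two vectors are related by a list of classical gates if their amplitudes are. -/
theorem appList_eq_of_classical {gs : List (WGate ι)} (h : ∀ g ∈ gs, g.Classical) {ψ φ : Amp ι}
    (hφ : ∀ x, φ (runList gs x) = ψ x) : appList gs ψ = φ := by
  funext y
  obtain ⟨x, rfl⟩ := (runList_bijective gs).2 y
  rw [appList_runList h, hφ]

end List

/-! ### Locality -/

section Locality

variable {ι κ : Type} [DecidableEq ι] [DecidableEq κ]

/-- `Function.extend e y x` is the label with the values `y` on the wires in the range of `e` and
`x` elsewhere. It serves throughout to single out a sub-register while the other wires keep fixed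
values. -/
theorem extend_update {e : ι → κ} (he : Function.Injective e) (y : ι → Bool) (x : κ → Bool)
    (i : ι) (b : Bool) :
    Function.extend e (Function.update y i b) x =
      Function.update (Function.extend e y x) (e i) b := by
  funext k
  by_cases hk : ∃ j, e j = k
  · obtain ⟨j, rfl⟩ := hk
    rw [he.extend_apply]
    by_cases hj : j = i
    · subst hj; simp
    · rw [Function.update_of_ne hj, Function.update_of_ne (he.ne hj), he.extend_apply]
  · rw [Function.extend_apply' _ _ _ hk, Function.update_of_ne, Function.extend_apply' _ _ _ hk]
    rintro rfl
    exact hk ⟨i, rfl⟩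

theorem extend_comp_self {α β : Type} {e : α → β} (he : Function.Injective e) (x : β → Bool) :
    Function.extend e (x ∘ e) x = x := by
  funext k
  by_cases hk : ∃ j, e j = k
  · obtain ⟨j, rfl⟩ := hk
    rw [he.extend_apply]
    rfl
  · rw [Function.extend_apply' _ _ _ hk]

theorem WGate.run_map {e : ι → κ} (he : Function.Injective e) (g : WGate ι) (y : ι → Bool)
    (x : κ → Bool) :
    (g.map e).run (Function.extend e y x) = Function.extend e (g.run y) x := by
  cases g with
  | not i => simp [run, map, extend_update he, he.extend_apply]
  | had i => rfl
  | tee i => rfl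
  | cnot i j =>
      simp only [run, map, he.ne_iff, he.extend_apply]
      split_ifs
      · rw [extend_update he]
      · rfl
  | toffoli i j k =>
      simp only [run, map, he.ne_iff, he.extend_apply]
      split_ifs
      · rw [extend_update he]
      · rfl

theorem WGate.app_map {e : ι → κ} (he : Function.Injective e) (g : WGate ι) (ψ : Amp κ)
    (y : ι → Bool) (x : κ → Bool) :
    (g.map e).app ψ (Function.extend e y x) =
      g.app (fun z => ψ (Function.extend e z x)) y := by
  cases g with
  | had i => simp [app, map, oneWire, extend_update he, he.extend_apply]
  | tee i => simp [app, map, oneWire, extend_update he, he.extend_apply]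
  | not i =>
      exact congrArg ψ (run_map he (.not i) y x)
  | cnot i j =>
      exact congrArg ψ (run_map he (.cnot i j) y x)
  | toffoli i j k =>
      exact congrArg ψ (run_map he (.toffoli i j k) y x)

/-- Gates on a subset of the wires act on the slices of a vector in which the other wires have fixed
values. -/
theorem appList_map {e : ι → κ} (he : Function.Injective e) (gs : List (WGate ι)) (ψ : Amp κ)
    (y : ι → Bool) (x : κ → Bool) :
    appList (gs.map (WGate.map e)) ψ (Function.extend e y x) =
      appList gs (fun z => ψ (Function.extend e z x)) y := by
  induction gs generalizing ψ y with
  | nil => rfl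
  | cons g gs ih =>
      rw [List.map_cons, appList_cons, ih, appList_cons]
      exact congrArg (fun φ => appList gs φ y) (funext fun z => WGate.app_map he g ψ z x)

theorem appList_map_equiv (e : ι ≃ κ) (gs : List (WGate ι)) (ψ : Amp κ) (x : κ → Bool) :
    appList (gs.map (WGate.map e)) ψ x = appList gs (fun z => ψ (z ∘ e.symm)) (x ∘ e) := by
  have hx : ∀ z : ι → Bool, Function.extend e z x = z ∘ e.symm := fun z => by
    funext k
    obtain ⟨j, rfl⟩ := e.surjective k
    rw [e.injective.extend_apply]
    simp
  have := appList_map e.injective gs ψ (x ∘ e) x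
  rw [extend_comp_self e.injective] at this
  rw [this]
  exact congrArg (fun φ => appList gs φ (x ∘ e)) (funext fun z => by rw [hx])

end Locality

/-! ### Unitarity -/

section Unitary

variable {ι : Type} [DecidableEq ι] [Fintype ι]

/-- Every label arises twice: from itself and from the label with the bit `i` flipped. -/
theorem sum_update (i : ι) (F : (ι → Bool) → ℂ) :
    ∑ x, ∑ b, F (Function.update x i b) = 2 * ∑ x, F x := by
  have h : ∀ x : ι → Bool, ∑ b, F (Function.update x i b) =
      F x + F (Function.update x i (!(x i))) := by
    intro x
    rw [Fintype.sum_bool]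
    cases hx : x i
    · rw [add_comm, ← hx, Function.update_eq_self, hx]; rfl
    · rw [← hx, Function.update_eq_self, hx]; rfl
  simp only [h, Finset.sum_add_distrib]
  rw [two_mul]
  congr 1
  exact (WGate.run_involutive (.not i : WGate ι)).bijective.sum_comp F

theorem oneWire_inner {A : Matrix Bool Bool ℂ} (hA : A.conjTranspose * A = 1) (i : ι)
    (φ ψ : Amp ι) :
    ∑ x, star (WGate.oneWire A i φ x) * WGate.oneWire A i ψ x = ∑ x, star (φ x) * ψ x := by
  -- Doubling both sides allows summing over pairs of labels that differ at most at `i`; on each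
  -- pair the claim is the unitarity of the two-by-two matrix.
  have h2 : (2 : ℂ) ≠ 0 := two_ne_zero
  apply mul_left_cancel₀ h2
  rw [← sum_update i, ← sum_update i]
  refine Finset.sum_congr rfl fun x _ => ?_
  have hA' : ∀ a b, ∑ c, star (A c a) * A c b = if a = b then 1 else 0 := by
    intro a b
    have := congrFun (congrFun hA a) b
    rw [Matrix.mul_apply, Matrix.one_apply] at this
    exact this
  simp only [WGate.oneWire, LinearMap.coe_mk, AddHom.coe_mk, Function.update_self,
    Function.update_idem]
  set p := fun b => φ (Function.update x i b)
  set r := fun b => ψ (Function.update x i b)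
  change ∑ c, star (∑ b, A c b * p b) * ∑ b, A c b * r b = ∑ b, star (p b) * r b
  have h00 := hA' false false
  have h01 := hA' false true
  have h10 := hA' true false
  have h11 := hA' true true
  simp only [Fintype.sum_bool] at *
  simp only [star_add, star_mul'] at *
  simp at h00 h01 h10 h11
  simp
  linear_combination (starRingEnd ℂ (p false)) * r false * h00 +
    (starRingEnd ℂ (p false)) * r true * h01 + (starRingEnd ℂ (p true)) * r false * h10 +
    (starRingEnd ℂ (p true)) * r true * h11

theorem hadMat_unitary : hadMat.conjTranspose * hadMat = 1 := by
  have h : (Real.sqrt 2 : ℂ) * (Real.sqrt 2 : ℂ) = 2 := by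
    rw [← Complex.ofReal_mul, Real.mul_self_sqrt (by norm_num)]
    norm_num
  have h0 : (Real.sqrt 2 : ℂ) ≠ 0 := by
    intro h'
    rw [h'] at h
    norm_num at h
  ext a b
  rw [Matrix.mul_apply, Fintype.sum_bool]
  cases a <;> cases b <;> simp [hadMat] <;> field_simp <;> norm_num [pow_two, h]

theorem teeMat_unitary : teeMat.conjTranspose * teeMat = 1 := by
  rw [teeMat, Matrix.diagonal_conjTranspose, Matrix.diagonal_mul_diagonal, ← Matrix.diagonal_one]
  congr 1
  funext a
  cases a
  · simp
  · simp only [Pi.star_apply, if_true, RCLike.star_def]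
    rw [← Complex.exp_conj, ← Complex.exp_add]
    simp [map_ofNat]

theorem WGate.inner_app (g : WGate ι) (φ ψ : Amp ι) :
    ∑ x, star (g.app φ x) * g.app ψ x = ∑ x, star (φ x) * ψ x := by
  cases g with
  | had i => exact oneWire_inner hadMat_unitary i φ ψ
  | tee i => exact oneWire_inner teeMat_unitary i φ ψ
  | not i => exact (run_involutive (.not i)).bijective.sum_comp fun x => star (φ x) * ψ x
  | cnot i j => exact (run_involutive (.cnot i j)).bijective.sum_comp fun x => star (φ x) * ψ x
  | toffoli i j k =>
      exact (run_involutive (.toffoli i j k)).bijective.sum_comp fun x => star (φ x) * ψ x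

theorem inner_appList (gs : List (WGate ι)) (φ ψ : Amp ι) :
    ∑ x, star (appList gs φ x) * appList gs ψ x = ∑ x, star (φ x) * ψ x := by
  induction gs generalizing φ ψ with
  | nil => rfl
  | cons g gs ih => simp only [appList_cons]; rw [ih, WGate.inner_app]

theorem sum_norm_sq_appList (gs : List (WGate ι)) (ψ : Amp ι) :
    ∑ x, ‖appList gs ψ x‖ ^ 2 = ∑ x, ‖ψ x‖ ^ 2 := by
  have h := inner_appList gs ψ ψ
  simp only [RCLike.star_def, Complex.conj_mul'] at h
  exact_mod_cast h

end Unitary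

/-! ### Comparison with circuits -/

section Compare

/-- A gate on the wires of a register of `n` qubits, as a gate with numbered wires. -/
def WGate.toGate {n : ℕ} : WGate (Fin n) → Gate
  | .not i => .not i
  | .had i => .had i
  | .tee i => .tee i
  | .cnot i j => .cnot i j
  | .toffoli i j k => .toffoli i j k

/-- The gate of a circuit as a gate on the existing wires; `none` if it acts on other wires. -/
def Gate.toWGate (n : ℕ) : Gate → Option (WGate (Fin n))
  | .not i => if h : i < n then some (.not ⟨i, h⟩) else none
  | .had i => if h : i < n then some (.had ⟨i, h⟩) else none
  | .tee i => if h : i < n then some (.tee ⟨i, h⟩) else none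
  | .cnot i j => if h : i < n ∧ j < n then some (.cnot ⟨i, h.1⟩ ⟨j, h.2⟩) else none
  | .toffoli i j k =>
      if h : i < n ∧ j < n ∧ k < n then some (.toffoli ⟨i, h.1⟩ ⟨j, h.2.1⟩ ⟨k, h.2.2⟩) else none

/-- The amplitude at `x` comes from the preimage of `x`, which for an involution is `F x`. -/
theorem basisMap_mulVec {n : ℕ} {F : Bits n → Bits n} (hF : Function.Involutive F)
    (ψ : Bits n → ℂ) : (basisMap F).mulVec ψ = fun x => ψ (F x) := by
  funext x
  rw [Matrix.mulVec, dotProduct, Finset.sum_eq_single (F x)]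
  · simp [basisMap, hF x]
  · intro y _ hy
    rw [basisMap, if_neg, zero_mul]
    rintro rfl
    exact hy (hF y).symm
  · simp

theorem oneQubit_mulVec {n : ℕ} (A : Matrix Bool Bool ℂ) (i : Fin n) (ψ : Bits n → ℂ) :
    (oneQubit A i).mulVec ψ = WGate.oneWire A i ψ := by
  funext x
  have hinj : Function.Injective fun b => Function.update x i b := by
    intro b b' h
    simpa using congrFun h i
  rw [Matrix.mulVec, dotProduct]
  simp only [WGate.oneWire, LinearMap.coe_mk, AddHom.coe_mk]
  -- In the row `x` only the two labels that agree with `x` off the wire `i` have non-zero entries.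
  rw [← Finset.sum_subset (Finset.subset_univ (Finset.univ.image fun b => Function.update x i b)),
    Finset.sum_image hinj.injOn]
  · refine Finset.sum_congr rfl fun b _ => ?_
    rw [oneQubit, if_pos, Function.update_self]
    intro j hj
    rw [Function.update_of_ne hj]
  · intro y _ hy
    rw [oneQubit, if_neg, zero_mul]
    intro h
    apply hy
    rw [Finset.mem_image]
    refine ⟨y i, Finset.mem_univ _, ?_⟩
    funext j
    by_cases hj : j = i
    · subst hj; simp
    · rw [Function.update_of_ne hj, h j hj]

/-- The cases with coinciding wires match because both conventions make such a gate the identity. -/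
theorem WGate.op_toGate {n : ℕ} (g : WGate (Fin n)) (ψ : Bits n → ℂ) :
    (g.toGate.op n).mulVec ψ = g.app ψ := by
  cases g with
  | had i => simp [toGate, Gate.op, oneQubit_mulVec, app]
  | tee i => simp [toGate, Gate.op, oneQubit_mulVec, app]
  | not i =>
      simp only [toGate, Gate.op, i.2, dif_pos]
      exact basisMap_mulVec (run_involutive (.not i)) ψ
  | cnot i j =>
      by_cases h : i = j
      · subst h
        simp only [toGate, Gate.op, ne_eq, not_true_eq_false, and_false, dif_neg, not_false_eq_true,
          Matrix.one_mulVec]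
        funext x
        rw [app_of_classical (by simp [Classical])]
        simp [run]
      · have h' : (i : ℕ) ≠ j := fun e => h (Fin.ext e)
        simp only [toGate, Gate.op, i.2, j.2, h', ne_eq, not_false_eq_true, and_self, dif_pos]
        rw [basisMap_mulVec]
        · funext x
          rw [app_of_classical (by simp [Classical])]
          simp [run, h]
        · intro x
          have := run_run (.cnot i j) x
          simpa only [run, ne_eq, h, not_false_eq_true, if_true] using this
  | toffoli i j k =>
      by_cases h : i ≠ j ∧ i ≠ k ∧ j ≠ k
      · have h' : (i : ℕ) < n ∧ (j : ℕ) < n ∧ (k : ℕ) < n ∧ (i : ℕ) ≠ j ∧ (i : ℕ) ≠ k ∧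
            (j : ℕ) ≠ k :=
          ⟨i.2, j.2, k.2, fun e => h.1 (Fin.ext e), fun e => h.2.1 (Fin.ext e),
            fun e => h.2.2 (Fin.ext e)⟩
        simp only [toGate, Gate.op]
        rw [dif_pos h', basisMap_mulVec]
        · funext x
          rw [app_of_classical (by simp [Classical])]
          simp only [run, if_pos h]
        · intro x
          have := run_run (.toffoli i j k) x
          simpa only [run, if_pos h] using this
      · have h' : ¬((i : ℕ) < n ∧ (j : ℕ) < n ∧ (k : ℕ) < n ∧ (i : ℕ) ≠ j ∧ (i : ℕ) ≠ k ∧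
            (j : ℕ) ≠ k) := fun e => h ⟨fun e' => e.2.2.2.1 (e' ▸ rfl),
              fun e' => e.2.2.2.2.1 (e' ▸ rfl), fun e' => e.2.2.2.2.2 (e' ▸ rfl)⟩
        simp only [toGate, Gate.op]
        rw [dif_neg h', Matrix.one_mulVec]
        funext x
        rw [app_of_classical (by simp [Classical])]
        simp only [run, if_neg h]

theorem Gate.toWGate_eq_some {n : ℕ} {g : Gate} {w : WGate (Fin n)} (h : g.toWGate n = some w) :
    w.toGate = g := by
  cases g <;> simp only [toWGate] at h <;> split_ifs at h <;> cases h <;> rfl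

theorem Gate.toWGate_eq_none {n : ℕ} {g : Gate} (h : g.toWGate n = none) : g.op n = 1 := by
  cases g with
  | not i | had i | tee i =>
      simp only [toWGate] at h
      split_ifs at h with h'
      simp [op, h']
  | cnot i j =>
      simp only [toWGate] at h
      split_ifs at h with h'
      rw [op, dif_neg fun e => h' ⟨e.1, e.2.1⟩]
  | toffoli i j k =>
      simp only [toWGate] at h
      split_ifs at h with h'
      rw [op, dif_neg fun e => h' ⟨e.1, e.2.1, e.2.2.1⟩]

theorem gatesOp_mulVec (n : ℕ) (gs : List Gate) (ψ : Bits n → ℂ) :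
    (gatesOp n gs).mulVec ψ = gs.foldl (fun φ g => (g.op n).mulVec φ) ψ := by
  have : ∀ V : OpMat n, (gs.foldl (fun V g => g.op n * V) V).mulVec ψ =
      gs.foldl (fun φ g => (g.op n).mulVec φ) (V.mulVec ψ) := by
    induction gs with
    | nil => intro V; rfl
    | cons g gs ih => intro V; rw [List.foldl_cons, ih, List.foldl_cons, Matrix.mulVec_mulVec]
  rw [gatesOp, this, Matrix.one_mulVec]

/-- The circuit of an adversary is arbitrary and may name wires that do not exist. Such gates act as
the identity and can be dropped, which is what allows embedding the adversary in a larger register.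
-/
theorem gatesOp_mulVec_filterMap (n : ℕ) (gs : List Gate) (ψ : Bits n → ℂ) :
    (gatesOp n gs).mulVec ψ = appList (gs.filterMap (Gate.toWGate n)) ψ := by
  rw [gatesOp_mulVec]
  induction gs generalizing ψ with
  | nil => rfl
  | cons g gs ih =>
      rw [List.foldl_cons, ih]
      cases h : g.toWGate n with
      | none => rw [List.filterMap_cons_none h, Gate.toWGate_eq_none h, Matrix.one_mulVec]
      | some w =>
          rw [List.filterMap_cons_some h, appList_cons, ← WGate.op_toGate,
            Gate.toWGate_eq_some h]

theorem gatesOp_mulVec_toGate (n : ℕ) (gs : List (WGate (Fin n))) (ψ : Bits n → ℂ) :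
    (gatesOp n (gs.map WGate.toGate)).mulVec ψ = appList gs ψ := by
  rw [gatesOp_mulVec]
  induction gs generalizing ψ with
  | nil => rfl
  | cons g gs ih => rw [List.map_cons, List.foldl_cons, ih, appList_cons, WGate.op_toGate]

end Compare

end QPK

namespace QPK

/-! ### Registers split into a first and a second part -/

/-- Labels of a register and pairs of labels of its first `k` and its other qubits. -/
def Bits.joinEquiv {k w : ℕ} (hk : k ≤ w) : Bits k × Bits (w - k) ≃ Bits w where
  toFun p := p.1.join p.2
  invFun x := (fun i => x ⟨i, i.2.trans_le hk⟩, fun i => x ⟨i + k, by omega⟩)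
  left_inv p := by
    ext i
    · simp [Bits.join]
    · simp [Bits.join]
  right_inv x := by
    funext i
    simp only [Bits.join]
    split_ifs with h
    · rfl
    · congr 1
      apply Fin.ext
      simp only
      omega

theorem Bits.join_of_lt {k w : ℕ} (x : Bits k) (z : Bits (w - k)) (i : Fin w) (h : i.val < k) :
    x.join z i = x ⟨i, h⟩ := dif_pos h

theorem sum_join {k w : ℕ} (hk : k ≤ w) {M : Type*} [AddCommMonoid M] (F : Bits w → M) :
    ∑ x, F x = ∑ y : Bits k, ∑ z : Bits (w - k), F (y.join z) := by
  rw [← (Bits.joinEquiv hk).sum_comp, Fintype.sum_prod_type]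
  rfl

/-! ### Circuits on pure states -/

/-- The operator `|ψ⟩⟨ψ|` of a vector of arbitrary norm. -/
def pureOp {q : ℕ} (ψ : Bits q → ℂ) : QOp := ⟨q, Matrix.vecMulVec ψ (star ψ)⟩

theorem conj_vecMulVec {q : ℕ} (U : OpMat q) (ψ : Bits q → ℂ) :
    U * Matrix.vecMulVec ψ (star ψ) * U.conjTranspose =
      Matrix.vecMulVec (U.mulVec ψ) (star (U.mulVec ψ)) := by
  rw [Matrix.mul_vecMulVec, Matrix.vecMulVec_mul, Matrix.star_mulVec]

theorem overlap_mk {r : ℕ} (B : OpMat r) (ψ : Ket) (h : ψ.qubits = r) :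
    (⟨r, B⟩ : QOp).overlap ψ = (∑ x : Bits r, ∑ y : Bits r,
      star (ψ.amp fun i => x (Fin.cast h i)) * B x y * ψ.amp fun i => y (Fin.cast h i)).re := by
  subst h
  exact dif_pos rfl

/-- The matrix element `⟨f|ρ|f⟩` of the reduced operator of `V` on the first `m` qubits. -/
theorem overlap_takeFirst {w : ℕ} (V : OpMat w) (m : ℕ) (ψ : Ket) (h : ψ.qubits = min m w)
    (F : Bits (min m w) → ℂ) (hF : ∀ x, ψ.amp (fun i => x (Fin.cast h i)) = F x) :
    ((⟨w, V⟩ : QOp).takeFirst m).overlap ψ = (∑ x : Bits (min m w), ∑ y : Bits (min m w),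
      star (F x) * (∑ z : Bits (w - min m w), V (x.join z) (y.join z)) * F y).re := by
  simp only [← hF]
  exact overlap_mk _ ψ h

/-- For a single output qubit the matrix element at `|b⟩` of the reduced operator is the part of the
trace over the labels that begin with `b`: the Born rule for the first wire. -/
theorem overlap_takeFirst_one {w : ℕ} (hw : 0 < w) (V : OpMat w) (b : Bool) :
    ((⟨w, V⟩ : QOp).takeFirst 1).overlap (Ket.ofBits [b]) =
      (∑ x : Bits w, if x ⟨0, hw⟩ = b then V x x else 0).re := by
  have hmin : 1 = min 1 w := by omega
  have hk : min 1 w ≤ w := Nat.min_le_right _ _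
  have hamp : ∀ x : Bits (min 1 w), ((Ket.ofBits [b]).amp fun i => x (Fin.cast hmin i)) =
      if x = fun _ => b then 1 else 0 := by
    intro x
    change (Pi.single (M := fun _ : Bits 1 => ℂ) [b].get 1 : Bits 1 → ℂ)
      (fun i : Fin 1 => x (Fin.cast hmin i)) = _
    rw [Pi.single_apply]
    have h2 : ([b].get : Bits 1) = fun _ => b := by
      funext i
      obtain rfl : i = (0 : Fin 1) := Subsingleton.elim (α := Fin 1) _ _
      rfl
    rw [h2]
    congr 1
    refine propext ⟨fun h => ?_, fun h => ?_⟩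
    · funext i
      exact congrFun h (Fin.cast hmin.symm i)
    · rw [h]
      rfl
  rw [overlap_takeFirst V 1 (Ket.ofBits [b]) hmin _ hamp, sum_join hk]
  have hconst : ∀ y : Bits (min 1 w), y ⟨0, by omega⟩ = b ↔ y = fun _ => b := by
    intro y
    constructor
    · intro h
      funext i
      rw [← h]
      congr 1
      apply Fin.ext
      have := i.2
      simp only
      omega
    · rintro rfl
      rfl
  congr 1
  refine Finset.sum_congr rfl fun x _ => ?_
  have hx : ∀ z : Bits (w - min 1 w), x.join z ⟨0, hw⟩ = b ↔ x = fun _ => b := by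
    intro z
    rw [Bits.join_of_lt _ _ _ (by simp only; omega)]
    exact hconst x
  simp only [hx]
  by_cases h : x = fun _ => b
  · simp [h]
  · simp [h]

theorem overlap_output_pureOp {q : ℕ} (hq : 0 < q) (ψ : Bits q → ℂ) (gs : List Gate) (b : Bool) :
    ((⟨0, 1, gs⟩ : Circuit).output (pureOp ψ)).overlap (Ket.ofBits [b]) =
      ∑ x : Bits q, if x ⟨0, hq⟩ = b then ‖(gatesOp q gs).mulVec ψ x‖ ^ 2 else 0 := by
  have hfin : (⟨0, 1, gs⟩ : Circuit).output (pureOp ψ) =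
      (⟨q, Matrix.vecMulVec ((gatesOp q gs).mulVec ψ) (star ((gatesOp q gs).mulVec ψ))⟩ :
        QOp).takeFirst 1 := by
    rw [← conj_vecMulVec]
    have : (pureOp ψ).addAncillas 0 = pureOp ψ := by
      refine QOp.ext_cast rfl fun x y => ?_
      simp [QOp.addAncillas, pureOp]
    simp only [Circuit.output, Circuit.final]
    rw [this]
    rfl
  rw [hfin, overlap_takeFirst_one hq, Complex.re_sum]
  refine Finset.sum_congr rfl fun x _ => ?_
  split_ifs
  · rw [Matrix.vecMulVec_apply, Pi.star_apply, RCLike.star_def, Complex.mul_conj']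
    exact_mod_cast rfl
  · rfl

/-! ### Sizes -/

theorem length_encodeNats (l : List ℕ) : (encodeNats l).length = (l.map (· + 1)).sum := by
  induction l with
  | nil => rfl
  | cons a l ih =>
      simp only [encodeNats, List.flatMap_cons, List.length_append, List.map_cons, List.sum_cons] at *
      rw [ih]
      simp

theorem length_gates_le_size (C : Circuit) : C.gates.length ≤ C.size := by
  have : ∀ gs : List Gate, gs.length ≤ ((gs.flatMap Gate.toNats).map (· + 1)).sum := by
    intro gs
    induction gs with
    | nil => simp
    | cons g gs ih =>
        rw [List.flatMap_cons, List.map_append, List.sum_append, List.length_cons]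
        have : 1 ≤ (g.toNats.map (· + 1)).sum := by cases g <;> simp [Gate.toNats] <;> omega
        omega
  have := this C.gates
  simp only [Circuit.size, Circuit.encode, length_encodeNats, List.map_cons, List.sum_cons]
  omega

theorem anc_le_size (C : Circuit) : C.anc ≤ C.size := by
  simp only [Circuit.size, Circuit.encode, length_encodeNats, List.map_cons, List.sum_cons]
  omega

/-- The longest gate is a Toffoli gate: the number 4, three wire numbers below `n` and four
terminating zeros. The 3 is the length of the encoded pair of 0 ancillas and 1 output. -/
theorem size_toGate_le (n : ℕ) (gs : List (WGate (Fin n))) :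
    (⟨0, 1, gs.map WGate.toGate⟩ : Circuit).size ≤ 3 + gs.length * (3 * n + 8) := by
  simp only [Circuit.size, Circuit.encode, length_encodeNats, List.map_cons, List.sum_cons]
  have : ((List.flatMap Gate.toNats (gs.map WGate.toGate)).map (· + 1)).sum ≤
      gs.length * (3 * n + 8) := by
    induction gs with
    | nil => simp
    | cons g gs ih =>
        rw [List.map_cons, List.flatMap_cons, List.map_append, List.sum_append, List.length_cons,
          add_mul, one_mul, add_comm]
        refine Nat.add_le_add ih ?_
        cases g with
        | not i | had i | tee i =>
            have := i.2
            simp [WGate.toGate, Gate.toNats]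
            omega
        | cnot i j =>
            have := i.2
            have := j.2
            simp [WGate.toGate, Gate.toNats]
            omega
        | toffoli i j k =>
            have := i.2
            have := j.2
            have := k.2
            simp [WGate.toGate, Gate.toNats]
            omega
  omega

/-! ### Graphs as inputs -/

open Classical in
/-- The adjacency matrix of a graph as a function on bits. -/
noncomputable def adjBits {m : ℕ} (G : SimpleGraph (Fin m)) : Fin m × Fin m → Bool :=
  fun p => decide (G.Adj p.1 p.2)

open Classical in
/-- The product of a basis state of the wires `S` and a vector of amplitudes of the wires `W`. -/
noncomputable def basisTensor {S W : Type} (s : S → Bool) (φ : Amp W) : Amp (S ⊕ W) :=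
  fun x => if x ∘ Sum.inl = s then φ (x ∘ Sum.inr) else 0

/-- Wires of graph and advice, numbered in the order in which circuits receive them. -/
noncomputable def inputWires (m : ℕ) (A : Type) [Fintype A] :
    (Fin m × Fin m) ⊕ A ≃ Fin (m * m + Fintype.card A) :=
  (Equiv.sumCongr finProdFinEquiv (Fintype.equivFin A)).trans finSumFinEquiv

/-- A vector of amplitudes as a state of numbered qubits. -/
noncomputable def adviceKet {A : Type} [Fintype A] [DecidableEq A] (α : Amp A)
    (hα : ∑ x, ‖α x‖ ^ 2 = 1) : Ket where
  qubits := Fintype.card A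
  amp := fun x => α (x ∘ Fintype.equivFin A)
  norm_one := by
    rw [← hα]
    exact ((Fintype.equivFin A).symm.arrowCongr (Equiv.refl Bool)).sum_comp fun x => ‖α x‖ ^ 2

theorem tensor_toOp_eq_pureOp {l q : ℕ} (w : List Bool) (a : Ket) (hw : w.length = l)
    (ha : a.qubits = q) (ψ : Bits (l + q) → ℂ)
    (hψ : ∀ x, ψ x = (if (fun i => x (Fin.castAdd q (Fin.cast hw i))) = w.get then 1 else 0) *
      a.amp fun i => x (Fin.natAdd l (Fin.cast ha i))) :
    (Ket.ofBits w).toOp.tensor a.toOp = pureOp ψ := by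
  subst hw ha
  refine QOp.ext_cast rfl fun x y => ?_
  simp only [pureOp, Matrix.vecMulVec_apply, Pi.star_apply, hψ]
  simp only [QOp.tensor, Ket.toOp, Matrix.vecMulVec_apply, Pi.star_apply, Ket.ofBits,
    Pi.single_apply, star_mul', Fin.cast_eq_self]
  exact mul_mul_mul_comm _ _ _ _

theorem graphState_tensor {m : ℕ} {A : Type} [Fintype A] [DecidableEq A] (G : SimpleGraph (Fin m))
    (α : Amp A) (hα : ∑ x, ‖α x‖ ^ 2 = 1) :
    (graphState G).tensor (adviceKet α hα).toOp =
      pureOp fun x => basisTensor (adjBits G) α (x ∘ inputWires m A) := by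
  classical
  unfold graphState
  refine tensor_toOp_eq_pureOp (l := m * m) (q := Fintype.card A) _ _ List.length_ofFn rfl _
    fun x => ?_
  have h1 : (x ∘ inputWires m A) ∘ Sum.inl = adjBits G ↔
      (fun i => x (Fin.castAdd (Fintype.card A) (Fin.cast (List.length_ofFn) i))) =
          (List.ofFn fun t : Fin (m * m) => decide (G.Adj (finProdFinEquiv.symm t).1
            (finProdFinEquiv.symm t).2)).get := by
    constructor
    · intro h
      funext i
      have := congrFun h (finProdFinEquiv.symm (Fin.cast (List.length_ofFn) i))
      simp only [Function.comp_apply, adjBits, inputWires, Equiv.trans_apply,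
        Equiv.sumCongr_apply, Sum.map_inl, Equiv.apply_symm_apply, finSumFinEquiv_apply_left] at this
      rw [this, List.get_ofFn]
    · intro h
      funext p
      have := congrFun h (Fin.cast (List.length_ofFn).symm (finProdFinEquiv p))
      rw [List.get_ofFn] at this
      simp only [Fin.cast_cast, Fin.cast_eq_self, Equiv.symm_apply_apply] at this
      simp only [Function.comp_apply, adjBits, inputWires, Equiv.trans_apply,
        Equiv.sumCongr_apply, Sum.map_inl, finSumFinEquiv_apply_left]
      exact this
  change _ = (if (fun i => x (Fin.castAdd (Fintype.card A) (Fin.cast (List.length_ofFn) i))) =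
    (List.ofFn fun t : Fin (m * m) => decide (G.Adj (finProdFinEquiv.symm t).1
      (finProdFinEquiv.symm t).2)).get then 1 else 0) * α ((x ∘ inputWires m A) ∘ Sum.inr)
  rw [basisTensor]
  by_cases h : (x ∘ inputWires m A) ∘ Sum.inl = adjBits G
  · rw [if_pos h, if_pos (h1.1 h), one_mul]
  · rw [if_neg h, if_neg fun h' => h (h1.2 h'), zero_mul]

/-- Gates on the wires of a graph and of an advice state, as a circuit. -/
theorem exists_circuit {m : ℕ} (hm : 0 < m) {A : Type} [Fintype A] [DecidableEq A]
    (gs : List (WGate ((Fin m × Fin m) ⊕ A))) (α : Amp A) (hα : ∑ x, ‖α x‖ ^ 2 = 1) :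
    ∃ (C : Circuit) (a : Ket),
      C.size ≤ 3 + gs.length * (3 * (m * m + Fintype.card A) + 8) ∧ a.qubits = Fintype.card A ∧
      ∀ (G : SimpleGraph (Fin m)) (b : Bool),
        (C.output ((graphState G).tensor a.toOp)).overlap (Ket.ofBits [b]) =
          ∑ x, if x (Sum.inl (⟨0, hm⟩, ⟨0, hm⟩)) = b then
            ‖appList gs (basisTensor (adjBits G) α) x‖ ^ 2 else 0 := by
  refine ⟨⟨0, 1, (gs.map (WGate.map (inputWires m A))).map WGate.toGate⟩, adviceKet α hα, ?_, rfl,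
    fun G b => ?_⟩
  · have := size_toGate_le _ (gs.map (WGate.map (inputWires m A)))
    rwa [List.length_map] at this
  · have hpos : 0 < m * m + Fintype.card A := by positivity
    rw [graphState_tensor, overlap_output_pureOp hpos]
    let E : ((Fin m × Fin m) ⊕ A → Bool) ≃ Bits (m * m + Fintype.card A) :=
      (inputWires m A).arrowCongr (Equiv.refl Bool)
    rw [← E.sum_comp]
    refine Finset.sum_congr rfl fun x _ => ?_
    have hE : E x = x ∘ (inputWires m A).symm := rfl
    -- A circuit outputs its first wires, so the answer has to appear on the wire that carries the
    -- entry `(0, 0)` of the adjacency matrix.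
    have h0 : E x ⟨0, hpos⟩ = x (Sum.inl (⟨0, hm⟩, ⟨0, hm⟩)) := by
      rw [hE, Function.comp_apply]
      congr 1
      rw [Equiv.symm_apply_eq]
      apply Fin.ext
      simp [inputWires]
    rw [h0, gatesOp_mulVec_toGate, appList_map_equiv, hE]
    have h3 : (x ∘ (inputWires m A).symm) ∘ (inputWires m A) = x := by
      funext i; simp
    have h4 : (fun z : (Fin m × Fin m) ⊕ A → Bool =>
        basisTensor (adjBits G) α ((z ∘ (inputWires m A).symm) ∘ inputWires m A)) = basisTensor (adjBits G) α := by
      funext z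
      congr 1
      funext i; simp
    rw [h3, h4]

end QPK

namespace QPK

/-! ### Independent runs -/

section Parallel

variable {S W X B : Type}

/-- The product of vectors of amplitudes of `B` registers and of the remaining wires. -/
noncomputable def runsTensor [Fintype B] (φ : B → Amp W) (c : Amp X) : Amp ((B × W) ⊕ X) :=
  fun y => c (y ∘ Sum.inr) * ∏ b, φ b fun w => y (Sum.inl (b, w))

/-- The wires of the run with number `b`. -/
def runWires (b : B) : S ⊕ W → S ⊕ ((B × W) ⊕ X) := Sum.map id fun w => Sum.inl (b, w)

theorem runWires_injective (b : B) : Function.Injective (runWires (S := S) (W := W) (X := X) b) :=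
  Function.injective_id.sumMap fun w w' h => by simpa using h

/-- Gates for every run. -/
noncomputable def allRuns (B : Type) [Fintype B] (gs : List (WGate (S ⊕ W))) :
    List (WGate (S ⊕ ((B × W) ⊕ X))) :=
  (Finset.univ : Finset B).toList.flatMap fun b => gs.map (WGate.map (runWires b))

theorem length_allRuns [Fintype B] (gs : List (WGate (S ⊕ W))) :
    (allRuns (X := X) B gs).length = Fintype.card B * gs.length := by
  simp [allRuns, List.length_flatMap, Finset.card_univ]

variable [DecidableEq S] [DecidableEq W] [DecidableEq X] [DecidableEq B] [Fintype B]

/-- Fix the values of all wires outside the run `b`. The slice is a scalar multiple of the input of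
a single run, the scalar `K` being the product of the other amplitudes, so linearity gives the
claim. By hypothesis the wires `S` return to the basis state `s`, so that they can be shared with
the next run. -/
theorem appList_run (b : B) (gs : List (WGate (S ⊕ W))) (s : S → Bool) (φ : B → Amp W) (φ' : Amp W)
    (h : appList gs (basisTensor s (φ b)) = basisTensor s φ') (c : Amp X) :
    appList (gs.map (WGate.map (runWires b))) (basisTensor s (runsTensor φ c)) =
      basisTensor s (runsTensor (Function.update φ b φ') c) := by
  funext x
  have hinj := runWires_injective (S := S) (W := W) (X := X) b
  rw [← extend_comp_self hinj x, appList_map hinj, extend_comp_self hinj x]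
  set K : ℂ := c (x ∘ Sum.inr ∘ Sum.inr) *
    ∏ b' ∈ Finset.univ.erase b, φ b' fun w => x (Sum.inr (Sum.inl (b', w)))
  have h1 : (fun z => basisTensor s (runsTensor φ c) (Function.extend (runWires b) z x)) =
      K • basisTensor s (φ b) := by
    funext z
    have hS : Function.extend (runWires b) z x ∘ Sum.inl = z ∘ Sum.inl := by
      funext i
      exact hinj.extend_apply z x (Sum.inl i)
    have hX : (Function.extend (runWires b) z x ∘ Sum.inr) ∘ Sum.inr = x ∘ Sum.inr ∘ Sum.inr := by
      funext i
      refine Function.extend_apply' _ _ _ ?_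
      rintro ⟨a, ha⟩
      cases a <;> simp [runWires] at ha
    have hb : (fun w => (Function.extend (runWires b) z x ∘ Sum.inr) (Sum.inl (b, w))) =
        z ∘ Sum.inr := by
      funext w
      exact hinj.extend_apply z x (Sum.inr w)
    have hb' : ∀ b', b' ≠ b →
        (fun w => (Function.extend (runWires b) z x ∘ Sum.inr) (Sum.inl (b', w))) =
          fun w => x (Sum.inr (Sum.inl (b', w))) := by
      intro b' hne
      funext w
      refine Function.extend_apply' _ _ _ ?_
      rintro ⟨a, ha⟩
      cases a with
      | inl a => simp [runWires] at ha
      | inr a =>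
          simp only [runWires, Sum.map_inr, Sum.inr.injEq, Sum.inl.injEq, Prod.mk.injEq] at ha
          exact hne ha.1.symm
    simp only [basisTensor, runsTensor, Pi.smul_apply, smul_eq_mul]
    by_cases hz : z ∘ Sum.inl = s
    · rw [if_pos hz, if_pos (hS.trans hz), hX, ← Finset.mul_prod_erase _ _ (Finset.mem_univ b), hb,
        Finset.prod_congr rfl fun b' hmem => by rw [hb' b' (Finset.ne_of_mem_erase hmem)]]
      ring
    · rw [if_neg hz, if_neg fun e => hz (hS.symm.trans e), mul_zero]
  rw [h1, map_smul, h, Pi.smul_apply, smul_eq_mul]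
  simp only [basisTensor, runsTensor]
  by_cases hx : x ∘ Sum.inl = s
  · rw [if_pos hx, if_pos (show (x ∘ runWires b) ∘ Sum.inl = s from hx),
      ← Finset.mul_prod_erase _ _ (Finset.mem_univ b), Function.update_self,
      Finset.prod_congr rfl fun b' hmem => by
        rw [Function.update_of_ne (Finset.ne_of_mem_erase hmem)]]
    simp only [K]
    change c (x ∘ Sum.inr ∘ Sum.inr) * _ * φ' (fun w => x (Sum.inr (Sum.inl (b, w)))) =
      c (x ∘ Sum.inr ∘ Sum.inr) * (_ * _)
    simp only [Function.comp_apply]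
    ring
  · rw [if_neg hx, if_neg (show ¬(x ∘ runWires b) ∘ Sum.inl = s from hx), mul_zero]

theorem appList_allRuns (gs : List (WGate (S ⊕ W))) (s : S → Bool) (φ φ' : B → Amp W)
    (h : ∀ b, appList gs (basisTensor s (φ b)) = basisTensor s (φ' b)) (c : Amp X) :
    appList (allRuns B gs) (basisTensor s (runsTensor φ c)) =
      basisTensor s (runsTensor φ' c) := by
  -- Generalised to states in which only the runs still to come have their initial vectors.
  have key : ∀ (l : List B), l.Nodup → ∀ ψ : B → Amp W, (∀ b ∈ l, ψ b = φ b) →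
      appList (l.flatMap fun b => gs.map (WGate.map (runWires b))) (basisTensor s (runsTensor ψ c)) =
        basisTensor s (runsTensor (fun b => if b ∈ l then φ' b else ψ b) c) := by
    intro l
    induction l with
    | nil => intro _ ψ _; simp
    | cons b l ih =>
        intro hl ψ hψ
        rw [List.nodup_cons] at hl
        rw [List.flatMap_cons, appList_append, appList_run b gs s ψ (φ' b)
          (by rw [hψ b List.mem_cons_self, h]), ih hl.2]
        · congr 2
          funext b'
          by_cases hb : b' = b
          · subst hb; simp [hl.1]
          · simp [hb]
        · intro b' hb'
          rw [Function.update_of_ne, hψ b' (List.mem_cons_of_mem _ hb')]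
          rintro rfl
          exact hl.1 hb'
  rw [allRuns, key _ (Finset.nodup_toList _) φ fun _ _ => rfl]
  simp

end Parallel

/-! ### Classical programs that add bits to target wires -/

/-- The exclusive or of the values of a function on a list. -/
def xorList {α : Type} (l : List α) (f : α → Bool) : Bool := l.foldr (fun a b => (f a).xor b) false

theorem xorList_eq_false {α : Type} {l : List α} {f : α → Bool} (h : ∀ a ∈ l, f a = false) :
    xorList l f = false := by
  induction l with
  | nil => rfl
  | cons a l ih =>
      change (f a).xor (xorList l f) = false
      rw [h a List.mem_cons_self, ih fun b hb => h b (List.mem_cons_of_mem _ hb)]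
      rfl

theorem xorList_eq_single {α : Type} {l : List α} (hl : l.Nodup) {f : α → Bool} {a : α} (ha : a ∈ l)
    (h : ∀ b ∈ l, b ≠ a → f b = false) : xorList l f = f a := by
  induction l with
  | nil => simp at ha
  | cons c l ih =>
      rw [List.nodup_cons] at hl
      change (f c).xor (xorList l f) = f a
      by_cases hc : c = a
      · subst hc
        rw [xorList_eq_false, Bool.xor_false]
        intro b hb
        refine h b (List.mem_cons_of_mem _ hb) ?_
        rintro rfl
        exact hl.1 hb
      · rw [h c List.mem_cons_self hc, Bool.false_xor]
        refine ih hl.2 ?_ fun b hb => h b (List.mem_cons_of_mem _ hb)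
        exact (List.mem_cons.1 ha).resolve_left fun e => hc e.symm

section Adds

variable {κ : Type} [DecidableEq κ]

/-- The gates `gs` add, modulo two, the bits `m x w` to the wires `w ∈ T`, where `m x` does not
depend on the values of these wires. -/
structure Adds (T : Set κ) (gs : List (WGate κ)) (m : (κ → Bool) → κ → Bool) : Prop where
  classical : ∀ g ∈ gs, g.Classical
  run : ∀ x w, runList gs x w = (x w).xor (m x w)
  indep : ∀ x y, (∀ w, w ∉ T → x w = y w) → m x = m y
  supp : ∀ x w, w ∉ T → m x w = false

theorem Adds.nil (T : Set κ) : Adds T [] fun _ _ => false where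
  classical := by simp
  run := by simp
  indep _ _ _ := rfl
  supp _ _ _ := rfl

/-- The first list changes only wires in `T`, on which the second mask does not depend; so both
masks can be evaluated at the original label. -/
theorem Adds.append {T : Set κ} {gs hs : List (WGate κ)} {m m' : (κ → Bool) → κ → Bool}
    (h : Adds T gs m) (h' : Adds T hs m') :
    Adds T (gs ++ hs) fun x w => (m x w).xor (m' x w) where
  classical g hg := (List.mem_append.1 hg).elim (h.classical g) (h'.classical g)
  run x w := by
    rw [runList_append, h'.run, h.run, h'.indep (runList gs x) x, Bool.xor_assoc]
    intro v hv
    rw [h.run, h.supp x v hv, Bool.xor_false]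
  indep x y hxy := by rw [h.indep x y hxy, h'.indep x y hxy]
  supp x w hw := by rw [h.supp x w hw, h'.supp x w hw]; rfl

theorem Adds.flatMap {T : Set κ} {α : Type} (l : List α) {gs : α → List (WGate κ)}
    {m : α → (κ → Bool) → κ → Bool} (h : ∀ a ∈ l, Adds T (gs a) (m a)) :
    Adds T (l.flatMap gs) fun x w => xorList l fun a => m a x w := by
  induction l with
  | nil => exact Adds.nil T
  | cons a l ih =>
      exact (h a List.mem_cons_self).append (ih fun b hb => h b (List.mem_cons_of_mem _ hb))

theorem Adds.cnot {T : Set κ} {i w : κ} (hi : i ∉ T) (hw : w ∈ T) :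
    Adds T [.cnot i w] fun x v => if v = w then x i else false where
  classical := by simp [WGate.Classical]
  run x v := by
    have hne : i ≠ w := fun e => hi (e ▸ hw)
    by_cases hv : v = w
    · subst hv; simp [runList_cons, WGate.run, hne]
    · simp [runList_cons, WGate.run, hne, hv]
  indep x y h := by rw [h i hi]
  supp x v hv := if_neg fun (e : v = w) => hv (e ▸ hw)

theorem Adds.toffoli {T : Set κ} {i j w : κ} (hij : i ≠ j) (hi : i ∉ T) (hj : j ∉ T) (hw : w ∈ T) :
    Adds T [.toffoli i j w] fun x v => if v = w then x i && x j else false where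
  classical := by simp [WGate.Classical]
  run x v := by
    have hi' : i ≠ w := fun e => hi (e ▸ hw)
    have hj' : j ≠ w := fun e => hj (e ▸ hw)
    by_cases hv : v = w
    · subst hv; simp [runList_cons, WGate.run, hij, hi', hj']
    · simp [runList_cons, WGate.run, hij, hi', hj', hv]
  indep x y h := by rw [h i hi, h j hj]
  supp x v hv := if_neg fun (e : v = w) => hv (e ▸ hw)

/-- A negation with three controls; `t` is an auxiliary wire. -/
def cccnot (t i j k w : κ) : List (WGate κ) := [.toffoli i j t, .toffoli t k w, .toffoli i j t]

/-- The third gate undoes the first on `t`, so `t` is restored and need not belong to `T`. The value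
of `t` remains in the formula because `t` is not assumed to be zero. -/
theorem Adds.cccnot {T : Set κ} {t i j k w : κ} (ht : t ∉ T) (hi : i ∉ T) (hj : j ∉ T) (hk : k ∉ T)
    (hw : w ∈ T) (hij : i ≠ j) (hit : i ≠ t) (hjt : j ≠ t) (hkt : k ≠ t) :
    Adds T (cccnot t i j k w)
      fun x v => if v = w then ((x t).xor (x i && x j)) && x k else false where
  classical := by simp [QPK.cccnot, WGate.Classical]
  run x v := by
    have hi' : i ≠ w := fun e => hi (e ▸ hw)
    have hj' : j ≠ w := fun e => hj (e ▸ hw)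
    have hk' : k ≠ w := fun e => hk (e ▸ hw)
    have ht' : t ≠ w := fun e => ht (e ▸ hw)
    by_cases hv : v = w
    · subst hv
      simp [QPK.cccnot, runList_cons, WGate.run, hij, hit, hjt, hkt, hkt.symm, hk', ht', ht'.symm]
    · by_cases hvt : v = t
      · subst hvt
        simp [QPK.cccnot, runList_cons, WGate.run, hij, hit, hjt, hkt, hkt.symm, hk', ht', hi', hj']
      · simp [QPK.cccnot, runList_cons, WGate.run, hij, hit, hjt, hkt, hkt.symm, hk', ht', hv, hvt]
  indep x y h := by rw [h t ht, h i hi, h j hj, h k hk]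
  supp x v hv := if_neg fun (e : v = w) => hv (e ▸ hw)

end Adds

end QPK

namespace QPK

/-! ### Counting -/

section Counting

variable {κ : Type} [DecidableEq κ] {R : ℕ} (out : Fin R → Bool → κ)
  (ctr : Fin (R + 1) → ZMod (R + 1) → κ)

/-- Computes the counter after `t + 1` steps from the counter after `t` steps, the counters being
unit vectors: the position moves on if the bits `out t false` and `out t true` differ. -/
noncomputable def countLayer (t : Fin R) : List (WGate κ) :=
  (Finset.univ : Finset (ZMod (R + 1))).toList.flatMap fun j =>
    [.cnot (ctr t.castSucc j) (ctr t.succ j)] ++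
    ([.toffoli (out t false) (ctr t.castSucc j) (ctr t.succ j)] ++
    ([.toffoli (out t true) (ctr t.castSucc j) (ctr t.succ j)] ++
    ([.toffoli (out t false) (ctr t.castSucc (j - 1)) (ctr t.succ j)] ++
    [.toffoli (out t true) (ctr t.castSucc (j - 1)) (ctr t.succ j)])))

omit [DecidableEq κ] in
theorem length_countLayer (t : Fin R) : (countLayer out ctr t).length = 5 * (R + 1) := by
  simp [countLayer, List.length_flatMap, Finset.card_univ, ZMod.card, mul_comm]

variable {out ctr} (hctr : Function.Injective2 ctr) (hoc : ∀ t b s j, out t b ≠ ctr s j)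

-- With `a`, `b` the two output bits and `c`, `d` the old entries at `j` and `j - 1`, the five gates
-- add `c + (a + b)c + (a + b)d` modulo two, which is `c` if `a = b` and `d` otherwise.
include hctr hoc in
theorem adds_countLayer (t : Fin R) :
    Adds (Set.range (ctr t.succ)) (countLayer out ctr t) fun x w =>
      xorList (Finset.univ : Finset (ZMod (R + 1))).toList fun j =>
        if w = ctr t.succ j then
          if (x (out t false)).xor (x (out t true)) then x (ctr t.castSucc (j - 1))
          else x (ctr t.castSucc j)
        else false := by
  refine Adds.flatMap _ fun j _ => ?_
  have h1 : ∀ i, ctr t.castSucc i ∉ Set.range (ctr t.succ) := by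
    rintro i ⟨j, hj⟩
    have := (hctr hj).1
    simp [Fin.ext_iff] at this
  have h2 : ∀ b, out t b ∉ Set.range (ctr t.succ) := by
    rintro b ⟨j, hj⟩
    exact hoc _ _ _ _ hj.symm
  have h3 : ctr t.succ j ∈ Set.range (ctr t.succ) := ⟨j, rfl⟩
  convert (Adds.cnot (h1 j) h3).append ((Adds.toffoli (hoc t false _ _) (h2 _) (h1 j) h3).append
    ((Adds.toffoli (hoc t true _ _) (h2 _) (h1 j) h3).append
    ((Adds.toffoli (hoc t false _ _) (h2 _) (h1 (j - 1)) h3).append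
    (Adds.toffoli (hoc t true _ _) (h2 _) (h1 (j - 1)) h3)))) using 3
  by_cases hw : ‹κ› = ctr t.succ j
  · simp only [hw, if_true]
    generalize ‹κ → Bool› (out t false) = a
    generalize ‹κ → Bool› (out t true) = b
    generalize ‹κ → Bool› (ctr t.castSucc j) = c
    generalize ‹κ → Bool› (ctr t.castSucc (j - 1)) = d
    cases a <;> cases b <;> cases c <;> cases d <;> rfl
  · simp only [hw, if_false]
    rfl

include hctr hoc in
theorem run_countLayer (t : Fin R) (x : κ → Bool) (j : ZMod (R + 1)) :
    runList (countLayer out ctr t) x (ctr t.succ j) = (x (ctr t.succ j)).xor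
      (if (x (out t false)).xor (x (out t true)) then x (ctr t.castSucc (j - 1))
          else x (ctr t.castSucc j)) := by
  rw [(adds_countLayer hctr hoc t).run, xorList_eq_single (Finset.nodup_toList _)
    (Finset.mem_toList.2 (Finset.mem_univ j)), if_pos rfl]
  intro i _ hi
  exact if_neg fun h => hi (hctr h).2.symm

include hctr hoc in
theorem run_countLayer_of_ne (t : Fin R) (x : κ → Bool) (w : κ) (hw : ∀ j, w ≠ ctr t.succ j) :
    runList (countLayer out ctr t) x w = x w := by
  rw [(adds_countLayer hctr hoc t).run, (adds_countLayer hctr hoc t).supp _ _, Bool.xor_false]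
  rintro ⟨j, hj⟩
  exact hw j hj.symm

variable (out ctr) in
/-- The first `n` steps of the counting program. -/
noncomputable def countProgram (n : ℕ) : List (WGate κ) :=
  (List.range n).flatMap fun t => if h : t < R then countLayer out ctr ⟨t, h⟩ else []

omit [DecidableEq κ] in
theorem length_countProgram_le (n : ℕ) :
    (countProgram out ctr n).length ≤ n * (5 * (R + 1)) := by
  induction n with
  | zero => simp [countProgram]
  | succ n ih =>
      have : countProgram out ctr (n + 1) = countProgram out ctr n ++
          if h : n < R then countLayer out ctr ⟨n, h⟩ else [] := by
        simp [countProgram, List.range_succ]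
      rw [this, List.length_append, add_mul, one_mul]
      refine Nat.add_le_add ih ?_
      split_ifs
      · rw [length_countLayer]
      · simp

variable (out) in
/-- Number of the first `n` steps in which the two bits differ. -/
def diffCount (x : κ → Bool) (n : ℕ) : ℕ :=
  ∑ t ∈ Finset.range n,
    if h : t < R then ((x (out ⟨t, h⟩ false)).xor (x (out ⟨t, h⟩ true))).toNat else 0

omit [DecidableEq κ] in
theorem diffCount_le (x : κ → Bool) (n : ℕ) : diffCount out x n ≤ n := by
  refine (Finset.sum_le_card_nsmul _ _ 1 fun t _ => ?_).trans (by simp)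
  split_ifs
  · exact Bool.toNat_le _
  · exact Nat.zero_le _

-- Reversible gates cannot overwrite a counter, so each step writes into a fresh layer, initially
-- zero. After `n` steps the layers up to `n` are unit vectors at the partial counts and the later
-- ones are still zero.
include hctr hoc in
theorem run_countProgram (x : κ → Bool)
    (hx : ∀ t j, x (ctr t j) = decide (t = 0 ∧ j = 0)) (n : ℕ) (hn : n ≤ R) :
    (∀ w, (∀ t j, w ≠ ctr t j) → runList (countProgram out ctr n) x w = x w) ∧
    ∀ t j, runList (countProgram out ctr n) x (ctr t j) =
      decide ((t : ℕ) ≤ n ∧ j = (diffCount out x t : ℕ)) := by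
  induction n with
  | zero =>
      refine ⟨fun w _ => rfl, fun t j => ?_⟩
      change x (ctr t j) = _
      rw [hx]
      refine decide_eq_decide.2 ?_
      constructor
      · rintro ⟨rfl, rfl⟩
        simp [diffCount]
      · rintro ⟨ht, hj⟩
        obtain rfl : t = 0 := Fin.ext (Nat.le_zero.1 ht)
        exact ⟨rfl, by simpa [diffCount] using hj⟩
  | succ n ih =>
      obtain ⟨ih1, ih2⟩ := ih (Nat.le_of_succ_le hn)
      have hlt : n < R := hn
      have heq : countProgram out ctr (n + 1) =
          countProgram out ctr n ++ countLayer out ctr ⟨n, hlt⟩ := by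
        simp [countProgram, List.range_succ, hlt]
      rw [heq]
      simp only [runList_append]
      refine ⟨fun w hw => ?_, fun t j => ?_⟩
      · rw [run_countLayer_of_ne hctr hoc _ _ _ fun j => hw _ j, ih1 w hw]
      · by_cases ht : t = Fin.succ ⟨n, hlt⟩
        · subst ht
          rw [run_countLayer hctr hoc, ih1 _ (hoc _ _), ih1 _ (hoc _ _)]
          simp only [ih2]
          have hd : diffCount out x (n + 1) = diffCount out x n +
              ((x (out ⟨n, hlt⟩ false)).xor (x (out ⟨n, hlt⟩ true))).toNat := by
            simp [diffCount, Finset.sum_range_succ, hlt]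
          simp only [Fin.val_succ, Fin.val_castSucc, hd]
          cases (x (out ⟨n, hlt⟩ false)).xor (x (out ⟨n, hlt⟩ true))
          · simp
          · simp [sub_eq_iff_eq_add]
        · rw [run_countLayer_of_ne hctr hoc, ih2]
          · have ht' : (t : ℕ) ≠ n + 1 := fun e => ht (Fin.ext e)
            refine decide_eq_decide.2 (and_congr_left fun _ => ?_)
            omega
          · intro i hi
            exact ht (hctr hi).1

variable (ctr) in
/-- Adds to the wire `r` whether the final count is less than `thr`. -/
noncomputable def readout (r : κ) (thr : ℕ) : List (WGate κ) :=
  (Finset.univ.filter fun j : ZMod (R + 1) => j.val < thr).toList.flatMap fun j =>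
    [.cnot (ctr (Fin.last R) j) r]

omit [DecidableEq κ] in
theorem length_readout_le (r : κ) (thr : ℕ) : (readout ctr r thr).length ≤ R + 1 := by
  have : (readout ctr r thr).length =
      (Finset.univ.filter fun j : ZMod (R + 1) => j.val < thr).card := by
    simp [readout, List.length_flatMap]
  rw [this]
  exact (Finset.card_filter_le _ _).trans (by simp [Finset.card_univ, ZMod.card])

theorem adds_readout {r : κ} (hr : ∀ t j, r ≠ ctr t j) (thr : ℕ) :
    Adds {r} (readout ctr r thr) fun x w =>
      xorList (Finset.univ.filter fun j : ZMod (R + 1) => j.val < thr).toList fun j =>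
        if w = r then x (ctr (Fin.last R) j) else false :=
  Adds.flatMap _ fun _ _ => Adds.cnot (fun h => hr _ _ h.symm) rfl

include hctr hoc in
theorem run_count_readout {r : κ} (hr : ∀ t j, r ≠ ctr t j) (thr : ℕ) (x : κ → Bool)
    (hx : ∀ t j, x (ctr t j) = decide (t = 0 ∧ j = 0)) (hxr : x r = false) :
    runList (countProgram out ctr R ++ readout ctr r thr) x r =
      decide (diffCount out x R < thr) := by
  obtain ⟨h1, h2⟩ := run_countProgram hctr hoc x hx R le_rfl
  rw [runList_append, (adds_readout hr thr).run, h1 r hr, hxr, Bool.false_xor]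
  simp only [if_true, h2, Fin.val_last, le_refl, true_and]
  -- The count is at most `R`, so the cyclic counter of length `R + 1` has not wrapped around.
  have hval : ((diffCount out x R : ℕ) : ZMod (R + 1)).val = diffCount out x R :=
    ZMod.val_natCast_of_lt (Nat.lt_succ_of_le (diffCount_le x R))
  by_cases hlt : diffCount out x R < thr
  · rw [xorList_eq_single (a := (diffCount out x R : ZMod (R + 1))) (Finset.nodup_toList _)]
    · simp [hlt]
    · simp [hval, hlt]
    · intro b _ hb
      simp [hb]
  · rw [xorList_eq_false]
    · simp [hlt]
    · intro j hj
      simp only [Finset.mem_toList, Finset.mem_filter, Finset.mem_univ, true_and] at hj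
      simp only [decide_eq_false_iff_not]
      rintro rfl
      rw [hval] at hj
      exact hlt hj

include hctr hoc in
theorem classical_count_readout {r : κ} (hr : ∀ t j, r ≠ ctr t j) (thr : ℕ) :
    ∀ g ∈ countProgram out ctr R ++ readout ctr r thr, g.Classical := by
  intro g hg
  rcases List.mem_append.1 hg with hg | hg
  · obtain ⟨t, _, ht⟩ := List.mem_flatMap.1 hg
    split_ifs at ht
    · exact (adds_countLayer hctr hoc _).classical g ht
    · simp at ht
  · exact (adds_readout hr thr).classical g hg

end Counting

/-! ### Chebyshev's inequality for finite products -/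

section Chebyshev

variable {Ω : Type} [Fintype Ω] (w : Ω → ℝ)

theorem sum_pi_prod {R : ℕ} (f : Fin R → Ω → ℝ) :
    ∑ ω : Fin R → Ω, ∏ t, f t (ω t) = ∏ t, ∑ o, f t o := by
  rw [Finset.prod_univ_sum, Fintype.piFinset_univ]

/-- Independence: expand the square. A mixed term factorises and contains the mean of `g`, which is
zero; each of the `R` diagonal terms is the variance. -/
theorem sum_sq_sum {R : ℕ} (hw : ∑ o, w o = 1) (g : Ω → ℝ) (hg : ∑ o, w o * g o = 0) :
    ∑ ω : Fin R → Ω, (∏ t, w (ω t)) * (∑ t, g (ω t)) ^ 2 = R * ∑ o, w o * g o ^ 2 := by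
  have h1 : ∀ ω : Fin R → Ω, (∏ t, w (ω t)) * (∑ t, g (ω t)) ^ 2 =
      ∑ s, ∑ t, ∏ u, w (ω u) * ((if u = s then g (ω u) else 1) * (if u = t then g (ω u) else 1)) := by
    intro ω
    rw [pow_two, Finset.sum_mul_sum, Finset.mul_sum]
    refine Finset.sum_congr rfl fun s _ => ?_
    rw [Finset.mul_sum]
    refine Finset.sum_congr rfl fun t _ => ?_
    rw [Finset.prod_mul_distrib, Finset.prod_mul_distrib]
    simp
  simp only [h1]
  rw [Finset.sum_comm]
  have h2 : ∀ s : Fin R, ∑ ω : Fin R → Ω, ∑ t, ∏ u, w (ω u) *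
      ((if u = s then g (ω u) else 1) * (if u = t then g (ω u) else 1)) =
        ∑ o, w o * g o ^ 2 := by
    intro s
    rw [Finset.sum_comm, Finset.sum_eq_single s]
    · rw [sum_pi_prod fun u o => w o * ((if u = s then g o else 1) * (if u = s then g o else 1)),
        Finset.prod_eq_single s]
      · simp [pow_two]
      · intro u _ hu
        simp [hu, hw]
      · simp
    · intro t _ ht
      rw [sum_pi_prod fun u o => w o * ((if u = s then g o else 1) * (if u = t then g o else 1))]
      refine Finset.prod_eq_zero (Finset.mem_univ s) ?_
      simp [ht.symm, hg]
    · simp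
  rw [Finset.sum_congr rfl fun s _ => h2 s]
  simp

/-- On the bad event the squared deviation is at least `a²`, and the variance of a variable with
values 0 and 1 is bounded crudely by 1. -/
theorem chebyshev {R : ℕ} (hw0 : ∀ o, 0 ≤ w o) (hw : ∑ o, w o = 1) (Z : Ω → ℝ)
    (hZ : ∀ o, Z o = 0 ∨ Z o = 1) {a : ℝ} (ha : 0 < a) (bad : (Fin R → Ω) → Prop)
    [DecidablePred bad] (hbad : ∀ ω, bad ω → a ≤ |∑ t, Z (ω t) - R * ∑ o, w o * Z o|) :
    ∑ ω : Fin R → Ω, (if bad ω then ∏ t, w (ω t) else 0) ≤ R / a ^ 2 := by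
  set p := ∑ o, w o * Z o
  have hp0 : 0 ≤ p := Finset.sum_nonneg fun o _ => mul_nonneg (hw0 o) (by
    rcases hZ o with h | h <;> rw [h]; exact zero_le_one)
  have hp1 : p ≤ 1 := by
    rw [← hw]
    refine Finset.sum_le_sum fun o _ => mul_le_of_le_one_right (hw0 o) ?_
    rcases hZ o with h | h <;> rw [h]; exact zero_le_one
  have hsum : ∀ ω : Fin R → Ω, ∑ t, Z (ω t) - R * p = ∑ t, (Z (ω t) - p) := by
    intro ω
    simp [Finset.sum_sub_distrib]
  have hvar : ∑ o, w o * (Z o - p) ^ 2 ≤ 1 := by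
    rw [← hw]
    refine Finset.sum_le_sum fun o _ => mul_le_of_le_one_right (hw0 o) ?_
    rcases hZ o with h | h <;> rw [h] <;> nlinarith
  have hmean : ∑ o, w o * (Z o - p) = 0 := by
    simp only [mul_sub, Finset.sum_sub_distrib, ← Finset.sum_mul, hw, one_mul]
    exact sub_self _
  calc ∑ ω : Fin R → Ω, (if bad ω then ∏ t, w (ω t) else 0)
      ≤ ∑ ω : Fin R → Ω, (∏ t, w (ω t)) * (∑ t, (Z (ω t) - p)) ^ 2 / a ^ 2 := by
        refine Finset.sum_le_sum fun ω _ => ?_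
        have h0 : 0 ≤ ∏ t, w (ω t) := Finset.prod_nonneg fun t _ => hw0 _
        split_ifs with hb
        · rw [le_div_iff₀ (by positivity)]
          refine mul_le_mul_of_nonneg_left ?_ h0
          rw [← hsum, ← sq_abs (_ - _)]
          exact pow_le_pow_left₀ ha.le (hbad ω hb) 2
        · positivity
    _ = (R * ∑ o, w o * (Z o - p) ^ 2) / a ^ 2 := by
        rw [← Finset.sum_div, sum_sq_sum w hw _ hmean]
    _ ≤ R / a ^ 2 := by
        gcongr
        exact mul_le_of_le_one_right (Nat.cast_nonneg R) hvar

end Chebyshev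

end QPK

namespace QPK

/-! ### Amplification -/

section Amplify

set_option linter.unusedSectionVars false

/-- The wires that hold the indices of the runs and the counters. -/
abbrev ExtraWires (R : ℕ) (I : Type) : Type := (Fin R × I) ⊕ (Fin (R + 1) × ZMod (R + 1))

instance (R : ℕ) (I : Type) [DecidableEq I] : DecidableEq (ExtraWires R I) :=
  instDecidableEqSum

/-- The wires of `R` pairs of runs. -/
abbrev PairWires (R : ℕ) (W I : Type) : Type := ((Fin R × Bool) × W) ⊕ ExtraWires R I

instance (R : ℕ) (W I : Type) [DecidableEq W] [DecidableEq I] : DecidableEq (PairWires R W I) :=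
  instDecidableEqSum

variable {W I : Type} [Fintype W] [DecidableEq W] [Fintype I] [DecidableEq I] {R : ℕ}

/-- The values of the extra wires at the beginning. -/
def indexBits (J : Fin R → I) : ExtraWires R I → Bool :=
  Sum.elim (fun p => decide (J p.1 = p.2)) fun p => decide (p.1 = 0 ∧ p.2 = 0)

omit [Fintype I] in
theorem indexBits_injective : Function.Injective (indexBits (R := R) (I := I)) := by
  intro J J' h
  funext t
  have := congrFun h (Sum.inl (t, J t))
  simpa [indexBits, eq_comm] using this

/-- Superposition of pairs of runs over all indices. -/
noncomputable def pairsState (R : ℕ) (φ : I → Amp W) : Amp (PairWires R W I) :=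
  ∑ J : Fin R → I, (((Real.sqrt (Fintype.card I))⁻¹ ^ R : ℝ) : ℂ) •
    runsTensor (fun b : Fin R × Bool => φ (J b.1)) (Pi.single (indexBits J) 1)

theorem norm_sq_sum_of_disjoint {α : Type} [Fintype α] (c : α → ℂ)
    (h : ∀ a b, a ≠ b → c a = 0 ∨ c b = 0) : ‖∑ a, c a‖ ^ 2 = ∑ a, ‖c a‖ ^ 2 := by
  by_cases h0 : ∃ a, c a ≠ 0
  · obtain ⟨a, ha⟩ := h0
    have hz : ∀ b, b ≠ a → c b = 0 := fun b hb => (h b a hb).resolve_right ha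
    rw [Finset.sum_eq_single a (fun b _ hb => hz b hb) (by simp),
      Finset.sum_eq_single a (fun b _ hb => by rw [hz b hb]; simp) (by simp)]
  · push Not at h0
    simp [h0]

/-- The extra wires record the tuple of indices, so different tuples do not interfere: the
superposition behaves as a uniform classical mixture. -/
theorem norm_sq_pairsState (φ : I → Amp W) (y : PairWires R W I → Bool) :
    ‖pairsState R φ y‖ ^ 2 = ∑ J : Fin R → I, if y ∘ Sum.inr = indexBits J then
      ((Fintype.card I : ℝ)⁻¹) ^ R * ∏ b : Fin R × Bool, ‖φ (J b.1) fun w => y (Sum.inl (b, w))‖ ^ 2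
      else 0 := by
  rw [pairsState, Finset.sum_apply, norm_sq_sum_of_disjoint]
  · refine Finset.sum_congr rfl fun J _ => ?_
    rw [Pi.smul_apply, smul_eq_mul, runsTensor, Pi.single_apply]
    split_ifs
    · rw [one_mul, norm_mul, norm_prod, mul_pow, Finset.prod_pow, Complex.norm_real, Real.norm_eq_abs,
        sq_abs, ← pow_mul, mul_comm R 2, pow_mul, inv_pow, Real.sq_sqrt (Nat.cast_nonneg _)]
    · simp
  · intro J J' hJ
    by_cases h : y ∘ Sum.inr = indexBits J
    · right
      simp [runsTensor, h, indexBits_injective.ne hJ]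
    · left
      simp [runsTensor, h]

/-- The weight of one pair of runs. -/
noncomputable def pairWeight (φ : I → Amp W) (o : I × (Bool → W → Bool)) : ℝ :=
  (Fintype.card I : ℝ)⁻¹ * ∏ β, ‖φ o.1 (o.2 β)‖ ^ 2

/-- Measuring the superposition is drawing `R` independent samples, each consisting of an index and
the two labels of its runs. Labels whose extra wires do not encode a tuple of indices have amplitude
zero, so the event need only be compared on the others. -/
theorem sum_pairsState (φ : I → Amp W) (G : (PairWires R W I → Bool) → Prop) [DecidablePred G]
    (G' : (Fin R → I × (Bool → W → Bool)) → Prop) [DecidablePred G']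
    (hG : ∀ (J : Fin R → I) (u : Fin R × Bool → W → Bool),
      G (Sum.elim (fun p => u p.1 p.2) (indexBits J)) ↔ G' fun t => (J t, fun β => u (t, β))) :
    ∑ y, (if G y then ‖pairsState R φ y‖ ^ 2 else 0) =
      ∑ ω : Fin R → I × (Bool → W → Bool), if G' ω then ∏ t, pairWeight φ (ω t) else 0 := by
  let E : (Fin R → I × (Bool → W → Bool)) ≃ (Fin R → I) × (Fin R × Bool → W → Bool) :=
    (Equiv.arrowProdEquivProdArrow (Fin R) (fun _ => I) fun _ => Bool → W → Bool).trans
      (Equiv.prodCongr (Equiv.refl _) (Equiv.curry (Fin R) Bool (W → Bool)).symm)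
  rw [← E.symm.sum_comp, Fintype.sum_prod_type]
  simp only [norm_sq_pairsState]
  rw [← (Equiv.sumArrowEquivProdArrow ((Fin R × Bool) × W) (ExtraWires R I) Bool).symm.sum_comp,
    Fintype.sum_prod_type, Finset.sum_comm]
  rw [← Finset.sum_subset (Finset.subset_univ (Finset.univ.image (indexBits (R := R) (I := I)))),
    Finset.sum_image indexBits_injective.injOn]
  · refine Finset.sum_congr rfl fun J _ => ?_
    rw [← (Equiv.curry (Fin R × Bool) W Bool).symm.sum_comp]
    refine Finset.sum_congr rfl fun u _ => ?_
    have h1 : (Equiv.sumArrowEquivProdArrow ((Fin R × Bool) × W) (ExtraWires R I) Bool).symm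
        ((Equiv.curry (Fin R × Bool) W Bool).symm u, indexBits J) =
          Sum.elim (fun p => u p.1 p.2) (indexBits J) := by
      funext i
      cases i <;> rfl
    have h2 : E.symm (J, u) = fun t => (J t, fun β => u (t, β)) := rfl
    rw [h1, h2]
    by_cases hg : G' fun t => (J t, fun β => u (t, β))
    · rw [if_pos hg, if_pos ((hG J u).2 hg), Finset.sum_eq_single J]
      · rw [if_pos (Sum.elim_comp_inr _ _)]
        simp only [pairWeight, Finset.prod_mul_distrib, Finset.prod_const, Finset.card_univ,
          Fintype.card_fin, Fintype.prod_prod_type, Sum.elim_inl]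
      · intro J' _ hJ'
        rw [if_neg]
        intro h
        exact hJ' (indexBits_injective h).symm
      · simp
    · rw [if_neg hg, if_neg fun h => hg ((hG J u).1 h)]
  · intro z _ hz
    refine Finset.sum_eq_zero fun u _ => ?_
    rw [Finset.sum_eq_zero, ite_self]
    intro J _
    rw [if_neg]
    intro h
    exact hz (Finset.mem_image.2 ⟨J, Finset.mem_univ _, h.symm⟩)

theorem sum_pairWeight [Nonempty I] {φ : I → Amp W} (hφ : ∀ i, ∑ x, ‖φ i x‖ ^ 2 = 1) :
    ∑ o, pairWeight φ o = 1 := by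
  rw [Fintype.sum_prod_type]
  have : ∀ i, ∑ u : Bool → W → Bool, pairWeight φ (i, u) = (Fintype.card I : ℝ)⁻¹ := by
    intro i
    simp only [pairWeight]
    rw [← Finset.mul_sum]
    have := Finset.prod_univ_sum (fun _ : Bool => (Finset.univ : Finset (W → Bool)))
      (fun _ x => ‖φ i x‖ ^ 2)
    rw [Fintype.piFinset_univ] at this
    rw [← this]
    simp [hφ]
  simp only [this]
  simp

theorem pairWeight_nonneg (φ : I → Amp W) (o : I × (Bool → W → Bool)) : 0 ≤ pairWeight φ o := by
  unfold pairWeight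
  positivity

/-- The probability that a bit `v` is true. -/
noncomputable def trueWeight (v : W) (φ : Amp W) : ℝ := ∑ x, if x v then ‖φ x‖ ^ 2 else 0

/-- Given the index, the two runs are independent with the same probability `p` of a true bit, so
their bits differ with probability `2p(1 - p)`. This quantity does not depend on the direction of
the bias. -/
theorem sum_pairWeight_diff {φ : I → Amp W} (hφ : ∀ i, ∑ x, ‖φ i x‖ ^ 2 = 1) (v : W) :
    ∑ o : I × (Bool → W → Bool),
      pairWeight φ o * (((o.2 false v).xor (o.2 true v)).toNat : ℝ) =
        (Fintype.card I : ℝ)⁻¹ * ∑ i, 2 * trueWeight v (φ i) * (1 - trueWeight v (φ i)) := by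
  rw [Fintype.sum_prod_type, Finset.mul_sum]
  refine Finset.sum_congr rfl fun i _ => ?_
  have hF : ∑ x, (if x v then 0 else ‖φ i x‖ ^ 2) = 1 - trueWeight v (φ i) := by
    rw [eq_sub_iff_add_eq, trueWeight, ← Finset.sum_add_distrib, ← hφ i]
    refine Finset.sum_congr rfl fun x _ => ?_
    split_ifs <;> simp
  have hpt : ∀ u : Bool → W → Bool,
      pairWeight φ (i, u) * (((u false v).xor (u true v)).toNat : ℝ) =
        (Fintype.card I : ℝ)⁻¹ *
          ((∏ β, if u β v = β then ‖φ i (u β)‖ ^ 2 else 0) +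
            ∏ β, if u β v = !β then ‖φ i (u β)‖ ^ 2 else 0) := by
    intro u
    simp only [pairWeight, Fintype.prod_bool]
    cases u false v <;> cases u true v <;> simp
  simp only [hpt]
  rw [← Finset.mul_sum, Finset.sum_add_distrib]
  congr 1
  have h1 := Finset.prod_univ_sum (fun _ : Bool => (Finset.univ : Finset (W → Bool)))
    (fun β x => if x v = β then ‖φ i x‖ ^ 2 else 0)
  have h2 := Finset.prod_univ_sum (fun _ : Bool => (Finset.univ : Finset (W → Bool)))
    (fun β x => if x v = !β then ‖φ i x‖ ^ 2 else 0)
  rw [Fintype.piFinset_univ] at h1 h2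
  rw [← h1, ← h2, Fintype.prod_bool, Fintype.prod_bool]
  have hF' : ∑ x, (if x v = false then ‖φ i x‖ ^ 2 else 0) = 1 - trueWeight v (φ i) := by
    rw [← hF]
    refine Finset.sum_congr rfl fun x _ => ?_
    cases x v <;> simp
  simp only [Bool.not_true, Bool.not_false, hF']
  change trueWeight v (φ i) * _ + _ * trueWeight v (φ i) = _
  ring

theorem sum_basisTensor {S : Type} [Fintype S] [DecidableEq S] (s : S → Bool) (φ : Amp W)
    (G : (S ⊕ W → Bool) → Prop) [DecidablePred G] :
    ∑ x, (if G x then ‖basisTensor s φ x‖ ^ 2 else 0) =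
      ∑ y, if G (Sum.elim s y) then ‖φ y‖ ^ 2 else 0 := by
  rw [← (Equiv.sumArrowEquivProdArrow S W Bool).symm.sum_comp, Fintype.sum_prod_type,
    Finset.sum_eq_single s]
  · refine Finset.sum_congr rfl fun y _ => ?_
    change (if G (Sum.elim s y) then ‖basisTensor s φ (Sum.elim s y)‖ ^ 2 else 0) = _
    have : basisTensor s φ (Sum.elim s y) = φ y := by
      rw [basisTensor, if_pos (Sum.elim_comp_inl _ _), Sum.elim_comp_inr]
    rw [this]
  · intro t _ ht
    refine Finset.sum_eq_zero fun y _ => ?_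
    change (if G (Sum.elim t y) then ‖basisTensor s φ (Sum.elim t y)‖ ^ 2 else 0) = _
    have : basisTensor s φ (Sum.elim t y) = 0 := by
      rw [basisTensor, if_neg]
      rwa [Sum.elim_comp_inl]
    rw [this]
    simp
  · simp

theorem sum_norm_sq_basisTensor {S : Type} [Fintype S] [DecidableEq S] (s : S → Bool)
    (φ : Amp W) : ∑ x, ‖basisTensor s φ x‖ ^ 2 = ∑ y, ‖φ y‖ ^ 2 := by
  simpa using sum_basisTensor s φ fun _ => True

omit [Fintype W] in
theorem appList_allRuns_pairsState {S : Type} [DecidableEq S] (gs : List (WGate (S ⊕ W)))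
    (s : S → Bool) (φ φ' : I → Amp W)
    (h : ∀ i, appList gs (basisTensor s (φ i)) = basisTensor s (φ' i)) :
    appList (allRuns (Fin R × Bool) gs) (basisTensor s (pairsState R φ)) =
      basisTensor s (pairsState R φ') := by
  have hsum : ∀ φ : I → Amp W, basisTensor s (pairsState R φ) =
      ∑ J : Fin R → I, (((Real.sqrt (Fintype.card I))⁻¹ ^ R : ℝ) : ℂ) •
        basisTensor s (runsTensor (fun b : Fin R × Bool => φ (J b.1))
          (Pi.single (indexBits J) 1)) := by
    intro φ
    funext x
    rw [Finset.sum_apply]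
    by_cases hx : x ∘ Sum.inl = s
    · simp only [basisTensor, if_pos hx, pairsState, Finset.sum_apply, Pi.smul_apply]
    · simp [basisTensor, if_neg hx]
  rw [hsum, hsum, map_sum]
  refine Finset.sum_congr rfl fun J _ => ?_
  rw [map_smul]
  exact congrArg _ (appList_allRuns gs s (fun b : Fin R × Bool => φ (J b.1))
    (fun b => φ' (J b.1)) (fun b => h (J b.1)) (Pi.single (indexBits J) 1))

end Amplify

end QPK

namespace QPK

/-! ### Threshold decision with error at most one third. -/

section Decision

variable {W I : Type} [Fintype W] [DecidableEq W] [Fintype I] [DecidableEq I]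

/-- A wrong decision means a deviation of at least `Rδ/2`, which has probability at most `R /
(Rδ/2)² = 4 / (Rδ²)`; the bound `12 ≤ Rδ²` makes this at most `1/3`. -/
theorem two_thirds_le_of_chebyshev {Ω : Type} [Fintype Ω] (w : Ω → ℝ) {R : ℕ} (hw0 : ∀ o, 0 ≤ w o)
    (hw : ∑ o, w o = 1) (Z : Ω → ℕ) (hZ : ∀ o, Z o = 0 ∨ Z o = 1) {δ : ℝ} (hδ : 0 < δ)
    (hR : 12 ≤ R * δ ^ 2) (good : (Fin R → Ω) → Prop) [DecidablePred good]
    (hgood : ∀ ω, ¬ good ω → R * (δ / 2) ≤ |((∑ t, Z (ω t) : ℕ) : ℝ) - R * ∑ o, w o * Z o|) :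
    2 / 3 ≤ ∑ ω : Fin R → Ω, if good ω then ∏ t, w (ω t) else 0 := by
  have hR0 : (0 : ℝ) < R := by
    rcases (Nat.cast_nonneg R : (0 : ℝ) ≤ R).eq_or_lt with h | h
    · rw [← h] at hR
      norm_num at hR
    · exact h
  have htotal : ∑ ω : Fin R → Ω, ∏ t, w (ω t) = 1 := by
    rw [sum_pi_prod fun _ => w]
    simp [hw]
  have hsplit : (∑ ω : Fin R → Ω, if good ω then ∏ t, w (ω t) else 0) +
      ∑ ω : Fin R → Ω, (if ¬ good ω then ∏ t, w (ω t) else 0) = 1 := by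
    rw [← Finset.sum_add_distrib, ← htotal]
    refine Finset.sum_congr rfl fun ω _ => ?_
    by_cases h : good ω <;> simp [h]
  have hbad := chebyshev (R := R) w hw0 hw (fun o => (Z o : ℝ))
    (fun o => by rcases hZ o with h | h <;> simp [h]) (a := R * (δ / 2)) (by positivity)
    (fun ω => ¬ good ω) (fun ω h => by simpa using hgood ω h)
  have h3 : (R : ℝ) / (R * (δ / 2)) ^ 2 ≤ 1 / 3 := by
    rw [div_le_div_iff₀ (by positivity) (by norm_num)]
    nlinarith
  linarith

/-- Amplification: a family of runs, indexed by `I`, whose output bit is unbiased for some graphs and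
biased for others is turned into a circuit that distinguishes these graphs. -/
theorem exists_amplified [Nonempty I] {m : ℕ} (hm : 0 < m) (v : W)
    (gs : List (WGate ((Fin m × Fin m) ⊕ W))) (φ : I → Amp W) (hφ : ∀ i, ∑ x, ‖φ i x‖ ^ 2 = 1)
    (R : ℕ) {δ : ℝ} (hδ : 0 < δ) (hR : 12 ≤ R * δ ^ 2) :
    ∃ (C : Circuit) (a : Ket),
      C.size ≤ 3 + (R * 2 * gs.length + (R * (5 * (R + 1)) + (R + 1))) *
        (3 * (m * m + (R * 2 * Fintype.card W + (R * Fintype.card I + (R + 1) * (R + 1)))) + 8) ∧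
      a.qubits = R * 2 * Fintype.card W + (R * Fintype.card I + (R + 1) * (R + 1)) ∧
      ∀ (G : SimpleGraph (Fin m)) (φ' : I → Amp W),
        (∀ i, appList gs (basisTensor (adjBits G) (φ i)) = basisTensor (adjBits G) (φ' i)) →
        ((∀ i, trueWeight v (φ' i) = 1 / 2) →
          2 / 3 ≤ (C.output ((graphState G).tensor a.toOp)).overlap (Ket.ofBits [false])) ∧
        ((Fintype.card I : ℝ)⁻¹ * ∑ i, 2 * trueWeight v (φ' i) * (1 - trueWeight v (φ' i)) ≤
            1 / 2 - δ →
          2 / 3 ≤ (C.output ((graphState G).tensor a.toOp)).overlap (Ket.ofBits [true])) := by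
  set out : Fin R → Bool → (Fin m × Fin m) ⊕ PairWires R W I := fun t β =>
    Sum.inr (Sum.inl ((t, β), v))
  set ctr : Fin (R + 1) → ZMod (R + 1) → (Fin m × Fin m) ⊕ PairWires R W I := fun t j =>
    Sum.inr (Sum.inr (Sum.inr (t, j)))
  -- A diagonal entry of the adjacency matrix. A graph has no loops, so this wire starts at zero and
  -- can take the answer.
  set r : (Fin m × Fin m) ⊕ PairWires R W I := Sum.inl (⟨0, hm⟩, ⟨0, hm⟩)
  have hctr : Function.Injective2 ctr := by
    intro t t' j j' h
    simpa [ctr] using h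
  have hoc : ∀ t b s j, out t b ≠ ctr s j := by
    intro t b s j h
    simp [out, ctr] at h
  have hr : ∀ t j, r ≠ ctr t j := by
    intro t j h
    simp [r, ctr] at h
  -- Midway between the expected count `R/2` in the unbiased case and the upper bound `R(1/2 - δ)`
  -- for it in the biased case.
  set thr : ℕ := ⌈(R : ℝ) / 2 - R * (δ / 2)⌉₊
  have hcard : Fintype.card (PairWires R W I) =
      R * 2 * Fintype.card W + (R * Fintype.card I + (R + 1) * (R + 1)) := by
    simp [Fintype.card_sum, Fintype.card_prod, ZMod.card]
  have hunit : ∑ y, ‖pairsState R φ y‖ ^ 2 = 1 := by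
    have h := sum_pairsState (R := R) φ (fun _ => True) (fun _ => True) (fun _ _ => Iff.rfl)
    simp only [if_true] at h
    rw [h, sum_pi_prod fun _ => pairWeight φ]
    simp [sum_pairWeight hφ]
  obtain ⟨C, a, hC, ha, hov⟩ := exists_circuit hm
    (allRuns (Fin R × Bool) gs ++ (countProgram out ctr R ++ readout ctr r thr))
    (pairsState R φ) hunit
  refine ⟨C, a, ?_, ha.trans hcard, ?_⟩
  · refine hC.trans ?_
    rw [hcard]
    refine Nat.add_le_add_left (Nat.mul_le_mul_right _ ?_) _
    rw [List.length_append, List.length_append, length_allRuns]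
    have h1 := length_countProgram_le (out := out) (ctr := ctr) R
    have h2 := length_readout_le (ctr := ctr) r thr
    simp only [Fintype.card_prod, Fintype.card_fin, Fintype.card_bool]
    omega
  · intro G φ' hrun
    have hφ' : ∀ i, ∑ x, ‖φ' i x‖ ^ 2 = 1 := by
      intro i
      rw [← hφ i, ← sum_norm_sq_basisTensor (adjBits G) (φ' i), ← hrun i, sum_norm_sq_appList,
        sum_norm_sq_basisTensor]
    let Z : I × (Bool → W → Bool) → ℕ := fun o => ((o.2 false v).xor (o.2 true v)).toNat
    have hprob : ∀ b, (C.output ((graphState G).tensor a.toOp)).overlap (Ket.ofBits [b]) =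
        ∑ ω : Fin R → I × (Bool → W → Bool),
          if decide (∑ t, Z (ω t) < thr) = b then ∏ t, pairWeight φ' (ω t) else 0 := by
      intro b
      rw [hov]
      simp only [appList_append (allRuns (Fin R × Bool) gs)]
      -- Counting and reading out are classical and are moved from the state to the event.
      rw [sum_appList_of_classical (classical_count_readout hctr hoc hr thr) _
        fun x t => if x r = b then t else 0]
      have hpairs := appList_allRuns_pairsState (R := R) gs (adjBits G) φ φ' hrun
      rw [hpairs, sum_basisTensor (adjBits G) (pairsState R φ')
        (fun x => runList (countProgram out ctr R ++ readout ctr r thr) x r = b)]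
      refine sum_pairsState φ' _ (fun ω => decide (∑ t, Z (ω t) < thr) = b) fun J u => ?_
      rw [run_count_readout hctr hoc hr]
      · have : diffCount out (Sum.elim (adjBits G)
            (Sum.elim (fun p => u p.1 p.2) (indexBits J) : PairWires R W I → Bool)) R =
              ∑ t, Z (J t, fun β => u (t, β)) := by
          rw [diffCount, Finset.sum_range]
          refine Finset.sum_congr rfl fun t _ => ?_
          rw [dif_pos t.2]
          rfl
        rw [this]
      · intro t j
        rfl
      · simp [r, adjBits]
    have hZ : ∀ o, Z o = 0 ∨ Z o = 1 := by
      intro o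
      change Bool.toNat _ = 0 ∨ Bool.toNat _ = 1
      cases (o.2 false v).xor (o.2 true v) <;> simp
    have hmean : ∑ o, pairWeight φ' o * (Z o : ℝ) = (Fintype.card I : ℝ)⁻¹ *
        ∑ i, 2 * trueWeight v (φ' i) * (1 - trueWeight v (φ' i)) := sum_pairWeight_diff hφ' v
    have hR0 : (0 : ℝ) ≤ R := Nat.cast_nonneg R
    constructor
    · intro hq
      rw [hprob]
      refine two_thirds_le_of_chebyshev (pairWeight φ') (pairWeight_nonneg φ') (sum_pairWeight hφ') Z
        hZ hδ hR _ fun ω hω => ?_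
      rw [Bool.not_eq_false, decide_eq_true_iff, Nat.lt_ceil] at hω
      have : (Fintype.card I : ℝ)⁻¹ *
          ∑ i, 2 * trueWeight v (φ' i) * (1 - trueWeight v (φ' i)) = 1 / 2 := by
        have hI : (Fintype.card I : ℝ) ≠ 0 := by exact_mod_cast Fintype.card_ne_zero
        simp only [hq]
        rw [Finset.sum_const, Finset.card_univ, nsmul_eq_mul]
        field_simp
        norm_num
      rw [hmean, this, abs_sub_comm]
      refine le_trans ?_ (le_abs_self _)
      linarith
    · intro hq
      rw [hprob]
      refine two_thirds_le_of_chebyshev (pairWeight φ') (pairWeight_nonneg φ') (sum_pairWeight hφ') Z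
        hZ hδ hR _ fun ω hω => ?_
      rw [decide_eq_true_iff, not_lt, Nat.ceil_le] at hω
      rw [hmean]
      refine le_trans ?_ (le_abs_self _)
      nlinarith

end Decision

end QPK

namespace QPK

/-! ### The success probability of an adversary as a linear functional of its input -/

/-- A vector with ancillas in state `|0⟩` behind it. -/
def padAncillas {q : ℕ} (anc : ℕ) (ψ : Bits q → ℂ) : Bits (q + anc) → ℂ := fun x =>
  if ∀ i, x (Fin.natAdd q i) = false then ψ fun i => x (Fin.castAdd anc i) else 0

theorem pureOp_addAncillas {q : ℕ} (anc : ℕ) (ψ : Bits q → ℂ) :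
    (pureOp ψ).addAncillas anc = pureOp (padAncillas anc ψ) := by
  refine congrArg (QOp.mk (q + anc)) ?_
  ext x y
  change (if (∀ i, x (Fin.natAdd q i) = false) ∧ (∀ i, y (Fin.natAdd q i) = false) then
    ψ (fun i => x (Fin.castAdd anc i)) * star (ψ fun i => y (Fin.castAdd anc i)) else 0) =
      padAncillas anc ψ x * star (padAncillas anc ψ y)
  simp only [padAncillas]
  by_cases hx : ∀ i, x (Fin.natAdd q i) = false <;> by_cases hy : ∀ i, y (Fin.natAdd q i) = false
  · rw [if_pos ⟨hx, hy⟩, if_pos hx, if_pos hy]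
    rfl
  · rw [if_neg fun h => hy h.2, if_neg hy, star_zero, mul_zero]
  · rw [if_neg fun h => hx h.1, if_neg hx, zero_mul]
  · rw [if_neg fun h => hx h.1, if_neg hx, zero_mul]

/-- The gates of a circuit that act on existing wires, for an input register of `q` qubits. -/
def Circuit.wireGates (C : Circuit) (q : ℕ) : List (WGate (Fin (q + C.anc))) :=
  C.gates.filterMap (Gate.toWGate (q + C.anc))

/-- The squared norm of the component of a vector whose first `r` qubits are in the state `f`. -/
noncomputable def firstOverlap {r w : ℕ} (f : Bits r → ℂ) (ψ : Bits w → ℂ) : ℝ :=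
  ∑ z : Bits (w - r), ‖∑ y : Bits r, star (f y) * ψ (y.join z)‖ ^ 2

/-- For each value `z` of the traced-out wires the double sum over output labels factorises into an
inner product with `f` and its conjugate. This puts the success probability into the form that a
swap test measures. -/
theorem overlap_output_pure (C : Circuit) {q : ℕ} (ψ : Bits q → ℂ) (f : Ket)
    (h : f.qubits = min C.out (q + C.anc)) :
    (C.output (pureOp ψ)).overlap f = firstOverlap (fun x => f.amp fun i => x (Fin.cast h i))
      (appList (C.wireGates q) (padAncillas C.anc ψ)) := by
  have hfin : C.output (pureOp ψ) =
      (pureOp (appList (C.wireGates q) (padAncillas C.anc ψ))).takeFirst C.out := by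
    rw [Circuit.wireGates, ← gatesOp_mulVec_filterMap]
    simp only [Circuit.output, Circuit.final]
    rw [pureOp_addAncillas]
    refine congrArg (fun V => QOp.takeFirst ⟨q + C.anc, V⟩ C.out) ?_
    exact conj_vecMulVec _ _
  rw [hfin]
  refine (overlap_takeFirst _ _ _ h _ fun _ => rfl).trans ?_
  rw [firstOverlap]
  set φ := appList (C.wireGates q) (padAncillas C.anc ψ)
  have : ∀ z : Bits (q + C.anc - min C.out (q + C.anc)),
      (‖∑ y : Bits (min C.out (q + C.anc)),
        star (f.amp fun i => y (Fin.cast h i)) * φ (y.join z)‖ ^ 2 : ℂ) =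
      ∑ x : Bits (min C.out (q + C.anc)), ∑ y : Bits (min C.out (q + C.anc)),
        star (f.amp fun i => x (Fin.cast h i)) * (φ (x.join z) * star (φ (y.join z))) *
          f.amp fun i => y (Fin.cast h i) := by
    intro z
    rw [← Complex.mul_conj', ← Complex.star_def, star_sum, Finset.sum_mul_sum]
    refine Finset.sum_congr rfl fun x _ => Finset.sum_congr rfl fun y _ => ?_
    rw [star_mul, star_star]
    ring
  rw [← Complex.ofReal_re (∑ z, _)]
  congr 1
  push_cast
  simp only [this, Matrix.vecMulVec_apply, Pi.star_apply, Finset.mul_sum, Finset.sum_mul]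
  rw [Finset.sum_comm]
  conv_rhs => rw [Finset.sum_comm]
  rw [Finset.sum_comm]
  refine Finset.sum_congr rfl fun x _ => ?_
  rw [Finset.sum_comm]

/-- Adding ancillas, conjugation, the partial trace and the matrix element at `f` are all linear in
the input operator. Hence the success on a mixture may be computed from any decomposition of it, in
particular from one into unnormalised pure slices and from one into product states. -/
theorem overlap_output_linear (C : Circuit) (q : ℕ) (f : Ket) :
    ∃ L : OpMat q →ₗ[ℂ] ℂ, ∀ M, (C.output ⟨q, M⟩).overlap f = (L M).re := by
  by_cases h : f.qubits = min C.out (q + C.anc)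
  · let V := gatesOp (q + C.anc) C.gates
    let P : OpMat q → OpMat (q + C.anc) := fun M => Matrix.of fun x y =>
      if (∀ i, x (Fin.natAdd q i) = false) ∧ (∀ i, y (Fin.natAdd q i) = false) then
        M (fun i => x (Fin.castAdd C.anc i)) (fun i => y (Fin.castAdd C.anc i)) else 0
    have hadd : ∀ M M', P (M + M') = P M + P M' := by
      intro M M'
      ext x y
      simp only [P, Matrix.of_apply, Matrix.add_apply]
      split_ifs
      · rfl
      · exact (add_zero (0 : ℂ)).symm
    have hsmul : ∀ (c : ℂ) M, P (c • M) = c • P M := by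
      intro c M
      ext x y
      simp only [P, Matrix.of_apply, Matrix.smul_apply]
      split_ifs
      · rfl
      · exact (smul_zero c).symm
    refine ⟨{
      toFun := fun M => ∑ x : Bits (min C.out (q + C.anc)), ∑ y : Bits (min C.out (q + C.anc)),
        star (f.amp fun i => x (Fin.cast h i)) *
          (∑ z : Bits (q + C.anc - min C.out (q + C.anc)),
            (V * P M * V.conjTranspose) (x.join z) (y.join z)) * f.amp fun i => y (Fin.cast h i)
      map_add' := fun M M' => by
        simp only [hadd, Matrix.add_apply, Finset.sum_add_distrib, mul_add, add_mul]
      map_smul' := fun c M => by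
        simp only [hsmul, Matrix.mul_smul, Matrix.smul_mul, Matrix.smul_apply, smul_eq_mul,
          Finset.mul_sum, RingHom.id_apply]
        refine Finset.sum_congr rfl fun x _ => Finset.sum_congr rfl fun y _ => ?_
        simp only [Finset.sum_mul, Finset.mul_sum]
        refine Finset.sum_congr rfl fun z _ => ?_
        ring }, fun M => ?_⟩
    exact overlap_takeFirst _ _ _ h _ fun _ => rfl
  · exact ⟨0, fun M => dif_neg h⟩

theorem overlap_output_sum {ι : Type*} (s : Finset ι) (C : Circuit) {q : ℕ} (f : Ket) (c : ι → ℝ)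
    (M : ι → OpMat q) : (C.output ⟨q, ∑ i ∈ s, (c i : ℂ) • M i⟩).overlap f =
      ∑ i ∈ s, c i * (C.output ⟨q, M i⟩).overlap f := by
  obtain ⟨L, hL⟩ := overlap_output_linear C q f
  simp only [hL, map_sum, map_smul, Complex.re_sum, smul_eq_mul, Complex.re_ofReal_mul]

/-! ### Tensor powers -/

/-- The product of `K` operators on `n` qubits and of the projection to a vector. -/
def productInput {n K b : ℕ} (G : Fin K → OpMat n) (v : Bits b → ℂ) : OpMat (K * n + b) :=
  fun x y => (∏ l, G l (fun t => x (Fin.castAdd b (finProdFinEquiv (l, t))))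
      (fun t => y (Fin.castAdd b (finProdFinEquiv (l, t))))) *
    (v (fun i => x (Fin.natAdd (K * n) i)) * star (v fun i => y (Fin.natAdd (K * n) i)))

/-- `finProdFinEquiv` sends `(l, t)` to `t + n * l`, so copy `l` occupies the consecutive block of
wires that iterated tensoring assigns to it. -/
theorem tensorPow_eq {n : ℕ} (M : OpMat n) (k : ℕ) :
    (⟨n, M⟩ : QOp).tensorPow k = ⟨k * n, fun x y => ∏ l : Fin k,
      M (fun t => x (finProdFinEquiv (l, t))) fun t => y (finProdFinEquiv (l, t))⟩ := by
  induction k with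
  | zero =>
      refine QOp.ext_cast (by simp [QOp.tensorPow]) fun x y => ?_
      have : x = y := funext fun i => Fin.elim0 i
      subst this
      simp only [QOp.tensorPow, Finset.univ_eq_empty, Finset.prod_empty]
      exact Matrix.one_apply_eq x
  | succ k ih =>
      rw [QOp.tensorPow, ih]
      refine QOp.ext_cast (Nat.succ_mul k n).symm fun x y => ?_
      refine Eq.trans ?_ (Fin.prod_univ_castSucc _).symm
      have e2 : ∀ (x : Bits (k * n + n)) (t : Fin n), x (Fin.natAdd (k * n) t) =
          x (Fin.cast (Nat.succ_mul k n) (finProdFinEquiv (Fin.last k, t))) := by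
        intro x t
        congr 1
        apply Fin.ext
        simp [finProdFinEquiv, Nat.mul_comm, Nat.add_comm]
      refine congrArg₂ (· * ·) rfl ?_
      exact congrArg₂ M (funext fun t => e2 x t) (funext fun t => e2 y t)

/-- The vector of the advice and of the auxiliary input. -/
def Ket.pair (a h : Ket) : Bits (a.qubits + h.qubits) → ℂ := fun x =>
  a.amp (fun i => x (Fin.castAdd h.qubits i)) * h.amp fun i => x (Fin.natAdd a.qubits i)

/-- The ciphertext is treated as the last of `k + 1` factors; for `B = M` this is the input with `k
+ 1` copies of the key. -/
theorem input_eq {n : ℕ} (M B : OpMat n) (k : ℕ) (a h : Ket) :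
    ((((⟨n, M⟩ : QOp).tensorPow k).tensor ⟨n, B⟩).tensor (a.toOp.tensor h.toOp)) =
      ⟨(k + 1) * n + (a.qubits + h.qubits),
        productInput (fun l : Fin (k + 1) => if l = Fin.last k then B else M) (a.pair h)⟩ := by
  rw [tensorPow_eq]
  have hq : k * n + n + (a.qubits + h.qubits) = (k + 1) * n + (a.qubits + h.qubits) := by
    rw [Nat.succ_mul]
  refine QOp.ext_cast hq fun x y => ?_
  have e1 : ∀ (x : Bits (k * n + n + (a.qubits + h.qubits))) (t : Fin n),
      x (Fin.castAdd _ (Fin.natAdd (k * n) t)) =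
        x (Fin.cast hq.symm (Fin.castAdd _ (finProdFinEquiv (Fin.last k, t)))) := by
    intro x t
    congr 1
    apply Fin.ext
    simp [finProdFinEquiv, Nat.mul_comm, Nat.add_comm]
  have e2 : ∀ (x : Bits (k * n + n + (a.qubits + h.qubits))) (t : Fin (a.qubits + h.qubits)),
      x (Fin.natAdd (k * n + n) t) = x (Fin.cast hq.symm (Fin.natAdd ((k + 1) * n) t)) := by
    intro x t
    congr 1
    apply Fin.ext
    simp
  have hprod : ∀ p q r s : ℂ, p * star q * (r * star s) = p * r * star (q * s) := by
    intro p q r s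
    rw [star_mul]
    ring
  have hfirst : ∀ l : Fin k, (fun l : Fin (k + 1) => if l = Fin.last k then B else M) l.castSucc = M :=
    fun l => if_neg (Fin.castSucc_lt_last l).ne
  have hlast : (fun l : Fin (k + 1) => if l = Fin.last k then B else M) (Fin.last k) = B := if_pos rfl
  generalize (fun l : Fin (k + 1) => if l = Fin.last k then B else M) = G at *
  refine congrArg₂ (· * ·) (Eq.trans ?_ (Fin.prod_univ_castSucc _).symm) ?_
  · refine congrArg₂ (· * ·) ?_ ?_
    · refine Eq.trans ?_ (Finset.prod_congr rfl fun l _ => by rw [hfirst l])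
      rfl
    · subst hlast
      exact congrArg₂ (G (Fin.last k)) (funext fun t => e1 x t) (funext fun t => e1 y t)
  · refine Eq.trans ?_ (congrArg₂ (fun u v => a.pair h u * star (a.pair h v))
      (funext fun t => e2 x t) (funext fun t => e2 y t))
    exact hprod _ _ _ _

end QPK

namespace QPK

/-! ### Gates on one part of a register split in two. -/

section Prod

variable {S W : Type} [DecidableEq S] [DecidableEq W]

theorem appList_map_inl (gs : List (WGate S)) (ψ : Amp (S ⊕ W)) (y : S → Bool) (z : W → Bool) :
    appList (gs.map (WGate.map Sum.inl)) ψ (Sum.elim y z) =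
      appList gs (fun y => ψ (Sum.elim y z)) y := by
  have h : ∀ y' : S → Bool, Function.extend Sum.inl y' (Sum.elim y z) = Sum.elim y' z := by
    intro y'
    funext k
    cases k with
    | inl i => simp [Sum.inl_injective.extend_apply]
    | inr j => rw [Function.extend_apply' _ _ _ (by simp)]; rfl
  have := appList_map (Sum.inl_injective (β := W)) gs ψ y (Sum.elim y z)
  simpa only [h] using this

theorem appList_map_inr (gs : List (WGate W)) (ψ : Amp (S ⊕ W)) (y : S → Bool) (z : W → Bool) :
    appList (gs.map (WGate.map Sum.inr)) ψ (Sum.elim y z) =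
      appList gs (fun z => ψ (Sum.elim y z)) z := by
  have h : ∀ z' : W → Bool, Function.extend Sum.inr z' (Sum.elim y z) = Sum.elim y z' := by
    intro z'
    funext k
    cases k with
    | inr i => simp [Sum.inr_injective.extend_apply]
    | inl j => rw [Function.extend_apply' _ _ _ (by simp)]; rfl
  have := appList_map (Sum.inr_injective (α := S)) gs ψ z (Sum.elim y z)
  simpa only [h] using this

theorem appList_map_inr_basisTensor (gs : List (WGate W)) (s : S → Bool) (φ : Amp W) :
    appList (gs.map (WGate.map Sum.inr)) (basisTensor s φ) = basisTensor s (appList gs φ) := by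
  funext x
  rw [← Sum.elim_comp_inl_inr x, appList_map_inr]
  rw [Sum.elim_comp_inl_inr]
  by_cases h : x ∘ Sum.inl = s
  · rw [basisTensor, if_pos h]
    refine congrFun (congrArg (appList gs) (funext fun z => ?_)) _
    exact if_pos h
  · rw [basisTensor, if_neg h]
    refine Eq.trans ?_ (congrFun (map_zero (appList gs)) (x ∘ Sum.inr))
    refine congrFun (congrArg (appList gs) (funext fun z => ?_)) _
    exact if_neg h

omit [DecidableEq S] [DecidableEq W] in
theorem sum_sum_elim [Fintype S] [Fintype W] [DecidableEq S] [DecidableEq W]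
    {M : Type*} [AddCommMonoid M] (F : (S ⊕ W → Bool) → M) :
    ∑ x, F x = ∑ y : S → Bool, ∑ z : W → Bool, F (Sum.elim y z) := by
  rw [← (Equiv.sumArrowEquivProdArrow S W Bool).symm.sum_comp, Fintype.sum_prod_type]
  rfl

end Prod

/-! ### The swap test -/

section SwapTest

/-- A register of `q` wires, a register of `r` wires and a control wire. -/
abbrev SwapWires (q r : ℕ) : Type := Fin q ⊕ (Fin r ⊕ Unit)

instance (q r : ℕ) : DecidableEq (SwapWires q r) := instDecidableEqSum

variable {q r : ℕ}

/-- Labels of the three registers of a swap test. -/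
def swapBits (x : Bits q) (u : Bits r) (b : Bool) : SwapWires q r → Bool :=
  Sum.elim x (Sum.elim u fun _ => b)

theorem sum_swapBits {M : Type*} [AddCommMonoid M] (F : (SwapWires q r → Bool) → M) :
    ∑ x, F x = ∑ x : Bits q, ∑ u : Bits r, ∑ b : Bool, F (swapBits x u b) := by
  rw [sum_sum_elim]
  refine Finset.sum_congr rfl fun x _ => ?_
  rw [sum_sum_elim]
  refine Finset.sum_congr rfl fun u _ => ?_
  exact ((Equiv.funUnique Unit Bool).symm.sum_comp _).symm

/-- Swaps, controlled by the last wire, wires of the second register and wires with the same number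
of the first register. -/
def swapGates (hr : r ≤ q) (l : List (Fin r)) : List (WGate (SwapWires q r)) :=
  l.flatMap fun i => [.cnot (.inr (.inl i)) (.inl (i.castLE hr)),
    .toffoli (.inr (.inr ())) (.inl (i.castLE hr)) (.inr (.inl i)),
    .cnot (.inr (.inl i)) (.inl (i.castLE hr))]

theorem length_swapGates (hr : r ≤ q) (l : List (Fin r)) :
    (swapGates hr l).length = 3 * l.length := by
  induction l with
  | nil => rfl
  | cons i l ih =>
      rw [swapGates, List.flatMap_cons, List.length_append]
      change 3 + (swapGates hr l).length = _
      rw [ih, List.length_cons]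
      ring

theorem classical_swapGates (hr : r ≤ q) (l : List (Fin r)) :
    ∀ g ∈ swapGates hr l, g.Classical := by
  intro g hg
  obtain ⟨i, -, hg⟩ := List.mem_flatMap.1 hg
  simp only [List.mem_cons, List.not_mem_nil, or_false] at hg
  rcases hg with rfl | rfl | rfl <;> trivial

/-- The three gates for one position form a controlled swap: `x += u`, then `u += bx`, then `x +=
u`, which exchanges `x` and `u` for `b = 1` and restores both for `b = 0`. -/
theorem runList_swapGates (hr : r ≤ q) {l : List (Fin r)} (hl : l.Nodup)
    (x : Bits q) (u : Bits r) (b : Bool) :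
    runList (swapGates hr l) (swapBits x u b) =
      swapBits (fun a => if h : a.val < r then if b = true ∧ ⟨a, h⟩ ∈ l then u ⟨a, h⟩ else x a else x a)
        (fun i => if b = true ∧ i ∈ l then x (i.castLE hr) else u i) b := by
  induction l generalizing x u with
  | nil => simp [swapGates]
  | cons i l ih =>
      rw [List.nodup_cons] at hl
      have h1 : runList (swapGates hr [i]) (swapBits x u b) =
          swapBits (if b then Function.update x (i.castLE hr) (u i) else x)
            (if b then Function.update u i (x (i.castLE hr)) else u) b := by
        have hw : ∀ (x : Bits q) (u : Bits r),
            (WGate.cnot (.inr (.inl i)) (.inl (i.castLE hr))).run (swapBits x u b) =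
            swapBits (Function.update x (i.castLE hr) ((x (i.castLE hr)).xor (u i))) u b := by
          intro x u
          rw [WGate.run, if_pos (by simp)]
          simp only [swapBits]
          rw [Sum.update_elim_inl]
          rfl
        have hf : ∀ (x : Bits q) (u : Bits r),
            (WGate.toffoli (.inr (.inr ())) (.inl (i.castLE hr)) (.inr (.inl i))).run
              (swapBits x u b) =
            swapBits x (Function.update u i ((u i).xor (b && x (i.castLE hr)))) b := by
          intro x u
          rw [WGate.run, if_pos (by simp)]
          simp only [swapBits]
          rw [Sum.update_elim_inr, Sum.update_elim_inl]
          rfl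
        have e : swapGates hr [i] = [.cnot (.inr (.inl i)) (.inl (i.castLE hr)),
          .toffoli (.inr (.inr ())) (.inl (i.castLE hr)) (.inr (.inl i)),
          .cnot (.inr (.inl i)) (.inl (i.castLE hr))] := by
          simp only [swapGates, List.flatMap_cons, List.flatMap_nil, List.append_nil]
        rw [e, runList_cons, runList_cons, runList_cons, runList_nil, hw, hf, hw]
        simp only [Function.update_self, Function.update_idem]
        cases b
        · simp
        · cases hx : x (i.castLE hr) <;> cases hu : u i <;> simp
      have happ : swapGates hr (i :: l) = swapGates hr [i] ++ swapGates hr l := by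
        simp [swapGates]
      rw [happ, runList_append, h1, ih hl.2]
      cases b
      · simp
      · congr 1
        · funext a
          by_cases h : a.val < r
          · by_cases ha : (⟨a, h⟩ : Fin r) = i
            · subst ha
              simp [hl.1, h]
            · have ha' : a ≠ i.castLE hr := by
                rintro rfl
                exact ha (Fin.ext rfl)
              simp [h, ha, ha']
          · have ha' : a ≠ i.castLE hr := by
              rintro rfl
              exact h i.2
            simp [h, ha']
        · funext j
          by_cases hj : j = i
          · subst hj
            simp [hl.1]
          · have : j.castLE hr ≠ i.castLE hr := fun e => hj (Fin.castLE_injective hr e)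
            simp [hj, this]

/-- The gates of the swap test, without the first Hadamard gate on the control wire. -/
def swapTest (hr : r ≤ q) : List (WGate (SwapWires q r)) :=
  swapGates hr (List.finRange r) ++ [.had (.inr (.inr ()))]

theorem runList_swapGates_finRange (hr : r ≤ q) (y : Bits r) (z : Bits (q - r)) (u : Bits r)
    (b : Bool) :
    runList (swapGates hr (List.finRange r)) (swapBits (y.join z) u b) =
      if b then swapBits (u.join z) y b else swapBits (y.join z) u b := by
  rw [runList_swapGates hr (List.nodup_finRange r)]
  cases b
  · simp
  · simp only [true_and, List.mem_finRange, if_true]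
    congr 1
    · funext a
      simp only [Bits.join]
      split_ifs <;> rfl
    · funext i
      exact Bits.join_of_lt y z _ i.2

/-- The product of vectors of the two registers and of `(|0⟩ + g|1⟩)/√2` on the control wire. -/
noncomputable def swapState (w : Bits q → ℂ) (f : Bits r → ℂ) (g : ℂ) : Amp (SwapWires q r) :=
  fun x => w (x ∘ Sum.inl) * f (fun i => x (.inr (.inl i))) *
    ((if x (.inr (.inr ())) then g else 1) / (Real.sqrt 2 : ℂ))

/-- The branch with control 0 is unswapped and the branch with control 1 is swapped and carries `g`;
the Hadamard gate subtracts them on control value 1. The first Hadamard gate of the usual test is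
already contained in `swapState`. -/
theorem swapTest_apply (hr : r ≤ q) (w : Bits q → ℂ) (f : Bits r → ℂ) (g : ℂ) (y : Bits r)
    (z : Bits (q - r)) (u : Bits r) :
    appList (swapTest hr) (swapState w f g) (swapBits (y.join z) u true) =
      (w (y.join z) * f u - g * (w (u.join z) * f y)) / 2 := by
  have h1 : ∀ b : Bool, appList (swapGates hr (List.finRange r)) (swapState w f g)
      (swapBits (y.join z) u b) =
        if b then swapState w f g (swapBits (u.join z) y b)
          else swapState w f g (swapBits (y.join z) u b) := by
    intro b
    cases b
    · have := appList_runList (classical_swapGates hr (List.finRange r)) (swapState w f g)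
        (swapBits (y.join z) u false)
      rw [runList_swapGates_finRange] at this
      simpa using this
    · have := appList_runList (classical_swapGates hr (List.finRange r)) (swapState w f g)
        (swapBits (u.join z) y true)
      rw [runList_swapGates_finRange] at this
      simpa using this
  have hupd : ∀ b : Bool, Function.update (swapBits (y.join z) u true)
      (Sum.inr (Sum.inr ()) : SwapWires q r) b =
      swapBits (y.join z) u b := by
    intro b
    funext k
    rcases k with a | j | ⟨⟩ <;> simp [swapBits]
  have hs : (Real.sqrt 2 : ℂ) * (Real.sqrt 2 : ℂ) = 2 := by
    rw [← Complex.ofReal_mul, Real.mul_self_sqrt (by norm_num)]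
    norm_num
  have hs0 : (Real.sqrt 2 : ℂ) ≠ 0 := by
    intro h
    rw [h] at hs
    norm_num at hs
  rw [swapTest, appList_append, appList_cons, appList_nil]
  change ∑ b : Bool, hadMat true b * appList (swapGates hr (List.finRange r)) (swapState w f g)
    (Function.update (swapBits (y.join z) u true) (Sum.inr (Sum.inr ())) b) = _
  simp only [hupd, h1, Fintype.sum_bool]
  simp only [hadMat, swapState, swapBits, if_true, Bool.and_true, Bool.and_false, Sum.elim_inr,
    Sum.elim_inl, Sum.elim_comp_inl, Bool.false_eq_true, if_false]
  field_simp
  rw [pow_two, hs]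
  ring

/-- In the squared norm of the difference the two pure terms give half of the total weight, and the
cross term gives the overlap with `f`. The phase `g = ±1` decides in which direction the overlap
shifts the probability from one half, which is how the sign bit of a run enters. -/
theorem sum_swapTest (hr : r ≤ q) (w : Bits q → ℂ) (f : Bits r → ℂ) (hf : ∑ u, ‖f u‖ ^ 2 = 1)
    (g : ℝ) (hg : g ^ 2 = 1) :
    ∑ x, (if x (.inr (.inr ())) then ‖appList (swapTest hr) (swapState w f g) x‖ ^ 2 else 0) =
      1 / 2 * ∑ x, ‖w x‖ ^ 2 - g / 2 * firstOverlap f w := by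
  have hexp : ∀ (y : Bits r) (z : Bits (q - r)) (u : Bits r),
      ‖(w (y.join z) * f u - g * (w (u.join z) * f y)) / 2‖ ^ 2 =
        1 / 4 * (‖w (y.join z)‖ ^ 2 * ‖f u‖ ^ 2) + 1 / 4 * (‖w (u.join z)‖ ^ 2 * ‖f y‖ ^ 2) -
          g / 2 * ((star (f y) * w (y.join z)) * star (star (f u) * w (u.join z))).re := by
    intro y z u
    simp only [Complex.sq_norm, map_div₀, ← Complex.normSq_mul]
    rw [Complex.normSq_sub, Complex.normSq_mul (g : ℂ), Complex.normSq_ofReal, ← pow_two, hg]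
    have : (w (y.join z) * f u * (starRingEnd ℂ) (g * (w (u.join z) * f y))).re =
        g * ((star (f y) * w (y.join z)) * star (star (f u) * w (u.join z))).re := by
      rw [← Complex.re_ofReal_mul]
      congr 1
      simp only [map_mul, Complex.conj_ofReal, star_mul', RCLike.star_def,
        Complex.conj_conj]
      ring
    rw [this]
    norm_num
    ring
  have hov : ∀ z : Bits (q - r), ∑ y : Bits r, ∑ u : Bits r,
      ((star (f y) * w (y.join z)) * star (star (f u) * w (u.join z))).re =
        ‖∑ y : Bits r, star (f y) * w (y.join z)‖ ^ 2 := by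
    intro z
    have := Complex.mul_conj' (∑ y : Bits r, star (f y) * w (y.join z))
    rw [← Complex.star_def, star_sum, Finset.sum_mul_sum] at this
    have h2 := congrArg Complex.re this
    simp only [Complex.re_sum] at h2
    rw [h2]
    exact_mod_cast Complex.ofReal_re _
  rw [sum_swapBits, sum_join hr]
  simp only [Fintype.sum_bool]
  simp only [swapTest_apply]
  have hc : ∀ (x : Bits q) (u : Bits r) (b : Bool), swapBits x u b (.inr (.inr ())) = b :=
    fun _ _ _ => rfl
  simp only [hc, if_true, Bool.false_eq_true, if_false, add_zero, hexp]
  rw [sum_join hr fun x => ‖w x‖ ^ 2, firstOverlap]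
  simp only [← hov]
  simp only [Finset.sum_sub_distrib, Finset.sum_add_distrib, ← Finset.mul_sum, ← Finset.sum_mul, hf,
    mul_one]
  rw [Finset.sum_comm (f := fun (z : Bits (q - r)) (u : Bits r) => ‖w (u.join z)‖ ^ 2)]
  have e2 : ∑ y : Bits r, ∑ z : Bits (q - r), ∑ u : Bits r,
      ((star (f y) * w (y.join z)) * star (star (f u) * w (u.join z))).re =
        ∑ z : Bits (q - r), ∑ y : Bits r, ∑ u : Bits r,
      ((star (f y) * w (y.join z)) * star (star (f u) * w (u.join z))).re := Finset.sum_comm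
  rw [e2]
  ring

end SwapTest

end QPK

namespace QPK

open Equiv

/-! ### Relabelling a relation by a classical program -/

section Relabel

variable {κ : Type} [DecidableEq κ] {N : ℕ}

/-- The value of a wire that may be missing. -/
def optionBit (x : κ → Bool) : Option κ → Bool
  | none => false
  | some k => x k

/-- Adds to the wires `tgt` the relation on the wires `src`, relabelled by the permutation whose
matrix is on the wires `P`; `t` is an auxiliary wire. -/
noncomputable def relabelGates (t : κ) (P : Fin N → Fin N → κ) (src : Fin N → Fin N → Option κ)
    (tgt : Fin N → Fin N → κ) : List (WGate κ) :=
  (Finset.univ : Finset ((Fin N × Fin N) × (Fin N × Fin N))).toList.flatMap fun a =>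
    if a.1.1 ≠ a.1.2 then
      match src a.2.1 a.2.2 with
      | none => []
      | some k => cccnot t (P a.2.1 a.1.1) (P a.2.2 a.1.2) k (tgt a.1.1 a.1.2)
    else []

omit [DecidableEq κ] in
theorem length_relabelGates_le (t : κ) (P : Fin N → Fin N → κ) (src : Fin N → Fin N → Option κ)
    (tgt : Fin N → Fin N → κ) : (relabelGates t P src tgt).length ≤ N ^ 4 * 3 := by
  rw [relabelGates, List.length_flatMap]
  refine (List.sum_le_card_nsmul _ 3 ?_).trans ?_
  · intro a ha
    obtain ⟨b, -, rfl⟩ := List.mem_map.1 ha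
    split_ifs
    · split <;> simp [cccnot]
    · simp
  · simp only [List.length_map, Finset.length_toList, Finset.card_univ, Fintype.card_prod,
      Fintype.card_fin, smul_eq_mul]
    exact le_of_eq (by ring)

variable {t : κ} {P : Fin N → Fin N → κ} {src : Fin N → Fin N → Option κ} {tgt : Fin N → Fin N → κ}

/-- The conditions on the wires of a relabelling. -/
structure RelabelWires (t : κ) (P : Fin N → Fin N → κ) (src : Fin N → Fin N → Option κ)
    (tgt : Fin N → Fin N → κ) : Prop where
  inj : Function.Injective2 P
  aux_ne : ∀ u v, t ≠ tgt u v
  ne_aux : ∀ u v, P u v ≠ t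
  ne_tgt : ∀ u v u' v', P u v ≠ tgt u' v'
  src_ne : ∀ u v k, src u v = some k → k ≠ t ∧ ∀ u' v', k ≠ tgt u' v'
  inj_tgt : Function.Injective2 tgt
  diag : ∀ u, src u u = none

theorem adds_relabelGates (h : RelabelWires t P src tgt) :
    Adds {w | ∃ u v, w = tgt u v} (relabelGates t P src tgt) fun x w =>
      xorList (Finset.univ : Finset ((Fin N × Fin N) × (Fin N × Fin N))).toList fun a =>
        if a.1.1 ≠ a.1.2 ∧ w = tgt a.1.1 a.1.2 then
          match src a.2.1 a.2.2 with
          | none => false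
          | some k => ((x t).xor (x (P a.2.1 a.1.1) && x (P a.2.2 a.1.2))) && x k
        else false := by
  obtain ⟨hP, ht, hPt, hPT, hst, -, -⟩ := h
  refine Adds.flatMap _ fun a _ => ?_
  by_cases ha : a.1.1 ≠ a.1.2
  · simp only [ha, ne_eq, not_false_eq_true, if_true, true_and]
    cases hk : src a.2.1 a.2.2 with
    | none => simpa using Adds.nil _
    | some k =>
        obtain ⟨hkt, hkT⟩ := hst _ _ _ hk
        refine Adds.cccnot ?_ ?_ ?_ ?_ ⟨_, _, rfl⟩ ?_ (hPt _ _) (hPt _ _) hkt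
        · rintro ⟨u, v, h⟩; exact ht u v h
        · rintro ⟨u, v, h⟩; exact hPT _ _ u v h
        · rintro ⟨u, v, h⟩; exact hPT _ _ u v h
        · rintro ⟨u, v, h⟩; exact hkT u v h
        · intro h; exact ha (hP h).2
  · simp only [ha, if_false, false_and]
    exact Adds.nil _

/-- Among all `(u', v')` that could contribute to the target `(u, v)`, only the one with `ρ u' = u`
and `ρ v' = v` has both controls true. Targets on the diagonal get no gates, since the two matrix
controls might then coincide; this loses nothing because `src` is empty on the diagonal. -/
theorem runList_relabelGates (h : RelabelWires t P src tgt)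
    {x : κ → Bool} (hx : x t = false) (ρ : Perm (Fin N))
    (hρ : ∀ u v, x (P u v) = decide (ρ u = v)) (u v : Fin N) :
    runList (relabelGates t P src tgt) x (tgt u v) =
      (x (tgt u v)).xor (optionBit x (src (ρ⁻¹ u) (ρ⁻¹ v))) := by
  rw [(adds_relabelGates h).run]
  congr 1
  by_cases huv : u = v
  · subst huv
    rw [h.diag, xorList_eq_false]
    · rfl
    · rintro a -
      rw [if_neg]
      rintro ⟨h1, h2⟩
      obtain ⟨e1, e2⟩ := h.inj_tgt h2
      exact h1 (e1.symm.trans e2)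
  · rw [xorList_eq_single (Finset.nodup_toList _)
      (a := ((u, v), (ρ⁻¹ u, ρ⁻¹ v))) (Finset.mem_toList.2 (Finset.mem_univ _))]
    · rw [if_pos ⟨huv, rfl⟩]
      cases src (ρ⁻¹ u) (ρ⁻¹ v) with
      | none => rfl
      | some k => simp [hx, hρ, optionBit]
    · rintro ⟨⟨u1, v1⟩, ⟨u2, v2⟩⟩ - hne
      split_ifs with hc
      · obtain ⟨h1, h2⟩ := hc
        obtain ⟨e1, e2⟩ := h.inj_tgt h2
        simp only at e1 e2
        subst e1 e2
        cases src u2 v2 with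
        | none => rfl
        | some k =>
            have : ¬ (ρ u2 = u ∧ ρ v2 = v) := by
              rintro ⟨rfl, rfl⟩
              exact hne (by simp)
            simp only [hx, hρ, Bool.false_xor]
            by_cases h3 : ρ u2 = u
            · have h4 : ρ v2 ≠ v := fun h4 => this ⟨h3, h4⟩
              simp [h4]
            · simp [h3]
      · rfl

theorem runList_relabelGates_of_ne (h : RelabelWires t P src tgt) {w : κ} (hw : ¬ ∃ u v, w = tgt u v)
    (x : κ → Bool) : runList (relabelGates t P src tgt) x w = x w := by
  rw [(adds_relabelGates h).run, (adds_relabelGates h).supp _ _ hw, Bool.xor_false]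

end Relabel

/-! ### The wires of a run -/

section Run

/-- The wires of a run beside those of the adversary and of the swap test: a permutation matrix
`τ`, a sign bit, the relabelled graph, `K` further relabelled graphs, `K` relabelled colourings, and
an auxiliary wire. -/
abbrev StructWires (N K : ℕ) (Clr : Type) : Type :=
  (Fin N × Fin N) ⊕ (Unit ⊕ ((Fin N × Fin N) ⊕ ((Fin K × Fin N × Fin N) ⊕
    ((Fin K × Fin N × Fin N × Clr) ⊕ Unit))))

instance (N K : ℕ) (Clr : Type) [DecidableEq Clr] : DecidableEq (StructWires N K Clr) :=
  have : DecidableEq ((Fin K × Fin N × Fin N) ⊕ ((Fin K × Fin N × Fin N × Clr) ⊕ Unit)) :=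
    instDecidableEqSum
  have : DecidableEq ((Fin N × Fin N) ⊕ ((Fin K × Fin N × Fin N) ⊕
    ((Fin K × Fin N × Fin N × Clr) ⊕ Unit))) := instDecidableEqSum
  instDecidableEqSum

/-- All wires of a run. -/
abbrev RunWires (q r N K : ℕ) (Clr : Type) : Type := SwapWires q r ⊕ StructWires N K Clr

instance (q r N K : ℕ) (Clr : Type) [DecidableEq Clr] : DecidableEq (RunWires q r N K Clr) :=
  instDecidableEqSum

variable {N K m q r : ℕ} {Clr : Type}

/-- A branch of the superposition: a permutation `τ`, a sign bit and `K` permutations. -/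
abbrev Branch (N K : ℕ) : Type := Perm (Fin N) × Bool × (Fin K → Perm (Fin N))

/-- The values of the structure wires in a branch. -/
def structBits (A : Fin N → Fin N → Bool) (B : Fin K → Fin N → Fin N → Bool)
    (X : Fin N → Fin N → Clr → Bool) (ℓ : Branch N K) : StructWires N K Clr → Bool :=
  Sum.elim (fun p => decide (ℓ.1 p.1 = p.2)) <| Sum.elim (fun _ => ℓ.2.1) <|
  Sum.elim (fun p => A (ℓ.1⁻¹ p.1) (ℓ.1⁻¹ p.2)) <|
  Sum.elim (fun p => B p.1 (ℓ.1⁻¹ ((ℓ.2.2 p.1)⁻¹ p.2.1)) (ℓ.1⁻¹ ((ℓ.2.2 p.1)⁻¹ p.2.2))) <|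
  Sum.elim (fun p => X (ℓ.1⁻¹ ((ℓ.2.2 p.1)⁻¹ p.2.1)) (ℓ.1⁻¹ ((ℓ.2.2 p.1)⁻¹ p.2.2.1)) p.2.2.2)
    fun _ => false

/-- The relabelling of a structure, consisting of a relation and a family of relations, by a
permutation. -/
def relabel (A : Fin N → Fin N → Bool) (X : Fin N → Fin N → Clr → Bool) (ρ : Perm (Fin N)) :
    Fin N → Fin N → Bool × (Clr → Bool) := fun a b => (A (ρ⁻¹ a) (ρ⁻¹ b), X (ρ⁻¹ a) (ρ⁻¹ b))

theorem structBits_left {A A' : Fin N → Fin N → Bool} {B B' : Fin K → Fin N → Fin N → Bool}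
    {X X' : Fin N → Fin N → Clr → Bool} {ℓ ℓ' : Branch N K}
    (h : structBits A B X ℓ = structBits A' B' X' ℓ') : ℓ.1 = ℓ'.1 ∧ ℓ.2.1 = ℓ'.2.1 := by
  constructor
  · ext1 i
    have := congrFun h (Sum.inl (i, ℓ.1 i))
    simp only [structBits, Sum.elim_inl, decide_true] at this
    exact (of_decide_eq_true this.symm).symm
  · exact congrFun h (Sum.inr (Sum.inl ()))

/-- For fixed `τ` and sign, the tuple `σ` enters the structure wires only through the structures
relabelled by `σ l * τ`. What these wires do not reveal about `σ` stays in coherent superposition.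
-/
theorem structBits_eq_iff {A : Fin N → Fin N → Bool} {X : Fin N → Fin N → Clr → Bool}
    {τ : Perm (Fin N)} {s : Bool} {σ σ' : Fin K → Perm (Fin N)} :
    structBits A (fun _ => A) X (τ, s, σ) = structBits A (fun _ => A) X (τ, s, σ') ↔
      ∀ l, relabel A X (σ l * τ) = relabel A X (σ' l * τ) := by
  constructor
  · intro h l
    funext a b
    refine Prod.ext ?_ ?_
    · exact congrFun h (Sum.inr (Sum.inr (Sum.inr (Sum.inl (l, a, b)))))
    · funext c
      exact congrFun h (Sum.inr (Sum.inr (Sum.inr (Sum.inr (Sum.inl (l, a, b, c))))))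
  · intro h
    funext w
    rcases w with w | w | w | ⟨l, a, b⟩ | ⟨l, a, b, c⟩ | w
    · rfl
    · rfl
    · rfl
    · exact congrArg Prod.fst (congrFun (congrFun (h l) a) b)
    · exact congrFun (congrArg Prod.snd (congrFun (congrFun (h l) a) b)) c
    · rfl

variable [DecidableEq Clr] (pos : Fin K → Fin N → Fin N → Fin q)
  (cell : Fin N → Fin N → Option (Fin m × Fin m))

/-- Wires of a run behind those of the graph. -/
abbrev structWire (q r m : ℕ) {N K : ℕ} {Clr : Type} (w : StructWires N K Clr) :
    (Fin m × Fin m) ⊕ RunWires q r N K Clr := Sum.inr (Sum.inr w)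

/-- The gates that relabel the graph by `τ` and add the result to the graph wires. -/
noncomputable def baseGates : List (WGate ((Fin m × Fin m) ⊕ RunWires q r N K Clr)) :=
  relabelGates (structWire q r m (.inr (.inr (.inr (.inr (.inr ()))))))
    (fun u v => structWire q r m (.inl (u, v)))
    (fun u v => (cell u v).map Sum.inl)
    (fun u v => structWire q r m (.inr (.inr (.inl (u, v)))))

/-- The gates that relabel the relabelled graph by the permutation in copy `l`. -/
noncomputable def copyGates (l : Fin K) : List (WGate ((Fin m × Fin m) ⊕ RunWires q r N K Clr)) :=
  relabelGates (structWire q r m (.inr (.inr (.inr (.inr (.inr ()))))))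
    (fun u v => Sum.inr (Sum.inl (Sum.inl (pos l u v))))
    (fun u v => if u = v then none else some (structWire q r m (.inr (.inr (.inl (u, v))))))
    (fun u v => structWire q r m (.inr (.inr (.inr (.inl (l, u, v))))))

/-- The gates that compute the relabelled graphs. -/
noncomputable def structGates : List (WGate ((Fin m × Fin m) ⊕ RunWires q r N K Clr)) :=
  baseGates cell ++ (List.finRange K).flatMap (copyGates pos)

/-- The relation that a cell assignment makes of the adjacency matrix of the graph. -/
def cellRel (s : Fin m × Fin m → Bool) : Fin N → Fin N → Bool := fun u v => optionBit s (cell u v)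

omit [DecidableEq Clr] in
theorem length_structGates_le :
    (structGates (r := r) (Clr := Clr) pos cell).length ≤ (K + 1) * (N ^ 4 * 3) := by
  rw [structGates, List.length_append, List.length_flatMap]
  have h : (((List.finRange K).map
      fun l => (copyGates (r := r) (m := m) (Clr := Clr) pos l).length).sum) ≤ K * (N ^ 4 * 3) := by
    refine (List.sum_le_card_nsmul _ (N ^ 4 * 3) ?_).trans ?_
    · intro a ha
      obtain ⟨b, -, rfl⟩ := List.mem_map.1 ha
      exact length_relabelGates_le _ _ _ _
    · simp
  refine (Nat.add_le_add (length_relabelGates_le _ _ _ _) h).trans (le_of_eq (by ring))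

/-- Structure wires that the gates change. -/
def structTargets (q r m N K : ℕ) (Clr : Type) : Set ((Fin m × Fin m) ⊕ RunWires q r N K Clr) :=
  {w | (∃ u v, w = structWire q r m (.inr (.inr (.inl (u, v))))) ∨
    ∃ l u v, w = structWire q r m (.inr (.inr (.inr (.inl (l, u, v)))))}

omit [DecidableEq Clr] in
theorem relabelWires_base (hcell : ∀ u, cell u u = none) :
    RelabelWires (structWire (N := N) (K := K) (Clr := Clr) q r m (.inr (.inr (.inr (.inr (.inr ()))))))
    (fun u v => structWire q r m (.inl (u, v)))
    (fun u v => (cell u v).map Sum.inl)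
    (fun u v => structWire q r m (.inr (.inr (.inl (u, v))))) where
  inj := by rintro a b c d h; simpa using h
  aux_ne := by simp
  ne_aux := by simp
  ne_tgt := by simp
  src_ne := by
    intro u v k hk
    obtain ⟨p, -, rfl⟩ := Option.map_eq_some_iff.1 hk
    simp
  inj_tgt := by rintro a b c d h; simpa using h
  diag := by simp [hcell]

omit [DecidableEq Clr] in
theorem relabelWires_copy (hpos : ∀ l, Function.Injective2 (pos l)) (l : Fin K) :
    RelabelWires (structWire (N := N) (K := K) (Clr := Clr) q r m (.inr (.inr (.inr (.inr (.inr ()))))))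
    (fun u v => Sum.inr (Sum.inl (Sum.inl (pos l u v))))
    (fun u v => if u = v then none else some (structWire q r m (.inr (.inr (.inl (u, v))))))
    (fun u v => structWire q r m (.inr (.inr (.inr (.inl (l, u, v)))))) where
  inj := by rintro a b c d h; exact hpos l (by simpa using h)
  aux_ne := by simp
  ne_aux := by simp
  ne_tgt := by simp
  src_ne := by
    intro u v k hk
    split_ifs at hk
    obtain rfl := Option.some.inj hk
    simp
  inj_tgt := by rintro a b c d h; simpa using h
  diag := by simp

variable (hcell : ∀ u, cell u u = none) (hpos : ∀ l, Function.Injective2 (pos l))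
include hcell hpos

theorem classical_structGates :
    ∀ g ∈ structGates (r := r) (Clr := Clr) pos cell, g.Classical := by
  intro g hg
  rcases List.mem_append.1 hg with hg | hg
  · exact (adds_relabelGates (relabelWires_base cell hcell)).classical g hg
  · obtain ⟨l, -, hg⟩ := List.mem_flatMap.1 hg
    exact (adds_relabelGates (relabelWires_copy pos hpos l)).classical g hg

theorem runList_structGates_of_notMem (x : (Fin m × Fin m) ⊕ RunWires q r N K Clr → Bool) {w} (hw : w ∉ structTargets q r m N K Clr) :
    runList (structGates pos cell) x w = x w := by
  have h : ∀ (L : List (Fin K)) x, runList (L.flatMap (copyGates pos)) x w = x w := by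
    intro L
    induction L with
    | nil => intro x; rfl
    | cons l L ih =>
        intro x
        rw [List.flatMap_cons, runList_append, ih]
        refine runList_relabelGates_of_ne (relabelWires_copy pos hpos l) ?_ x
        rintro ⟨u, v, rfl⟩
        exact hw (Or.inr ⟨l, u, v, rfl⟩)
  rw [structGates, runList_append, h]
  refine runList_relabelGates_of_ne (relabelWires_base cell hcell) ?_ x
  rintro ⟨u, v, rfl⟩
  exact hw (Or.inl ⟨u, v, rfl⟩)

/-- The graph is relabelled once by `τ`, and the result once more for each copy by the matrix of `σ
l` on the wires of the adversary. The coloured part does not depend on the graph and is already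
relabelled in the advice, so no gates touch it. -/
theorem runList_structGates (s : Fin m × Fin m → Bool) (y : SwapWires q r → Bool) (X : Fin N → Fin N → Clr → Bool)
    (ℓ : Branch N K) (hy : ∀ l u v, y (Sum.inl (pos l u v)) = decide (ℓ.2.2 l u = v)) :
    runList (structGates pos cell)
        (Sum.elim s (Sum.elim y (structBits (fun _ _ => false) (fun _ _ _ => false) X ℓ))) =
      Sum.elim s (Sum.elim y (structBits (cellRel cell s) (fun _ => cellRel cell s) X ℓ)) := by
  set A := cellRel cell s with hA
  have hbase : runList (baseGates cell)
      (Sum.elim s (Sum.elim y (structBits (fun _ _ => false) (fun _ _ _ => false) X ℓ))) =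
      Sum.elim s (Sum.elim y (structBits A (fun _ _ _ => false) X ℓ)) := by
    have hout : ∀ w, (¬ ∃ u v, w = structWire q r m (.inr (.inr (.inl (u, v))))) → ∀ x,
        runList (baseGates (Clr := Clr) (K := K) cell) x w = x w := fun w hw x =>
      runList_relabelGates_of_ne (relabelWires_base cell hcell) hw x
    funext w
    rcases w with w | w | w | w | ⟨u, v⟩ | w | w | w
    · exact hout _ (by simp) _
    · exact hout _ (by simp) _
    · exact hout _ (by simp) _
    · exact hout _ (by simp) _
    · refine (runList_relabelGates (relabelWires_base cell hcell) (by rfl) ℓ.1 (fun u v => rfl)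
        u v).trans ?_
      simp only [structBits, Sum.elim_inr, Sum.elim_inl, Bool.false_xor, hA, cellRel]
      cases cell (ℓ.1⁻¹ u) (ℓ.1⁻¹ v) <;> rfl
    · exact hout _ (by simp) _
    · exact hout _ (by simp) _
    · exact hout _ (by simp) _
  -- The intermediate states have `A` in the copies already treated and zeros in the others, hence
  -- the free `B`.
  have hcopy : ∀ (B : Fin K → Fin N → Fin N → Bool) (l : Fin K), B l = (fun _ _ => false) →
      runList (copyGates pos l) (Sum.elim s (Sum.elim y (structBits A B X ℓ))) =
        Sum.elim s (Sum.elim y (structBits A (Function.update B l A) X ℓ)) := by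
    intro B l hB
    have hout : ∀ w, (¬ ∃ u v, w = structWire q r m (.inr (.inr (.inr (.inl (l, u, v)))))) → ∀ x,
        runList (copyGates (Clr := Clr) pos l) x w = x w := fun w hw x =>
      runList_relabelGates_of_ne (relabelWires_copy pos hpos l) hw x
    funext w
    rcases w with w | w | w | w | w | ⟨l', u, v⟩ | w | w
    · exact hout _ (by simp) _
    · exact hout _ (by simp) _
    · exact hout _ (by simp) _
    · exact hout _ (by simp) _
    · exact hout _ (by simp) _
    · by_cases hl : l' = l
      · subst hl
        refine (runList_relabelGates (relabelWires_copy pos hpos l') (by rfl) (ℓ.2.2 l')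
          (fun u v => hy l' u v) u v).trans ?_
        simp only [structBits, Sum.elim_inr, Sum.elim_inl, hB, Bool.false_xor, Function.update_self]
        split_ifs with h
        · rw [h]
          simp [hA, cellRel, hcell, optionBit]
        · rfl
      · refine (hout _ (by simpa using hl) _).trans ?_
        simp only [structBits, Sum.elim_inr, Sum.elim_inl, Function.update_of_ne hl]
    · exact hout _ (by simp) _
    · exact hout _ (by simp) _
  have hall : ∀ (L : List (Fin K)), L.Nodup → ∀ B : Fin K → Fin N → Fin N → Bool,
      (∀ l ∈ L, B l = fun _ _ => false) →
      runList (L.flatMap (copyGates pos)) (Sum.elim s (Sum.elim y (structBits A B X ℓ))) =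
        Sum.elim s (Sum.elim y (structBits A (fun l => if l ∈ L then A else B l) X ℓ)) := by
    intro L
    induction L with
    | nil => intro _ B _; simp
    | cons l L ih =>
        intro hL B hB
        rw [List.nodup_cons] at hL
        rw [List.flatMap_cons, runList_append, hcopy B l (hB l List.mem_cons_self), ih hL.2]
        · congr 3
          funext l'
          by_cases h : l' = l
          · subst h; simp [hL.1]
          · simp [h]
        · intro l' hl'
          rw [Function.update_of_ne, hB l' (List.mem_cons_of_mem _ hl')]
          rintro rfl
          exact hL.1 hl'
  rw [structGates, runList_append, hbase, hall _ (List.nodup_finRange K) _ fun _ _ => rfl]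
  simp

end Run

end QPK

namespace QPK

open Equiv KKNY

/-! ### The superposition of all branches of a run -/

section Norms

theorem sum_append {k b : ℕ} {M : Type*} [AddCommMonoid M] (F : Bits (k + b) → M) :
    ∑ x, F x = ∑ y : Bits k, ∑ z : Bits b, F (Fin.append y z) := by
  rw [← (Fin.appendEquiv k b).sum_comp, Fintype.sum_prod_type]
  rfl

theorem sum_norm_sq_padAncillas {q : ℕ} (anc : ℕ) (ψ : Bits q → ℂ) :
    ∑ x, ‖padAncillas anc ψ x‖ ^ 2 = ∑ x, ‖ψ x‖ ^ 2 := by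
  rw [sum_append]
  refine Finset.sum_congr rfl fun y _ => ?_
  rw [Finset.sum_eq_single fun _ => false]
  · simp [padAncillas]
  · intro z _ hz
    rw [padAncillas, if_neg]
    · simp
    · intro h
      exact hz (funext fun i => by simpa using h i)
  · simp

theorem sum_norm_sq_swapState {q r : ℕ} (w : Bits q → ℂ) {f : Bits r → ℂ}
    (hf : ∑ u, ‖f u‖ ^ 2 = 1) {g : ℂ} (hg : ‖g‖ = 1) :
    ∑ x, ‖swapState w f g x‖ ^ 2 = ∑ x, ‖w x‖ ^ 2 := by
  have h : ∀ (x : Bits q) (u : Bits r) (b : Bool),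
      ‖swapState w f g (swapBits x u b)‖ ^ 2 = 1 / 2 * (‖w x‖ ^ 2 * ‖f u‖ ^ 2) := by
    intro x u b
    have : ‖(Real.sqrt 2 : ℂ)‖ ^ 2 = 2 := by
      rw [Complex.norm_real, Real.norm_eq_abs, sq_abs, Real.sq_sqrt (by norm_num)]
    have h1 : ‖(if b then g else 1 : ℂ)‖ = 1 := by cases b <;> simp [hg]
    change ‖w x * f u * ((if b then g else 1) / (Real.sqrt 2 : ℂ))‖ ^ 2 = _
    rw [norm_mul, norm_mul, norm_div, h1, mul_pow, mul_pow, div_pow, this]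
    ring
  rw [sum_swapBits]
  simp only [h, Fintype.sum_bool, ← two_mul]
  simp only [← mul_assoc, mul_one_div_cancel (two_ne_zero' ℝ), one_mul]
  simp only [← Finset.mul_sum, hf, mul_one]

end Norms

section Branches

variable {N k b : ℕ} {Ξ : Type} [DecidableEq Ξ]

/-- The part of a label of `K` registers and a further register that belongs to register `l`. -/
def copyPart {K n b : ℕ} (y : Bits (K * n + b)) (l : Fin K) : Bits n :=
  fun t => y (Fin.castAdd b (finProdFinEquiv (l, t)))

/-- The basis state of a tuple of permutations, followed by the vector `v`. -/
def permInput {K : ℕ} (σ : Fin K → Perm (Fin N)) (v : Bits b → ℂ) : Bits (K * (N * N) + b) → ℂ :=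
  fun y => if ∀ l, copyPart y l = bits (σ l) then v fun i => y (Fin.natAdd (K * (N * N)) i) else 0

theorem sum_norm_sq_permInput {K : ℕ} (σ : Fin K → Perm (Fin N)) (v : Bits b → ℂ) :
    ∑ y, ‖permInput σ v y‖ ^ 2 = ∑ z, ‖v z‖ ^ 2 := by
  rw [sum_append, Finset.sum_eq_single fun i : Fin (K * (N * N)) =>
    bits (σ (finProdFinEquiv.symm i).1) (finProdFinEquiv.symm i).2]
  · refine Finset.sum_congr rfl fun z _ => ?_
    rw [permInput, if_pos]
    · simp
    · intro l
      funext t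
      simp only [copyPart, Fin.append_left, Equiv.symm_apply_apply]
  · intro y _ hy
    refine Finset.sum_eq_zero fun z _ => ?_
    rw [permInput, if_neg]
    · simp
    · intro h
      refine hy (funext fun i => ?_)
      have := congrFun (h (finProdFinEquiv.symm i).1) (finProdFinEquiv.symm i).2
      simpa only [copyPart, Fin.append_left, Prod.mk.eta, Equiv.apply_symm_apply] using this
  · simp

/-- The sign of a permutation as a complex number. -/
def signC (σ : Perm (Fin N)) : ℂ := ((Perm.sign σ : ℤˣ) : ℤ)

theorem norm_signC (σ : Perm (Fin N)) : ‖signC σ‖ = 1 := by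
  rcases Int.units_eq_one_or (Perm.sign σ) with h | h <;> simp [signC, h]

theorem star_signC (σ : Perm (Fin N)) : star (signC σ) = signC σ := by
  simp [signC]

/-- The amplitude of a branch. -/
noncomputable def branchAmp (ℓ : Branch N (k + 1)) : ℂ :=
  (Real.sqrt (1 / (2 * N.factorial) * (1 / N.factorial) ^ (k + 1)) : ℂ) *
    if ℓ.2.1 then signC (ℓ.2.2 (Fin.last k)) else 1

theorem norm_sq_branchAmp (ℓ : Branch N (k + 1)) :
    ‖branchAmp ℓ‖ ^ 2 = 1 / (2 * N.factorial) * (1 / N.factorial) ^ (k + 1) := by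
  have : ‖(if ℓ.2.1 then signC (ℓ.2.2 (Fin.last k)) else 1 : ℂ)‖ = 1 := by
    split_ifs
    · exact norm_signC _
    · exact norm_one
  rw [branchAmp, norm_mul, this, mul_one, Complex.norm_real, Real.norm_eq_abs, sq_abs,
    Real.sq_sqrt (by positivity)]

theorem sum_norm_sq_branchAmp : ∑ ℓ : Branch N (k + 1), ‖branchAmp ℓ‖ ^ 2 = 1 := by
  simp only [norm_sq_branchAmp]
  rw [Finset.sum_const, Finset.card_univ]
  have h0 : (N.factorial : ℝ) ≠ 0 := by exact_mod_cast N.factorial_ne_zero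
  simp only [Fintype.card_prod, Fintype.card_pi, Fintype.card_perm, Fintype.card_fin, Fintype.card_bool,
    Finset.prod_const, Finset.card_univ, nsmul_eq_mul]
  push_cast
  field_simp
  rw [one_div, ← mul_pow, mul_inv_cancel₀ h0, one_pow]

/-- The component of the superposition of all branches `ℓ` for which a further register is in the
basis state `e`, if it is in the basis state `E ℓ` in the branch `ℓ`. -/
noncomputable def branchSlice (v : Bits b → ℂ) (E : Branch N (k + 1) → Ξ) (e : Ξ) :
    Bits ((k + 1) * (N * N) + b) → ℂ :=
  fun y => ∑ ℓ, if E ℓ = e then branchAmp ℓ * permInput ℓ.2.2 v y else 0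

/-- The further register determines `τ` and the sign, and the permutation registers determine `σ`.
So branches have disjoint supports and their weights add up. -/
theorem sum_norm_sq_branchSlice [Fintype Ξ] {v : Bits b → ℂ} (hv : ∑ z, ‖v z‖ ^ 2 = 1)
    {E : Branch N (k + 1) → Ξ} (hE : ∀ ℓ ℓ', E ℓ = E ℓ' → ℓ.1 = ℓ'.1 ∧ ℓ.2.1 = ℓ'.2.1) :
    ∑ e, ∑ y, ‖branchSlice v E e y‖ ^ 2 = 1 := by
  have h1 : ∀ e y, ‖branchSlice v E e y‖ ^ 2 =
      ∑ ℓ, if E ℓ = e then ‖branchAmp ℓ‖ ^ 2 * ‖permInput ℓ.2.2 v y‖ ^ 2 else 0 := by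
    intro e y
    rw [branchSlice, norm_sq_sum_of_disjoint]
    · refine Finset.sum_congr rfl fun ℓ _ => ?_
      split_ifs
      · rw [norm_mul, mul_pow]
      · simp
    · intro ℓ ℓ' hne
      by_contra! h
      obtain ⟨h2, h3⟩ := h
      simp only [ne_eq, ite_eq_right_iff, mul_eq_zero, not_forall, not_or] at h2 h3
      obtain ⟨e1, -, p1⟩ := h2
      obtain ⟨e2, -, p2⟩ := h3
      obtain ⟨ht, hs⟩ := hE _ _ (e1.trans e2.symm)
      rw [permInput, ite_eq_right_iff, not_forall] at p1 p2
      obtain ⟨q1, -⟩ := p1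
      obtain ⟨q2, -⟩ := p2
      refine hne (Prod.ext ht (Prod.ext hs (funext fun l => ?_)))
      exact bits_injective ((q1 l).symm.trans (q2 l))
  simp only [h1]
  rw [← sum_norm_sq_branchAmp (N := N) (k := k)]
  have h2 : ∀ e : Ξ, ∑ y, ∑ ℓ : Branch N (k + 1),
      (if E ℓ = e then ‖branchAmp ℓ‖ ^ 2 * ‖permInput ℓ.2.2 v y‖ ^ 2 else 0) =
      ∑ ℓ, if E ℓ = e then ‖branchAmp ℓ‖ ^ 2 else 0 := by
    intro e
    rw [Finset.sum_comm]
    refine Finset.sum_congr rfl fun ℓ _ => ?_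
    split_ifs
    · rw [← Finset.mul_sum, sum_norm_sq_permInput, hv, mul_one]
    · simp
  simp only [h2]
  rw [Finset.sum_comm]
  refine Finset.sum_congr rfl fun ℓ _ => ?_
  simp

open Classical in
/-- The contribution of a pair of permutations to an entry of `orbitMat`. -/
noncomputable def orbitTerm {Clr : Type} (A : Fin N → Fin N → Bool)
    (X : Fin N → Fin N → Clr → Bool) (τ : Perm (Fin N)) (s : Bool) (x y : Bits (N * N))
    (p : Perm (Fin N) × Perm (Fin N)) : ℂ :=
  if relabel A X (p.1 * τ) = relabel A X (p.2 * τ) ∧ x = bits p.1 ∧ y = bits p.2 then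
    (1 / N.factorial : ℂ) * (if s then signC p.1 * signC p.2 else 1) else 0

/-- The averaged state of a permutation register whose permutation is known up to automorphisms of
a relabelled structure. -/
noncomputable def orbitMat {Clr : Type} (A : Fin N → Fin N → Bool) (X : Fin N → Fin N → Clr → Bool)
    (τ : Perm (Fin N)) (s : Bool) : OpMat (N * N) :=
  fun x y => ∑ p, orbitTerm A X τ s x y p

-- A product of sums over pairs of permutations is a sum over pairs of tuples; the sign occurs in
-- the last factor only.
open Classical in
theorem prod_orbitMat {Clr : Type} (A : Fin N → Fin N → Bool) (X : Fin N → Fin N → Clr → Bool)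
    (τ : Perm (Fin N)) (s : Bool) (x y : Bits ((k + 1) * (N * N) + b)) :
    (∏ l, orbitMat A X τ (s && decide (l = Fin.last k)) (copyPart x l) (copyPart y l)) =
      ∑ P : (Fin (k + 1) → Perm (Fin N)) × (Fin (k + 1) → Perm (Fin N)),
        if (∀ l, relabel A X (P.1 l * τ) = relabel A X (P.2 l * τ)) ∧
          (∀ l, copyPart x l = bits (P.1 l)) ∧ (∀ l, copyPart y l = bits (P.2 l)) then
        (1 / N.factorial : ℂ) ^ (k + 1) *
          (if s then signC (P.1 (Fin.last k)) * signC (P.2 (Fin.last k)) else 1) else 0 := by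
  simp only [orbitMat]
  rw [Finset.prod_univ_sum, Fintype.piFinset_univ,
    ← (Equiv.arrowProdEquivProdArrow (Fin (k + 1)) (fun _ => Perm (Fin N))
      (fun _ => Perm (Fin N))).sum_comp]
  refine Finset.sum_congr rfl fun P _ => ?_
  change _ = if (∀ l, relabel A X ((P l).1 * τ) = relabel A X ((P l).2 * τ)) ∧
    (∀ l, copyPart x l = bits (P l).1) ∧ (∀ l, copyPart y l = bits (P l).2) then
      (1 / N.factorial : ℂ) ^ (k + 1) *
        (if s then signC (P (Fin.last k)).1 * signC (P (Fin.last k)).2 else 1) else 0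
  by_cases hall : (∀ l, relabel A X ((P l).1 * τ) = relabel A X ((P l).2 * τ)) ∧
    (∀ l, copyPart x l = bits (P l).1) ∧ (∀ l, copyPart y l = bits (P l).2)
  · have hl : ∀ l, orbitTerm A X τ (s && decide (l = Fin.last k)) (copyPart x l) (copyPart y l) (P l) =
        (1 / N.factorial : ℂ) *
          if s && decide (l = Fin.last k) then signC (P l).1 * signC (P l).2 else 1 :=
      fun l => if_pos ⟨hall.1 l, hall.2.1 l, hall.2.2 l⟩
    rw [if_pos hall]
    simp only [hl]
    rw [Finset.prod_mul_distrib, Finset.prod_const, Finset.card_univ, Fintype.card_fin]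
    congr 1
    cases s <;> simp
  · rw [if_neg hall]
    simp only [← forall_and, not_forall] at hall
    obtain ⟨l, hl⟩ := hall
    exact Finset.prod_eq_zero (Finset.mem_univ l) (if_neg hl)

/-- Tracing out the structure wires. Two branches interfere exactly if these wires agree, i.e. if
`τ`, the sign bit and the relabelled structure of every copy agree. The condition is a conjunction
over the copies, so for fixed `τ` and sign bit the state is a product of the `orbitMat`. The weight
`g` may be pulled out because the sign bit is among the traced wires. -/
theorem sum_branchSlice {Clr : Type} [Fintype Clr] [DecidableEq Clr] (v : Bits b → ℂ)
    (A : Fin N → Fin N → Bool) (X : Fin N → Fin N → Clr → Bool) (g : Bool → ℝ) :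
    ∑ e : StructWires N (k + 1) Clr → Bool, (g (e (.inr (.inl ()))) : ℂ) •
        Matrix.vecMulVec (branchSlice v (structBits A (fun _ => A) X) e)
          (star (branchSlice v (structBits A (fun _ => A) X) e)) =
      ∑ p : Perm (Fin N) × Bool, ((1 / (2 * N.factorial) * g p.2 : ℝ) : ℂ) •
        productInput (fun l : Fin (k + 1) => if l = Fin.last k then orbitMat A X p.1 p.2
          else orbitMat A X p.1 false) v := by
  classical
  set E : Branch N (k + 1) → StructWires N (k + 1) Clr → Bool := structBits A (fun _ => A) X with hE
  ext x y
  simp only [Matrix.sum_apply, Matrix.smul_apply, smul_eq_mul, Matrix.vecMulVec_apply, Pi.star_apply]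
  have hL : ∀ e, (g (e (.inr (.inl ()))) : ℂ) * (branchSlice v E e x * star (branchSlice v E e y)) =
      ∑ ℓ, ∑ ℓ', if E ℓ = e then (if E ℓ = E ℓ' then (g ℓ.2.1 : ℂ) *
        ((branchAmp ℓ * permInput ℓ.2.2 v x) * star (branchAmp ℓ' * permInput ℓ'.2.2 v y)) else 0)
        else 0 := by
    intro e
    rw [branchSlice, branchSlice, star_sum, Finset.sum_mul_sum, Finset.mul_sum]
    refine Finset.sum_congr rfl fun ℓ _ => ?_
    rw [Finset.mul_sum]
    refine Finset.sum_congr rfl fun ℓ' _ => ?_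
    by_cases h : E ℓ = e
    · subst h
      rw [if_pos rfl, if_pos rfl]
      by_cases h' : E ℓ' = E ℓ
      · rw [if_pos h', if_pos h'.symm]
        rfl
      · rw [if_neg h', if_neg (Ne.symm h')]
        simp
    · rw [if_neg h, if_neg h]
      simp
  simp only [hL]
  rw [Finset.sum_comm]
  -- The sum over `e` only fixes `e = E ℓ`, and agreement of the structure wires forces `ℓ'` to have
  -- the same `τ` and sign as `ℓ`.
  have hL2 : ∀ ℓ : Branch N (k + 1), ∑ e, ∑ ℓ', (if E ℓ = e then (if E ℓ = E ℓ' then (g ℓ.2.1 : ℂ) *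
        ((branchAmp ℓ * permInput ℓ.2.2 v x) * star (branchAmp ℓ' * permInput ℓ'.2.2 v y)) else 0)
        else 0) = ∑ σ' : Fin (k + 1) → Perm (Fin N),
      if ∀ l, relabel A X (ℓ.2.2 l * ℓ.1) = relabel A X (σ' l * ℓ.1) then (g ℓ.2.1 : ℂ) *
        ((branchAmp ℓ * permInput ℓ.2.2 v x) *
          star (branchAmp (ℓ.1, ℓ.2.1, σ') * permInput σ' v y)) else 0 := by
    rintro ⟨τ, s, σ⟩
    rw [Finset.sum_comm]
    simp only [Finset.sum_ite_eq, Finset.mem_univ, if_true]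
    rw [Fintype.sum_prod_type, Finset.sum_eq_single τ, Fintype.sum_prod_type,
      Finset.sum_eq_single s]
    · refine Finset.sum_congr rfl fun σ' _ => ?_
      simp only [hE, structBits_eq_iff]
    · intro s' _ hs
      refine Finset.sum_eq_zero fun σ' _ => if_neg fun h => ?_
      exact hs (structBits_left h).2.symm
    · simp
    · intro τ' _ ht
      refine Finset.sum_eq_zero fun σ' _ => if_neg fun h => ?_
      exact ht (structBits_left h).1.symm
    · simp
  simp only [hL2]
  rw [Fintype.sum_prod_type]
  simp only [Fintype.sum_prod_type]
  refine Finset.sum_congr rfl fun τ _ => Finset.sum_congr rfl fun s _ => ?_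
  have hG : ∀ l : Fin (k + 1), (if l = Fin.last k then orbitMat A X τ s else orbitMat A X τ false) =
      orbitMat A X τ (s && decide (l = Fin.last k)) := by
    intro l
    by_cases h : l = Fin.last k <;> simp [h]
  simp only [hG]
  change _ = _ * ((∏ l, orbitMat A X τ (s && decide (l = Fin.last k)) (copyPart x l) (copyPart y l)) * _)
  rw [prod_orbitMat, Finset.sum_mul, Finset.mul_sum, Fintype.sum_prod_type]
  refine Finset.sum_congr rfl fun σ _ => Finset.sum_congr rfl fun σ' _ => ?_
  simp only [permInput]
  by_cases hall : (∀ l, relabel A X (σ l * τ) = relabel A X (σ' l * τ)) ∧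
      (∀ l, copyPart x l = bits (σ l)) ∧ (∀ l, copyPart y l = bits (σ' l))
  · rw [if_pos hall.1, if_pos hall.2.1, if_pos hall.2.2, if_pos hall]
    have hsq : (Real.sqrt (1 / (2 * N.factorial) * (1 / N.factorial) ^ (k + 1)) : ℂ) *
        (Real.sqrt (1 / (2 * N.factorial) * (1 / N.factorial) ^ (k + 1)) : ℂ) =
        1 / (2 * N.factorial) * (1 / N.factorial) ^ (k + 1) := by
      rw [← Complex.ofReal_mul, Real.mul_self_sqrt (by positivity)]
      push_cast
      rfl
    simp only [branchAmp, star_mul', Complex.star_def, Complex.conj_ofReal]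
    have hif : (starRingEnd ℂ) (if s then signC (σ' (Fin.last k)) else 1) =
        if s then signC (σ' (Fin.last k)) else 1 := by
      split_ifs
      · exact star_signC _
      · exact map_one _
    rw [hif]
    have hif2 : (if s then signC (σ (Fin.last k)) * signC (σ' (Fin.last k)) else 1 : ℂ) =
        (if s then signC (σ (Fin.last k)) else 1) * if s then signC (σ' (Fin.last k)) else 1 := by
      split_ifs <;> simp
    rw [hif2]
    push_cast
    generalize (if s then signC (σ (Fin.last k)) else 1 : ℂ) = p1
    generalize (if s then signC (σ' (Fin.last k)) else 1 : ℂ) = p2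
    generalize (starRingEnd ℂ) (v fun i => y (Fin.natAdd ((k + 1) * (N * N)) i)) = p3
    generalize (v fun i => x (Fin.natAdd ((k + 1) * (N * N)) i)) = p4
    linear_combination (g s * p1 * p2 * p3 * p4) * hsq
  · rw [if_neg hall, zero_mul, mul_zero]
    split_ifs with h1 h2 h3
    · exact (hall ⟨h1, h2, h3⟩).elim
    all_goals simp

end Branches

end QPK

namespace QPK

open Equiv KKNY

/-! ### A run of the adversary followed by the swap test -/

section RunTheorem

variable {N k m b : ℕ} {Clr : Type} [Fintype Clr] [DecidableEq Clr]

/-- The wire that holds the entry `(u, v)` of the permutation matrix in copy `l`. -/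
def copyPos (N k b anc : ℕ) (l : Fin (k + 1)) (u v : Fin N) :
    Fin ((k + 1) * (N * N) + b + anc) :=
  Fin.castAdd anc (Fin.castAdd b (finProdFinEquiv (l, finProdFinEquiv (u, v))))

theorem copyPos_injective (N k b anc : ℕ) (l : Fin (k + 1)) :
    Function.Injective2 (copyPos N k b anc l) := by
  intro u u' v v' h
  have := finProdFinEquiv.injective (Fin.castAdd_injective _ _ (Fin.castAdd_injective _ _ h))
  have := finProdFinEquiv.injective (Prod.ext_iff.1 this).2
  exact Prod.ext_iff.1 this

/-- Amplitudes of the wires of a run, where the structure wires are in the state `E ℓ` in the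
branch `ℓ`. -/
noncomputable def runState {r : ℕ} (anc : ℕ) (v : Bits b → ℂ) (f : Bits r → ℂ)
    (E : Branch N (k + 1) → StructWires N (k + 1) Clr → Bool) :
    Amp (RunWires ((k + 1) * (N * N) + b + anc) r N (k + 1) Clr) :=
  fun x => swapState (padAncillas anc (branchSlice v E (x ∘ Sum.inr))) f
    (((if x (.inr (.inr (.inl ()))) then -1 else 1 : ℝ)) : ℂ) (x ∘ Sum.inl)

theorem sum_norm_sq_runState {r : ℕ} (anc : ℕ) {v : Bits b → ℂ} (hv : ∑ z, ‖v z‖ ^ 2 = 1)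
    {f : Bits r → ℂ} (hf : ∑ u, ‖f u‖ ^ 2 = 1)
    {E : Branch N (k + 1) → StructWires N (k + 1) Clr → Bool}
    (hE : ∀ ℓ ℓ', E ℓ = E ℓ' → ℓ.1 = ℓ'.1 ∧ ℓ.2.1 = ℓ'.2.1) :
    ∑ x, ‖runState anc v f E x‖ ^ 2 = 1 := by
  rw [sum_sum_elim, Finset.sum_comm, ← sum_norm_sq_branchSlice hv hE]
  refine Finset.sum_congr rfl fun e _ => ?_
  rw [← sum_norm_sq_padAncillas anc,
    ← sum_norm_sq_swapState _ hf (g := (((if e (.inr (.inl ())) then -1 else 1 : ℝ)) : ℂ))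
      (by split_ifs <;> simp)]
  rfl

variable (C : Circuit)

/-- The gates of a run: relabelling of the graph, the adversary, and the swap test. -/
noncomputable def runGates (k b : ℕ) (Clr : Type) (cell : Fin N → Fin N → Option (Fin m × Fin m)) :
    List (WGate ((Fin m × Fin m) ⊕ RunWires ((k + 1) * (N * N) + b + C.anc)
      (min C.out ((k + 1) * (N * N) + b + C.anc)) N (k + 1) Clr)) :=
  structGates (copyPos N k b C.anc) cell ++
    ((((C.wireGates ((k + 1) * (N * N) + b)).map (WGate.map Sum.inl) ++
      swapTest (Nat.min_le_right _ _)).map (WGate.map Sum.inl)).map (WGate.map Sum.inr))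

omit [Fintype Clr] [DecidableEq Clr] in
theorem length_runGates_le (cell : Fin N → Fin N → Option (Fin m × Fin m)) :
    (runGates C k b Clr cell).length ≤ (k + 2) * (N ^ 4 * 3) +
      (C.gates.length + (3 * ((k + 1) * (N * N) + b + C.anc) + 1)) := by
  rw [runGates, List.length_append]
  refine Nat.add_le_add (length_structGates_le _ _) ?_
  rw [List.length_map, List.length_map, List.length_append, List.length_map, swapTest,
    List.length_append, length_swapGates, List.length_finRange, List.length_singleton]
  have h1 : (C.wireGates ((k + 1) * (N * N) + b)).length ≤ C.gates.length :=
    List.length_filterMap_le _ _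
  have h2 := Nat.min_le_right C.out ((k + 1) * (N * N) + b + C.anc)
  omega

theorem appList_map_inl_swapState {q r : ℕ} (gs : List (WGate (Fin q))) (w : Bits q → ℂ)
    (f : Bits r → ℂ) (g : ℂ) :
    appList (gs.map (WGate.map Sum.inl)) (swapState w f g) = swapState (appList gs w) f g := by
  funext x
  rw [← Sum.elim_comp_inl_inr x, appList_map_inl, Sum.elim_comp_inl_inr]
  set c : ℂ := f (fun i => x (.inr (.inl i))) *
    ((if x (.inr (.inr ())) then g else 1) / (Real.sqrt 2 : ℂ)) with hc
  have h1 : (fun y => swapState w f g (Sum.elim y (x ∘ Sum.inr))) = c • w := by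
    funext y
    change w y * _ * _ = c * w y
    rw [hc, mul_assoc, mul_comm]
    rfl
  have h2 : swapState (appList gs w) f g x = c * appList gs w (x ∘ Sum.inl) := by
    rw [swapState, hc, mul_assoc, mul_comm]
  rw [h1, h2, map_smul]
  rfl

/-- The gates permute labels and change only structure wires, so it suffices to compare slices
branch by branch. Where the permutation registers hold the `σ` of the branch, the gates carry the
blank structure to the computed one, and bijectivity gives the converse; elsewhere both amplitudes
vanish. -/
theorem appList_structGates_runState {r : ℕ} {anc : ℕ} (v : Bits b → ℂ) (f : Bits r → ℂ)
    {cell : Fin N → Fin N → Option (Fin m × Fin m)} (hcell : ∀ u, cell u u = none)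
    (X : Fin N → Fin N → Clr → Bool) (s : Fin m × Fin m → Bool) :
    appList (structGates (copyPos N k b anc) cell)
        (basisTensor s (runState anc v f (structBits (fun _ _ => false) (fun _ _ _ => false) X))) =
      basisTensor s (runState anc v f (structBits (cellRel cell s) (fun _ => cellRel cell s) X)) := by
  have hpos := copyPos_injective N k b anc
  refine appList_eq_of_classical (classical_structGates _ cell hcell hpos) fun x => ?_
  set x' := runList (structGates (copyPos N k b anc) cell) x with hx'
  have hl : x' ∘ Sum.inl = x ∘ Sum.inl := by
    funext w
    exact runList_structGates_of_notMem _ cell hcell hpos x (by simp [structTargets])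
  have hr : x' ∘ Sum.inr ∘ Sum.inl = x ∘ Sum.inr ∘ Sum.inl := by
    funext w
    exact runList_structGates_of_notMem _ cell hcell hpos x (by simp [structTargets])
  have hs : x' (.inr (.inr (.inr (.inl ())))) = x (.inr (.inr (.inr (.inl ())))) :=
    runList_structGates_of_notMem _ cell hcell hpos x (by simp [structTargets])
  have helim : ∀ z : (Fin m × Fin m) ⊕ RunWires ((k + 1) * (N * N) + b + anc) r N (k + 1) Clr → Bool,
      z = Sum.elim (z ∘ Sum.inl) (Sum.elim (z ∘ Sum.inr ∘ Sum.inl) (z ∘ Sum.inr ∘ Sum.inr)) := by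
    intro z
    funext w
    rcases w with w | w | w <;> rfl
  unfold basisTensor
  rw [hl]
  split_ifs with hsx
  swap
  · rfl
  simp only [runState]
  have e1 : (x' ∘ Sum.inr) ∘ Sum.inl = (x ∘ Sum.inr) ∘ Sum.inl := hr
  have e2 : (x' ∘ Sum.inr) (.inr (.inr (.inl ()))) = (x ∘ Sum.inr) (.inr (.inr (.inl ()))) := hs
  rw [e1, e2]
  suffices h : branchSlice v (structBits (cellRel cell s) (fun _ => cellRel cell s) X)
      ((x' ∘ Sum.inr) ∘ Sum.inr) (fun i => x (.inr (.inl (.inl (Fin.castAdd anc i))))) =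
      branchSlice v (structBits (fun _ _ => false) (fun _ _ _ => false) X)
      ((x ∘ Sum.inr) ∘ Sum.inr) (fun i => x (.inr (.inl (.inl (Fin.castAdd anc i))))) by
    simp only [swapState]
    congr 2
    simp only [padAncillas]
    split_ifs
    · exact h
    · rfl
  simp only [branchSlice]
  refine Finset.sum_congr rfl fun ℓ _ => ?_
  by_cases hp : ∀ l, copyPart (fun i => x (.inr (.inl (.inl (Fin.castAdd anc i))))) l =
      bits (ℓ.2.2 l)
  · have hrun := runList_structGates (copyPos N k b anc) cell hcell hpos s (x ∘ Sum.inr ∘ Sum.inl) X ℓ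
      (fun l u v => by
        have := congrFun (hp l) (finProdFinEquiv (u, v))
        simp only [copyPart, bits, Equiv.symm_apply_apply] at this
        exact this)
    refine if_congr ?_ rfl rfl
    constructor
    · intro h
      have h3 : x' = runList (structGates (copyPos N k b anc) cell) (Sum.elim s
          (Sum.elim (x ∘ Sum.inr ∘ Sum.inl)
            (structBits (fun _ _ => false) (fun _ _ _ => false) X ℓ))) := by
        rw [hrun, helim x', hl, hsx, hr, h]
        rfl
      have h4 := (runList_bijective _).1 h3
      rw [h4]
      rfl
    · intro h
      have h3 : x = Sum.elim s (Sum.elim (x ∘ Sum.inr ∘ Sum.inl)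
          (structBits (fun _ _ => false) (fun _ _ _ => false) X ℓ)) := by
        conv_lhs => rw [helim x]
        rw [hsx, h]
        rfl
      have h4 : x' = Sum.elim s (Sum.elim (x ∘ Sum.inr ∘ Sum.inl)
          (structBits (cellRel cell s) (fun _ => cellRel cell s) X ℓ)) := by
        rw [← hrun, ← h3]
      rw [h4]
      rfl
  · simp only [permInput, if_neg hp, mul_zero]
    split_ifs <;> rfl

/-- After the relabelling no gate acts on the structure wires, so each of their values gives a
separate swap test on a slice. The slices have total weight 1, whence the first `1/2`; their
overlaps, signed by the sign bit, are reassembled into the mixture over `τ` and the sign by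
linearity. -/
theorem trueWeight_run (v : Bits b → ℂ) (hv : ∑ z, ‖v z‖ ^ 2 = 1) (f : Ket)
    (hf : f.qubits = min C.out ((k + 1) * (N * N) + b + C.anc))
    {cell : Fin N → Fin N → Option (Fin m × Fin m)} (hcell : ∀ u, cell u u = none)
    (X : Fin N → Fin N → Clr → Bool) (s : Fin m × Fin m → Bool) :
    ∃ φ' : Amp (RunWires ((k + 1) * (N * N) + b + C.anc)
        (min C.out ((k + 1) * (N * N) + b + C.anc)) N (k + 1) Clr),
      appList (runGates C k b Clr cell) (basisTensor s (runState C.anc v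
        (fun x => f.amp fun i => x (Fin.cast hf i))
        (structBits (fun _ _ => false) (fun _ _ _ => false) X))) = basisTensor s φ' ∧
      trueWeight (.inl (.inr (.inr ()))) φ' = 1 / 2 - 1 / 2 *
        ∑ p : Perm (Fin N) × Bool, 1 / (2 * N.factorial) * (if p.2 then -1 else 1) *
          (C.output ⟨(k + 1) * (N * N) + b, productInput (fun l : Fin (k + 1) =>
            if l = Fin.last k then orbitMat (cellRel cell s) X p.1 p.2
            else orbitMat (cellRel cell s) X p.1 false) v⟩).overlap f := by
  set F : Bits (min C.out ((k + 1) * (N * N) + b + C.anc)) → ℂ :=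
    fun x => f.amp fun i => x (Fin.cast hf i) with hF
  have hF1 : ∑ x, ‖F x‖ ^ 2 = 1 := by
    rw [← f.norm_one]
    exact ((Equiv.arrowCongr (finCongr hf) (Equiv.refl Bool)).symm.sum_comp
      fun x => ‖f.amp x‖ ^ 2)
  set E : Branch N (k + 1) → StructWires N (k + 1) Clr → Bool :=
    structBits (cellRel cell s) (fun _ => cellRel cell s) X with hE
  have hEl : ∀ ℓ ℓ', E ℓ = E ℓ' → ℓ.1 = ℓ'.1 ∧ ℓ.2.1 = ℓ'.2.1 := fun _ _ => structBits_left
  refine ⟨appList (((C.wireGates ((k + 1) * (N * N) + b)).map (WGate.map Sum.inl) ++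
    swapTest (Nat.min_le_right C.out ((k + 1) * (N * N) + b + C.anc))).map (WGate.map Sum.inl))
    (runState C.anc v F E), ?_, ?_⟩
  · rw [runGates, appList_append, appList_structGates_runState v F hcell,
      appList_map_inr_basisTensor]
  have hslice : ∀ (y) (e : StructWires N (k + 1) Clr → Bool),
      appList (((C.wireGates ((k + 1) * (N * N) + b)).map (WGate.map Sum.inl) ++
        swapTest (Nat.min_le_right C.out ((k + 1) * (N * N) + b + C.anc))).map (WGate.map Sum.inl))
        (runState C.anc v F E) (Sum.elim y e) =
      appList (swapTest (Nat.min_le_right C.out ((k + 1) * (N * N) + b + C.anc)))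
        (swapState (appList (C.wireGates ((k + 1) * (N * N) + b))
          (padAncillas C.anc (branchSlice v E e))) F
          (((if e (.inr (.inl ())) then -1 else 1 : ℝ)) : ℂ)) y := by
    intro y e
    rw [appList_map_inl, appList_append, ← appList_map_inl_swapState]
    rfl
  rw [trueWeight, sum_sum_elim, Finset.sum_comm]
  simp only [hslice, Sum.elim_inl]
  have hsum : ∀ e : StructWires N (k + 1) Clr → Bool, _ := fun e =>
    sum_swapTest (Nat.min_le_right C.out ((k + 1) * (N * N) + b + C.anc))
      (appList (C.wireGates ((k + 1) * (N * N) + b)) (padAncillas C.anc (branchSlice v E e))) F hF1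
      (if e (.inr (.inl ())) then -1 else 1) (by split_ifs <;> norm_num)
  simp only [hsum, sum_norm_sq_appList, sum_norm_sq_padAncillas]
  simp only [hF, ← overlap_output_pure C _ f hf]
  rw [Finset.sum_sub_distrib, ← Finset.mul_sum, sum_norm_sq_branchSlice hv hEl, mul_one]
  congr 1
  have h1 := overlap_output_sum Finset.univ C f
    (fun e : StructWires N (k + 1) Clr → Bool => (if e (.inr (.inl ())) then -1 else 1 : ℝ))
    (fun e => Matrix.vecMulVec (branchSlice v E e) (star (branchSlice v E e)))
  have h2 := overlap_output_sum Finset.univ C f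
    (fun p : Perm (Fin N) × Bool => 1 / (2 * N.factorial) * (if p.2 then -1 else 1 : ℝ))
    (fun p => productInput (fun l : Fin (k + 1) =>
            if l = Fin.last k then orbitMat (cellRel cell s) X p.1 p.2
            else orbitMat (cellRel cell s) X p.1 false) v)
  have h3 := sum_branchSlice (k := k) v (cellRel cell s) X fun c => (if c then -1 else 1 : ℝ)
  rw [← h2, ← h3, h1, Finset.mul_sum]
  refine Finset.sum_congr rfl fun e _ => ?_
  rw [pureOp]
  ring

end RunTheorem

end QPK

namespace QPK

open Equiv

/-! ### Two copies of a graph, with colours -/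

section Graph

variable {m : ℕ} (G : SimpleGraph (Fin m))

/-- The colours of two copies of a graph. In the first copy all vertices up to `i` have their own
colours; in the second copy all vertices before `i` have their own colours and `j` has the
colour `i`. -/
def twoColour (i j : Fin m) : Bool × Fin m → Option (Fin m)
  | (false, x) => if x ≤ i then some x else none
  | (true, x) => if x < i then some x else if x = j then some i else none

/-- A permutation of the vertices of two copies of a graph respects the copies, the edges and the
colours. -/
structure Respects (c : Bool × Fin m → Option (Fin m)) (ψ : Perm (Bool × Fin m)) : Prop where
  copy : ∀ p r, (ψ p).1 = (ψ r).1 ↔ p.1 = r.1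
  colour : ∀ p, c (ψ p) = c p
  adj : ∀ p r, p.1 = r.1 → (G.Adj (ψ p).2 (ψ r).2 ↔ G.Adj p.2 r.2)

/-- Automorphisms of a graph, as permutations. -/
def IsAut (φ : Perm (Fin m)) : Prop := ∀ x y, G.Adj (φ x) (φ y) ↔ G.Adj x y

variable {G}

theorem IsAut.mul {φ χ : Perm (Fin m)} (h : IsAut G φ) (h' : IsAut G χ) : IsAut G (φ * χ) :=
  fun x y => (h _ _).trans (h' x y)

theorem IsAut.inv {φ : Perm (Fin m)} (h : IsAut G φ) : IsAut G φ⁻¹ := fun x y => by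
  rw [← h]
  simp

theorem hasNontrivialAut_iff : HasNontrivialAut G ↔ ∃ φ, IsAut G φ ∧ φ ≠ 1 := by
  constructor
  · rintro ⟨φ, v, hv⟩
    exact ⟨φ.toEquiv, fun x y => φ.map_rel_iff, fun h => hv (congrFun (congrArg DFunLike.coe h) v)⟩
  · rintro ⟨φ, h, hne⟩
    refine ⟨⟨φ, fun {x y} => h x y⟩, ?_⟩
    by_contra! hall
    exact hne (Equiv.ext hall)

/-- A permutation that respects the copies either keeps both copies or swaps them. -/
theorem Respects.decompose {c : Bool × Fin m → Option (Fin m)} {ψ : Perm (Bool × Fin m)}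
    (h : Respects G c ψ) (i : Fin m) : ∃ s : Bool, ∃ α : Bool → Perm (Fin m),
      (∀ b x, ψ (b, x) = (b.xor s, α b x)) ∧ ∀ b, IsAut G (α b) := by
  have hs : ∀ b x, (ψ (b, x)).1 = b.xor (ψ (false, i)).1 := by
    intro b x
    cases b
    · rw [Bool.false_xor, h.copy]
    · have : (ψ (true, x)).1 ≠ (ψ (false, i)).1 := fun e => by simpa using (h.copy _ _).1 e
      revert this
      cases (ψ (true, x)).1 <;> cases (ψ (false, i)).1 <;> simp
  have hinj : ∀ b, Function.Injective fun x => (ψ (b, x)).2 := by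
    intro b x y hxy
    have : ψ (b, x) = ψ (b, y) := Prod.ext ((hs b x).trans (hs b y).symm) hxy
    exact (Prod.ext_iff.1 (ψ.injective this)).2
  refine ⟨(ψ (false, i)).1, fun b => Equiv.ofBijective _ (Finite.injective_iff_bijective.1 (hinj b)),
    fun b x => Prod.ext (hs b x) rfl, fun b x y => h.adj (b, x) (b, y) rfl⟩

theorem respects_one (c : Bool × Fin m → Option (Fin m)) : Respects G c 1 :=
  ⟨fun _ _ => Iff.rfl, fun _ => rfl, fun _ _ _ => Iff.rfl⟩

/-- Rigidity makes both components trivial, so only the plain exchange of the copies is left. It is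
excluded by the vertex `i`, which has the colour `i` in the first copy and, as `i ≠ j`, none in the
second. -/
theorem eq_one_of_respects_of_rigid (hG : ¬ HasNontrivialAut G) {i j : Fin m} (hij : i ≠ j)
    {ψ : Perm (Bool × Fin m)} (h : Respects G (twoColour i j) ψ) : ψ = 1 := by
  obtain ⟨s, α, hα, haut⟩ := h.decompose i
  have h1 : ∀ b, α b = 1 := by
    intro b
    by_contra hne
    exact hG (hasNontrivialAut_iff.2 ⟨α b, haut b, hne⟩)
  have hs : s = false := by
    by_contra hs
    rw [Bool.not_eq_false] at hs
    have := h.colour (false, i)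
    rw [hα, h1, hs] at this
    simp [twoColour, hij] at this
  ext1 ⟨b, x⟩
  rw [hα, h1, hs]
  simp

/-- The permutation that swaps two copies of a graph along `φ`. -/
def swapCopies (φ : Perm (Fin m)) : Perm (Bool × Fin m) where
  toFun p := (!p.1, if p.1 then φ⁻¹ p.2 else φ p.2)
  invFun p := (!p.1, if p.1 then φ⁻¹ p.2 else φ p.2)
  left_inv := by rintro ⟨b, x⟩; cases b <;> simp
  right_inv := by rintro ⟨b, x⟩; cases b <;> simp

theorem swapCopies_mul_self (φ : Perm (Fin m)) : swapCopies φ * swapCopies φ = 1 := by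
  ext1 p
  exact (swapCopies φ).left_inv p

theorem swapCopies_ne (φ : Perm (Fin m)) (p : Bool × Fin m) : swapCopies φ p ≠ p := by
  intro h
  have : (!p.1) = p.1 := congrArg Prod.fst h
  revert this
  cases p.1 <;> simp

/-- Take `i` maximal such that a non-trivial automorphism `φ` fixes all vertices before `i`, and `j
= φ i`. By maximality an automorphism that fixes all vertices up to `i` is trivial. A symmetry of
the coloured copies amounts, after composing with powers of `φ`, to such automorphisms, so it is the
identity or the exchange of the copies along `φ`. -/
theorem exists_respects_iff (hG : HasNontrivialAut G) : ∃ i j : Fin m, i ≠ j ∧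
    ∃ π : Perm (Bool × Fin m), π * π = 1 ∧ (∀ p, π p ≠ p) ∧
      ∀ ψ, Respects G (twoColour i j) ψ ↔ ψ = 1 ∨ ψ = π := by
  classical
  obtain ⟨φ₀, hφ₀, hne₀⟩ := hasNontrivialAut_iff.1 hG
  obtain ⟨v, -⟩ : ∃ v, φ₀ v ≠ v := by
    by_contra! hall
    exact hne₀ (Equiv.ext hall)
  -- It contains 0, for which the condition on earlier vertices is void.
  let S : Finset (Fin m) := Finset.univ.filter fun i => ∃ φ, IsAut G φ ∧ φ ≠ 1 ∧ ∀ x < i, φ x = x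
  have hS : S.Nonempty := by
    refine ⟨⟨0, v.pos⟩, Finset.mem_filter.2 ⟨Finset.mem_univ _, φ₀, hφ₀, hne₀, fun x hx => ?_⟩⟩
    exact absurd hx (Nat.not_lt_zero _)
  obtain ⟨i, hi, hmax⟩ := S.exists_max_image id hS
  obtain ⟨φ, hφ, hne, hfix⟩ := (Finset.mem_filter.1 hi).2
  have hrigid : ∀ χ, IsAut G χ → (∀ x ≤ i, χ x = x) → χ = 1 := by
    intro χ hχ hx
    by_contra hχne
    by_cases hlast : i.val + 1 < m
    · have hmem : (⟨i.val + 1, hlast⟩ : Fin m) ∈ S := by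
        refine Finset.mem_filter.2 ⟨Finset.mem_univ _, χ, hχ, hχne, fun x hlt => hx x ?_⟩
        exact Nat.lt_succ_iff.1 hlt
      have := hmax _ hmem
      simp only [id] at this
      exact absurd (Fin.le_def.1 this) (by simp)
    · refine hχne (Equiv.ext fun x => hx x ?_)
      have := x.2
      exact Fin.le_def.2 (by omega)
  -- Otherwise `φ` would fix all vertices up to `i` and be trivial.
  have hij : φ i ≠ i := by
    intro h
    refine hne (hrigid φ hφ fun x hx => ?_)
    rcases hx.lt_or_eq with h' | rfl
    · exact hfix x h'
    · exact h
  have hji : ¬ φ i < i := fun h => hij (φ.injective (hfix _ h))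
  have hlt : ∀ x, φ x < i ↔ x < i := by
    intro x
    constructor
    · intro h
      have := φ.injective (hfix _ h)
      rwa [this] at h
    · intro h
      rwa [hfix x h]
  have hcol : ∀ p, twoColour i (φ i) (swapCopies φ p) = twoColour i (φ i) p := by
    have hf : ∀ x, twoColour i (φ i) (true, φ x) = twoColour i (φ i) (false, x) := by
      intro x
      simp only [twoColour, hlt]
      rcases lt_trichotomy x i with h | rfl | h
      · simp [h, h.le, hfix]
      · simp
      · simp [h.not_gt, h.not_ge, h.ne']
    rintro ⟨b, x⟩
    cases b
    · exact hf x
    · have := hf (φ⁻¹ x)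
      rw [show φ (φ⁻¹ x) = x from φ.apply_symm_apply x] at this
      exact this.symm
  refine ⟨i, φ i, hij.symm, swapCopies φ, swapCopies_mul_self φ, swapCopies_ne φ, fun ψ => ⟨fun h => ?_, ?_⟩⟩
  · obtain ⟨s, α, hα, haut⟩ := h.decompose i
    have hc : ∀ b x, twoColour i (φ i) (b.xor s, α b x) = twoColour i (φ i) (b, x) := by
      intro b x
      rw [← hα]
      exact h.colour _
    cases s
    · left
      have hlt1 : ∀ b, ∀ x < i, α b x = x := by
        intro b x hx
        have := hc b x
        cases b
        · simp only [twoColour, Bool.xor_false, hx.le, if_true] at this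
          split_ifs at this
          exact Option.some.inj this
        · simp only [twoColour, Bool.xor_false, hx, if_true] at this
          split_ifs at this with h1 h2
          · exact Option.some.inj this
          · exact absurd (Option.some.inj this) hx.ne'
      have h0 : α false = 1 := by
        refine hrigid _ (haut _) fun x hx => ?_
        have := hc false x
        simp only [twoColour, Bool.xor_false, hx, if_true] at this
        split_ifs at this
        exact Option.some.inj this
      have h1 : α true (φ i) = φ i := by
        have := hc true (φ i)
        simp only [twoColour, Bool.xor_false, hji, if_true, if_false] at this
        split_ifs at this with h1 h2
        · exact absurd (Option.some.inj this) h1.ne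
        · exact h2
      -- On the second copy it is `φ i` rather than `i` that is fixed; conjugation by `φ` brings
      -- this back to the stabiliser of the vertices up to `i`.
      have h2 : φ⁻¹ * α true * φ = 1 := by
        refine hrigid _ ((hφ.inv.mul (haut _)).mul hφ) fun x hx => ?_
        rcases hx.lt_or_eq with h' | rfl
        · rw [Perm.mul_apply, Perm.mul_apply, hfix x h', hlt1 true x h', Perm.inv_eq_iff_eq]
          exact (hfix x h').symm
        · rw [Perm.mul_apply, Perm.mul_apply, h1]
          exact φ.symm_apply_apply _
      have h3 : α true = 1 := by
        have : α true = φ * (φ⁻¹ * α true * φ) * φ⁻¹ := by group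
        rw [this, h2]
        group
      ext1 ⟨b, x⟩
      rw [hα]
      cases b
      · simp [h0]
      · simp [h3]
    · right
      have hlt1 : ∀ b, ∀ x < i, α b x = x := by
        intro b x hx
        have := hc b x
        cases b
        · simp only [twoColour, Bool.false_xor, hx.le, if_true] at this
          split_ifs at this with h1 h2
          · exact Option.some.inj this
          · exact absurd (Option.some.inj this) hx.ne'
        · simp only [twoColour, Bool.xor_self, hx, if_true] at this
          split_ifs at this
          exact Option.some.inj this
      have h1 : α false i = φ i := by
        have := hc false i
        simp only [twoColour, Bool.false_xor, le_refl, if_true] at this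
        split_ifs at this with h1 h2
        · exact absurd (Option.some.inj this) h1.ne
        · exact h2
      have h2 : α true (φ i) = i := by
        have := hc true (φ i)
        simp only [twoColour, Bool.xor_self, hji, if_true, if_false] at this
        split_ifs at this
        exact Option.some.inj this
      -- The colour `i` forces `i ↦ φ i` on the first copy, so composing with the inverse of `φ`
      -- fixes all vertices up to `i`; the other copy is symmetric.
      have h3 : φ⁻¹ * α false = 1 := by
        refine hrigid _ (hφ.inv.mul (haut _)) fun x hx => ?_
        rcases hx.lt_or_eq with h' | rfl
        · rw [Perm.mul_apply, hlt1 false x h', Perm.inv_eq_iff_eq]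
          exact (hfix x h').symm
        · rw [Perm.mul_apply, h1]
          exact φ.symm_apply_apply _
      have h4 : α true * φ = 1 := by
        refine hrigid _ ((haut _).mul hφ) fun x hx => ?_
        rcases hx.lt_or_eq with h' | rfl
        · rw [Perm.mul_apply, hfix x h', hlt1 true x h']
        · rw [Perm.mul_apply, h2]
      have h5 : α false = φ := (inv_mul_eq_one.1 h3).symm
      have h6 : α true = φ⁻¹ := mul_eq_one_iff_eq_inv.1 h4
      ext1 ⟨b, x⟩
      rw [hα]
      cases b
      · simp [h5, swapCopies]
      · simp [h6, swapCopies]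
  · rintro (rfl | rfl)
    · exact respects_one _
    · refine ⟨fun p r => ?_, hcol, ?_⟩
      · simp [swapCopies]
      · rintro ⟨b, x⟩ ⟨b', y⟩ hb
        obtain rfl : b = b' := hb
        cases b
        · exact hφ x y
        · exact hφ.inv x y

end Graph

end QPK

namespace QPK

open Equiv KKNY

/-! ### The coloured double graph as a relational structure on `N` points. -/

section TwoCopies

variable {m N : ℕ} (ε : Bool × Fin m ≃ Fin N)

/-- Pairs of different vertices in the same copy, as entries of the adjacency matrix. -/
def twoCells (u v : Fin N) : Option (Fin m × Fin m) :=
  if (ε.symm u).1 = (ε.symm v).1 ∧ (ε.symm u).2 ≠ (ε.symm v).2 then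
    some ((ε.symm u).2, (ε.symm v).2) else none

theorem twoCells_self (u : Fin N) : twoCells ε u u = none := if_neg fun h => h.2 rfl

/-- The copies and the colours as a family of relations. -/
def twoRels (i j : Fin m) (u v : Fin N) : Option (Option (Fin m)) → Bool
  | none => decide ((ε.symm u).1 = (ε.symm v).1)
  | some c => decide (twoColour i j (ε.symm u) = c)

variable {G : SimpleGraph (Fin m)}

theorem cellRel_twoCells_iff (p r : Bool × Fin m) :
    cellRel (twoCells ε) (adjBits G) (ε p) (ε r) = true ↔ p.1 = r.1 ∧ G.Adj p.2 r.2 := by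
  simp only [cellRel, twoCells, Equiv.symm_apply_apply]
  split_ifs with h
  · simp [optionBit, adjBits, h.1]
  · simp only [optionBit, Bool.false_eq_true, false_iff]
    rintro ⟨h1, h2⟩
    exact h ⟨h1, h2.ne⟩

/-- Two relabellings of a structure agree exactly if `σ⁻¹ * σ'` is an automorphism. Colours are
coded as binary relations that ignore their second argument, so that one kind of relabelling covers
everything. -/
theorem relabel_eq_iff {i j : Fin m} {σ σ' : Perm (Fin N)} :
    relabel (cellRel (twoCells ε) (adjBits G)) (twoRels ε i j) σ =
        relabel (cellRel (twoCells ε) (adjBits G)) (twoRels ε i j) σ' ↔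
      Respects G (twoColour i j) (ε.symm.permCongr (σ⁻¹ * σ')) := by
  set ψ := ε.symm.permCongr (σ⁻¹ * σ') with hψ
  have hmap : ∀ p, σ⁻¹ (σ' (ε p)) = ε (ψ p) := by
    intro p
    simp [hψ, Equiv.permCongr_apply]
  constructor
  · intro h
    have h' : ∀ p r, cellRel (twoCells ε) (adjBits G) (ε (ψ p)) (ε (ψ r)) =
        cellRel (twoCells ε) (adjBits G) (ε p) (ε r) ∧
        ∀ c, twoRels ε i j (ε (ψ p)) (ε (ψ r)) c = twoRels ε i j (ε p) (ε r) c := by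
      intro p r
      have := congrFun (congrFun h (σ' (ε p))) (σ' (ε r))
      simp only [relabel, hmap, show ∀ a, σ'⁻¹ (σ' a) = a from σ'.symm_apply_apply] at this
      exact ⟨congrArg Prod.fst this, fun c => congrFun (congrArg Prod.snd this) c⟩
    have hcopy : ∀ p r, (ψ p).1 = (ψ r).1 ↔ p.1 = r.1 := by
      intro p r
      have := (h' p r).2 none
      simp only [twoRels, Equiv.symm_apply_apply] at this
      exact decide_eq_decide.1 this
    refine ⟨hcopy, fun p => ?_, fun p r hpr => ?_⟩
    · have := (h' p p).2 (some (twoColour i j p))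
      simp only [twoRels, Equiv.symm_apply_apply, decide_true] at this
      exact of_decide_eq_true this
    · have := (h' p r).1
      rw [Bool.eq_iff_iff, cellRel_twoCells_iff, cellRel_twoCells_iff, hcopy] at this
      simpa [hpr] using this
  · intro h
    funext a b
    obtain ⟨p, rfl⟩ : ∃ p, σ' (ε p) = a := ⟨ε.symm (σ'⁻¹ a), by simp⟩
    obtain ⟨r, rfl⟩ : ∃ r, σ' (ε r) = b := ⟨ε.symm (σ'⁻¹ b), by simp⟩
    simp only [relabel, hmap, show ∀ a, σ'⁻¹ (σ' a) = a from σ'.symm_apply_apply]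
    refine Prod.ext ?_ (funext fun c => ?_)
    · simp only
      rw [Bool.eq_iff_iff, cellRel_twoCells_iff, cellRel_twoCells_iff, h.copy]
      exact and_congr_right fun hpr => h.adj p r hpr
    · cases c with
      | none => simp [twoRels, h.copy]
      | some c => simp [twoRels, h.colour]

theorem relabel_injective_of_rigid (hG : ¬ HasNontrivialAut G) {i j : Fin m} (hij : i ≠ j) :
    Function.Injective
      (relabel (cellRel (twoCells ε) (adjBits G)) (twoRels ε i j)) := by
  intro σ σ' h
  have h1 := eq_one_of_respects_of_rigid hG hij ((relabel_eq_iff ε).1 h)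
  have h2 : σ⁻¹ * σ' = 1 := ε.symm.permCongr.injective (h1.trans (by ext1; simp))
  exact inv_mul_eq_one.1 h2

theorem exists_relabel_eq_iff (hG : HasNontrivialAut G) : ∃ i j : Fin m, i ≠ j ∧
    ∃ π : Perm (Fin N), π * π = 1 ∧ (∀ a, π a ≠ a) ∧ ∀ σ σ',
      relabel (cellRel (twoCells ε) (adjBits G)) (twoRels ε i j) σ =
        relabel (cellRel (twoCells ε) (adjBits G)) (twoRels ε i j) σ' ↔ σ' = σ ∨ σ' = σ * π := by
  obtain ⟨i, j, hij, π, hπ, hfix, hiff⟩ := exists_respects_iff hG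
  have hsymm : ∀ χ : Perm (Fin N), ε.symm.permCongr χ = π ↔ χ = ε.permCongr π := fun χ => by
    rw [← Equiv.eq_symm_apply]
    rfl
  have hone : ∀ χ : Perm (Fin N), ε.symm.permCongr χ = 1 ↔ χ = 1 := fun χ => by
    rw [← Equiv.eq_symm_apply]
    refine iff_of_eq (congrArg _ ?_)
    ext1
    simp
  refine ⟨i, j, hij, ε.permCongr π, ?_, fun a h => hfix (ε.symm a) ?_, fun σ σ' => ?_⟩
  · ext1 a
    have := congrFun (congrArg DFunLike.coe hπ) (ε.symm a)
    simp only [Perm.mul_apply, Perm.one_apply] at this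
    simp [Equiv.permCongr_apply, this]
  · rw [Equiv.permCongr_apply] at h
    exact ε.injective (by simpa using h)
  · rw [relabel_eq_iff, hiff, hone, hsymm, inv_mul_eq_one, inv_mul_eq_iff_eq_mul]
    exact or_congr_left eq_comm

end TwoCopies

/-! ### The permutation register after the structure has been traced out. -/

section OrbitStates

variable {N : ℕ} {Clr : Type} {A : Fin N → Fin N → Bool} {X : Fin N → Fin N → Clr → Bool}

theorem signC_mul_self (σ : Perm (Fin N)) : signC σ * signC σ = 1 := by
  rcases Int.units_eq_one_or (Perm.sign σ) with h | h <;> simp [signC, h]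

/-- Only diagonal terms survive, and there the sign occurs squared. This is why the two ciphertexts
are indistinguishable for a rigid graph. -/
theorem orbitMat_eq_of_injective (h : Function.Injective (relabel A X)) (τ : Perm (Fin N)) :
    orbitMat A X τ true = orbitMat A X τ false := by
  ext x y
  refine Finset.sum_congr rfl fun p _ => ?_
  simp only [orbitTerm, if_true, Bool.false_eq_true, if_false]
  split_ifs with hp
  · rw [mul_right_cancel (h hp.1), signC_mul_self]
  · rfl

/-- Expand the projection; the substitution `σ ↦ σπ` identifies the two halves of the four terms.
The cases `c = 1` and `c = -1` are `ρ⁺` and `ρ⁻`. -/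
theorem sum_ket_eq (π : Perm (Fin N)) (hπ : π * π = 1) (c : ℂ) (hc : c * c = 1) (hc' : star c = c) :
    (1 / (2 * (N.factorial : ℂ))) • ∑ σ : Perm (Fin N),
        Matrix.vecMulVec (ket σ + c • ket (σ * π)) (star (ket σ + c • ket (σ * π))) =
      (1 / (N.factorial : ℂ)) • ∑ σ : Perm (Fin N),
        (Matrix.vecMulVec (ket σ) (ket σ) + c • Matrix.vecMulVec (ket σ) (ket (σ * π))) := by
  have hstar : ∀ σ : Perm (Fin N), star (ket σ) = ket σ := by
    intro σ
    funext x
    simp [ket, Pi.single_apply]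
  have hreindex : ∀ F : Perm (Fin N) → OpMat (N * N), ∑ σ, F (σ * π) = ∑ σ, F σ := fun F =>
    Equiv.sum_comp (Equiv.mulRight π) F
  have h2 : ∀ σ : Perm (Fin N),
      Matrix.vecMulVec (ket σ + c • ket (σ * π)) (star (ket σ + c • ket (σ * π))) =
      (Matrix.vecMulVec (ket σ) (ket σ) + c • Matrix.vecMulVec (ket σ) (ket (σ * π))) +
        (Matrix.vecMulVec (ket (σ * π)) (ket (σ * π)) +
          c • Matrix.vecMulVec (ket (σ * π)) (ket (σ * π * π))) := by
    intro σ
    rw [star_add, star_smul, hstar, hstar, hc', mul_assoc, hπ, mul_one]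
    ext x y
    simp only [Matrix.vecMulVec_apply, Matrix.add_apply, Matrix.smul_apply, Pi.add_apply, Pi.smul_apply,
      smul_eq_mul]
    linear_combination (ket (σ * π) x * ket (σ * π) y) * hc
  simp only [h2]
  rw [Finset.sum_add_distrib, hreindex fun σ =>
    Matrix.vecMulVec (ket σ) (ket σ) + c • Matrix.vecMulVec (ket σ) (ket (σ * π)), ← two_smul ℂ,
    smul_smul]
  congr 1
  have : (N.factorial : ℂ) ≠ 0 := by exact_mod_cast N.factorial_ne_zero
  field_simp

/-- The additional relabelling by `τ` conjugates the automorphism, so `σ` interferes only with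
itself and with `σ * (τ * π * τ⁻¹)`. The relative sign of the two is `sgn π`, independent of `σ` and
`τ`. -/
theorem orbitMat_eq_sum {π : Perm (Fin N)} (hπ : π ≠ 1)
    (h : ∀ σ σ', relabel A X σ = relabel A X σ' ↔ σ' = σ ∨ σ' = σ * π) (τ : Perm (Fin N)) (s : Bool) :
    orbitMat A X τ s = (1 / (N.factorial : ℂ)) • ∑ σ : Perm (Fin N),
        (Matrix.vecMulVec (ket σ) (ket σ) +
          (if s then signC π else 1) • Matrix.vecMulVec (ket σ) (ket (σ * (τ * π * τ⁻¹)))) := by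
  classical
  have hrel : ∀ σ σ', relabel A X (σ * τ) = relabel A X (σ' * τ) ↔
      σ' = σ ∨ σ' = σ * (τ * π * τ⁻¹) := by
    intro σ σ'
    rw [h, mul_left_inj, ← eq_mul_inv_iff_mul_eq]
    simp only [mul_assoc]
  have hne : ∀ σ : Perm (Fin N), σ ≠ σ * (τ * π * τ⁻¹) := by
    intro σ e
    have h1 : τ * π * τ⁻¹ = 1 := by
      have := e.symm
      rwa [mul_eq_left] at this
    exact hπ (by simpa using h1)
  have hsgn : ∀ σ : Perm (Fin N), signC σ * signC (σ * (τ * π * τ⁻¹)) = signC π := by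
    intro σ
    have : signC (σ * (τ * π * τ⁻¹)) = signC σ * signC π := by
      simp only [signC, Perm.sign_mul, Perm.sign_inv]
      rcases Int.units_eq_one_or (Perm.sign τ) with h | h <;> simp [h]
    rw [this, ← mul_assoc, signC_mul_self, one_mul]
  ext x y
  rw [Matrix.smul_apply, Matrix.sum_apply, orbitMat, Fintype.sum_prod_type, Finset.smul_sum]
  refine Finset.sum_congr rfl fun σ _ => ?_
  rw [← Finset.sum_subset (Finset.subset_univ {σ, σ * (τ * π * τ⁻¹)}), Finset.sum_pair (hne σ)]
  · simp only [orbitTerm, hrel, or_true, true_and, Matrix.add_apply, Matrix.smul_apply,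
      Matrix.vecMulVec_apply, ket, Pi.single_apply, signC_mul_self, hsgn, smul_eq_mul]
    by_cases hx : x = bits σ <;> by_cases hy : y = bits σ <;>
      by_cases hy' : y = bits (σ * (τ * π * τ⁻¹)) <;> simp [hx, hy, hy', mul_add]
  · intro σ' _ hσ'
    simp only [Finset.mem_insert, Finset.mem_singleton] at hσ'
    exact if_neg fun h => hσ' ((hrel σ σ').1 h.1)

end OrbitStates

/-! ### Keys as conjugates of the automorphism. -/

section Keys

variable {n : ℕ} {Clr : Type} {A : Fin (deg n) → Fin (deg n) → Bool}
  {X : Fin (deg n) → Fin (deg n) → Clr → Bool}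

/-- Conjugation of decryption keys. -/
def conjSecret (τ : Perm (Fin (deg n))) (π : Secret n) : Secret n :=
  ⟨τ * π.1 * τ⁻¹, by
    have := π.2.1
    calc τ * π.1 * τ⁻¹ * (τ * π.1 * τ⁻¹) = τ * (π.1 * π.1) * τ⁻¹ := by group
      _ = 1 := by rw [this]; group, fun i h => π.2.2 (τ⁻¹ i) (by
        rw [Perm.eq_inv_iff_eq]
        exact h)⟩

theorem orbitMat_false (π : Secret n)
    (h : ∀ σ σ', relabel A X σ = relabel A X σ' ↔ σ' = σ ∨ σ' = σ * π.1) (τ : Perm (Fin (deg n))) :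
    orbitMat A X τ false = pubMat (conjSecret τ π).1 := by
  rw [orbitMat_eq_sum (secret_ne_one π) h, pubMat]
  have := sum_ket_eq (conjSecret τ π).1 (conjSecret τ π).2.1 1 (by simp) (by simp)
  simp only [one_smul] at this
  rw [this]
  simp [conjSecret]

/-- Keys are odd, being products of `2n + 1` transpositions, so the relative sign is `-1` and `ρ⁻`
appears. -/
theorem orbitMat_true (π : Secret n)
    (h : ∀ σ σ', relabel A X σ = relabel A X σ' ↔ σ' = σ ∨ σ' = σ * π.1) (τ : Perm (Fin (deg n))) :
    orbitMat A X τ true = applyKraus [encOp (deg n) [true]] (pubMat (conjSecret τ π).1) := by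
  have hs : signC π.1 = -1 := by simp [signC, secret_sign π]
  rw [orbitMat_eq_sum (secret_ne_one π) h]
  simp only [applyKraus, List.map_cons, List.map_nil, List.sum_cons, List.sum_nil, add_zero, encOp,
    if_true]
  rw [signOp_conj_pubMat (secret_sign _)]
  have := sum_ket_eq (conjSecret τ π).1 (conjSecret τ π).2.1 (-1) (by simp) (by simp)
  simp only [neg_smul, one_smul, ← sub_eq_add_neg] at this
  rw [this]
  simp [conjSecret, hs, sub_eq_add_neg]

/-- Every key has the cycle type of `2n + 1` transpositions. -/
theorem exists_conjSecret (π π' : Secret n) : ∃ τ, conjSecret τ π = π' := by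
  have hct : ∀ π : Secret n, π.1.cycleType = Multiset.replicate (2 * n + 1) 2 := by
    intro π
    have h2 : ∀ c ∈ π.1.cycleType, c = 2 := by
      have : Fact (Nat.Prime 2) := ⟨Nat.prime_two⟩
      exact Perm.pow_prime_eq_one_iff.1 (by rw [pow_two]; exact π.2.1)
    have h3 := Multiset.eq_replicate_of_mem h2
    have h4 : π.1.cycleType.sum = deg n := by
      rw [Perm.sum_cycleType]
      have : π.1.support = Finset.univ := by
        ext i
        simpa using π.2.2 i
      rw [this, Finset.card_univ, Fintype.card_fin]
    have h5 : Multiset.card π.1.cycleType = 2 * n + 1 := by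
      rw [h3, Multiset.sum_replicate] at h4
      simp only [deg, smul_eq_mul] at h4
      omega
    rw [h3, h5]
  obtain ⟨τ, hτ⟩ := isConj_iff.1 (Perm.isConj_iff_cycleType_eq.2 ((hct π).trans (hct π').symm))
  exact ⟨τ, Subtype.ext hτ⟩

/-- The conjugates of a key under uniformly random permutations are uniformly distributed. -/
theorem sum_conjSecret (π : Secret n) (F : Secret n → ℝ) :
    (1 / ((deg n).factorial : ℝ)) * ∑ τ, F (conjSecret τ π) =
      (1 / (Fintype.card (Secret n) : ℝ)) * ∑ π', F π' := by
  have hmul : ∀ (τ κ : Perm (Fin (deg n))) (π : Secret n),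
      conjSecret τ (conjSecret κ π) = conjSecret (τ * κ) π := by
    intro τ κ π
    refine Subtype.ext ?_
    simp only [conjSecret]
    group
  -- By transitivity the sum over `τ` does not depend on the key; summing it over all keys as well
  -- and exchanging the sums gives the claim.
  have hinv : ∀ π', ∑ τ, F (conjSecret τ π') = ∑ τ, F (conjSecret τ π) := by
    intro π'
    obtain ⟨κ, rfl⟩ := exists_conjSecret π π'
    simp only [hmul]
    exact Equiv.sum_comp (Equiv.mulRight κ) fun τ => F (conjSecret τ π)
  have hbij : ∀ τ : Perm (Fin (deg n)), ∑ π', F (conjSecret τ π') = ∑ π', F π' := by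
    intro τ
    refine Function.Bijective.sum_comp (Finite.injective_iff_bijective.1 fun a b hab => ?_) F
    have := congrArg (conjSecret τ⁻¹) hab
    have hone : ∀ π : Secret n, conjSecret 1 π = π := fun π => Subtype.ext (by simp [conjSecret])
    simpa only [hmul, inv_mul_cancel, hone] using this
  have h1 : (Fintype.card (Secret n) : ℝ) * ∑ τ, F (conjSecret τ π) =
      ((deg n).factorial : ℝ) * ∑ π', F π' := by
    calc _ = ∑ π' : Secret n, ∑ τ, F (conjSecret τ π') := by
          simp only [hinv, Finset.sum_const, Finset.card_univ, nsmul_eq_mul]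
      _ = ∑ τ : Perm (Fin (deg n)), ∑ π', F (conjSecret τ π') := Finset.sum_comm
      _ = _ := by
          simp only [hbij, Finset.sum_const, Finset.card_univ, nsmul_eq_mul, Fintype.card_perm,
            Fintype.card_fin]
  have hc : (Fintype.card (Secret n) : ℝ) ≠ 0 := by exact_mod_cast Fintype.card_ne_zero
  have hf : ((deg n).factorial : ℝ) ≠ 0 := by exact_mod_cast (deg n).factorial_ne_zero
  field_simp
  linarith

end Keys

end QPK

namespace QPK

open Equiv KKNY

/-! ### From the advantage of an adversary to graph automorphism -/

theorem Ket.sum_norm_sq_pair (a h : Ket) : ∑ x, ‖a.pair h x‖ ^ 2 = 1 := by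
  rw [sum_append]
  simp only [Ket.pair, Fin.append_left, Fin.append_right, norm_mul, mul_pow, ← Finset.mul_sum,
    h.norm_one, mul_one, a.norm_one]

section Advantage

variable (n k : ℕ) (C : Circuit) (a f h : Ket)

/-- The probability that the adversary produces `f` when it gets the ciphertext `B` and
copies of the encryption key that belongs to `π`. -/
noncomputable def successOn (B : OpMat (deg n * deg n)) (π : Secret n) : ℝ :=
  (C.output ((((⟨deg n * deg n, pubMat π.1⟩ : QOp).tensorPow k).tensor ⟨deg n * deg n, B⟩).tensor
    (a.toOp.tensor h.toOp))).overlap f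

/-- The gain of the adversary from getting a ciphertext of `1` in place of a further copy of the
encryption key. -/
noncomputable def signAdvantage : ℝ :=
  (1 / (Fintype.card (Secret n) : ℝ)) * ∑ π : Secret n,
    (successOn n k C a f h (applyKraus [encOp (deg n) [true]] (pubMat π.1)) π -
      successOn n k C a f h (pubMat π.1) π)

theorem signAdvantage_eq_zero
    (hf : f.qubits ≠ min C.out
      ((k + 1) * (deg n * deg n) + (a.qubits + h.qubits) + C.anc)) :
    signAdvantage n k C a f h = 0 := by
  have : ∀ B π, successOn n k C a f h B π = 0 := by
    intro B π
    rw [successOn, input_eq]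
    exact dif_neg hf
  simp [signAdvantage, this]

/-- The difference of the success probabilities of the adversary and of the same circuit when it
runs on one more copy of the encryption key in place of the ciphertext. -/
theorem realSuccess_sub_idealSuccess (X : PMF (system.msgs n)) (f h : List Bool → Ket) :
    system.realSuccess n k C a X f h - system.idealSuccess keepAdversary n k (k + 1) C a X f h =
      (X ⟨[true], by simp [system]⟩).toReal * signAdvantage n k C a (f [true]) (h [true]) := by
  rw [idealSuccess_keepAdversary, Cryptosystem.realSuccess, ← Finset.sum_sub_distrib, signAdvantage,
    mul_left_comm, Finset.mul_sum, Finset.mul_sum]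
  refine Finset.sum_congr rfl fun π _ => ?_
  rw [← Finset.sum_sub_distrib, Finset.sum_eq_single ⟨[true], by simp [system]⟩]
  · have hk : (system.keyDist n π).toReal = 1 / (Fintype.card (Secret n) : ℝ) := by
      have h : ∀ π : Secret n, (PMF.uniformOfFintype (Secret n) π).toReal =
          1 / (Fintype.card (Secret n) : ℝ) := by simp
      exact h π
    rw [hk]
    simp only [successOn]
    rw [← sub_mul]
    change (QOp.overlap _ _ - QOp.overlap _ _) * _ = _
    rw [show ∀ u v w : ℝ, u * (v * w) = v * (w * u) from fun u v w => by ring]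
    rfl
  -- For the message 0 the ciphertext is the key itself, so both experiments run `C` on `k + 1`
  -- copies and the terms cancel.
  · rintro ⟨α, hα⟩ _ hne
    have : α = [false] := by
      have h2 : α = [false] ∨ α = [true] := by simpa [system] using hα
      exact h2.resolve_right fun e => hne (Subtype.ext e)
    subst this
    rw [sub_eq_zero]
    congr 3
    have : system.cipher n π [false] = system.key n π := by
      change (⟨_, applyKraus [encOp (deg n) [false]] (pubMat π.1)⟩ : QOp) = ⟨_, pubMat π.1⟩
      simp [applyKraus, encOp]
    rw [this]
    rfl
  · simp

end Advantage

section Index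

variable {n k : ℕ} {C : Circuit} {a f h : Ket}

/-- The sum of the overlaps with a sign vanishes if the structure is rigid. -/
theorem sum_overlap_eq_zero {N b : ℕ} {Clr : Type} {A : Fin N → Fin N → Bool}
    {X : Fin N → Fin N → Clr → Bool} (hA : Function.Injective (relabel A X)) (v : Bits b → ℂ) :
    ∑ p : Perm (Fin N) × Bool, 1 / (2 * N.factorial) * (if p.2 then -1 else 1) *
      (C.output ⟨(k + 1) * (N * N) + b, productInput (fun l : Fin (k + 1) =>
        if l = Fin.last k then orbitMat A X p.1 p.2 else orbitMat A X p.1 false) v⟩).overlap f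
      = 0 := by
  rw [Fintype.sum_prod_type]
  refine Finset.sum_eq_zero fun τ _ => ?_
  simp [orbitMat_eq_of_injective hA]

/-- If the automorphism group of the structure is generated by a decryption key, then the sum of the
overlaps with a sign is the mean advantage of the adversary. -/
theorem sum_overlap_eq_signAdvantage {Clr : Type} {A : Fin (deg n) → Fin (deg n) → Bool}
    {X : Fin (deg n) → Fin (deg n) → Clr → Bool} (π : Secret n)
    (hA : ∀ σ σ', relabel A X σ = relabel A X σ' ↔ σ' = σ ∨ σ' = σ * π.1) :
    ∑ p : Perm (Fin (deg n)) × Bool, 1 / (2 * (deg n).factorial) * (if p.2 then -1 else 1) *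
      (C.output ⟨(k + 1) * (deg n * deg n) + (a.qubits + h.qubits),
        productInput (fun l : Fin (k + 1) => if l = Fin.last k then orbitMat A X p.1 p.2
          else orbitMat A X p.1 false) (a.pair h)⟩).overlap f
      = -(1 / 2) * signAdvantage n k C a f h := by
  -- The key is expressed as a random conjugate of `π`. The term without signs counts positively,
  -- whence the minus sign, and the sign bit contributes the factor `1/2`.
  rw [signAdvantage, ← sum_conjSecret π, Fintype.sum_prod_type, Finset.mul_sum, Finset.mul_sum]
  refine Finset.sum_congr rfl fun τ _ => ?_
  rw [Fintype.sum_bool]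
  simp only [orbitMat_false π hA, orbitMat_true π hA, if_true, Bool.false_eq_true, if_false]
  rw [← input_eq, ← input_eq, successOn, successOn]
  field_simp
  ring

end Index

/-- A bound for the number of wires of a run on graphs with `2 * n + 1` vertices. -/
def wiresBound {S : Type*} [CommSemiring S] (n k s : S) : S :=
  2 * ((k + 1) * (4 * n + 2) ^ 2 + s) + 1 + (4 * n + 2) ^ 2 * (2 + (k + 1) * (2 * n + 4)) + 2

/-- A bound for the number of gates of a run on graphs with `2 * n + 1` vertices. -/
def gatesBound {S : Type*} [CommSemiring S] (n k s : S) : S :=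
  (k + 2) * ((4 * n + 2) ^ 4 * 3) + (s + (3 * ((k + 1) * (4 * n + 2) ^ 2 + s) + 1))

/-- A bound for the size of the circuit and of the advice that decide graph automorphism on graphs
with `2 * n + 1` vertices by `R` pairs of runs. -/
def decisionBound {S : Type*} [CommSemiring S] (n k s R : S) : S :=
  3 + (R * 2 * gatesBound n k s + (R * (5 * (R + 1)) + (R + 1))) *
    (3 * ((2 * n + 1) * (2 * n + 1) + (R * 2 * wiresBound n k s +
      (R * ((2 * n + 1) * (2 * n + 1)) + (R + 1) * (R + 1)))) + 8)

/-- The bounds are stated over semirings so that one formula yields both a polynomial in the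
security parameter and, by evaluation, its values. -/
theorem map_decisionBound {S S' : Type*} [CommSemiring S] [CommSemiring S'] (φ : S →+* S')
    (n k s R : S) : φ (decisionBound n k s R) = decisionBound (φ n) (φ k) (φ s) (φ R) := by
  have h : ∀ (t : ℕ) [t.AtLeastTwo], φ (OfNat.ofNat t) = OfNat.ofNat t := fun t => map_ofNat φ t
  simp only [decisionBound, gatesBound, wiresBound, map_add, map_mul, map_pow, map_one, h]

/-- The swap test doubles the register of the adversary at most. The structure wires consist of two
blocks of size `N²`, of `k + 1` blocks for relabelled graphs and of as many for the `2n + 3`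
relations that code copies and colours, besides the sign and auxiliary wires. -/
theorem card_runWires_le (n k s b anc r : ℕ) (hs : b + anc ≤ s)
    (hr : r ≤ (k + 1) * (deg n * deg n) + b + anc) :
    Fintype.card (RunWires ((k + 1) * (deg n * deg n) + b + anc) r (deg n) (k + 1)
      (Option (Option (Fin (2 * n + 1))))) ≤ wiresBound n k s := by
  simp only [Fintype.card_sum, Fintype.card_prod, Fintype.card_fin, Fintype.card_unique,
    Fintype.card_option, wiresBound, deg] at *
  nlinarith

/-- A circuit that distinguishes the ciphertexts of `0` and `1` yields a circuit that decides graph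
automorphism. -/
theorem exists_solvesGA {n : ℕ} (hn : 0 < n) (k : ℕ) (C : Circuit) (a f h : Ket) (R : ℕ) {δ : ℝ}
    (hδ : 0 < δ) (hR : 12 ≤ R * δ ^ 2)
    (hadv : 8 * (2 * n + 1) ^ 2 * δ ≤ signAdvantage n k C a f h ^ 2) :
    ∃ (C' : Circuit) (a' : Ket), SolvesGA (2 * n + 1) C' a' ∧
      C'.size ≤ decisionBound n k (C.size + a.qubits + h.qubits) R ∧
      a'.qubits ≤ decisionBound n k (C.size + a.qubits + h.qubits) R := by
  classical
  -- If `f` has the wrong length the adversary never succeeds, against the positive advantage. So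
  -- the length of `f` is controlled by the circuit.
  have hf : f.qubits = min C.out
      ((k + 1) * (deg n * deg n) + (a.qubits + h.qubits) + C.anc) := by
    by_contra hf
    rw [signAdvantage_eq_zero n k C a f h hf] at hadv
    have : 0 < 8 * (2 * (n : ℝ) + 1) ^ 2 * δ := by positivity
    linarith
  set m := 2 * n + 1 with hm
  let ε : Bool × Fin m ≃ Fin (deg n) := Fintype.equivFinOfCardEq (by
    simp only [Fintype.card_prod, Fintype.card_bool, Fintype.card_fin, deg]
    omega)
  let I := {p : Fin m × Fin m // p.1 ≠ p.2}
  -- Two different vertices exist because `n` is positive.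
  have hI : Nonempty I := ⟨⟨(⟨0, by omega⟩, ⟨1, by omega⟩), by simp⟩⟩
  have hcardI : Fintype.card I ≤ m * m := by
    refine (Fintype.card_subtype_le _).trans ?_
    simp
  obtain ⟨C', a', hC', ha', hdec⟩ := exists_amplified (I := I) (m := m) (by omega)
    (.inl (.inr (.inr ())))
    (runGates C k (a.qubits + h.qubits) (Option (Option (Fin m))) (twoCells ε))
    (fun i => runState C.anc (a.pair h) (fun x => f.amp fun i => x (Fin.cast hf i))
      (structBits (fun _ _ => false) (fun _ _ _ => false) (twoRels ε i.1.1 i.1.2)))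
    (fun i => sum_norm_sq_runState _ (Ket.sum_norm_sq_pair a h) (by
        rw [← f.norm_one]
        exact ((Equiv.arrowCongr (finCongr hf) (Equiv.refl Bool)).symm.sum_comp
          fun x => ‖f.amp x‖ ^ 2)) fun _ _ => structBits_left) R hδ hR
  have hw : _ ≤ _ := card_runWires_le n k (C.size + a.qubits + h.qubits) (a.qubits + h.qubits) C.anc
    (min C.out ((k + 1) * (deg n * deg n) + (a.qubits + h.qubits) + C.anc))
    (by have := anc_le_size C; omega) (Nat.min_le_right _ _)
  have hg : (runGates C k (a.qubits + h.qubits) (Option (Option (Fin m))) (twoCells ε)).length ≤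
      gatesBound n k (C.size + a.qubits + h.qubits) := by
    refine (length_runGates_le C (twoCells ε)).trans ?_
    have h1 := anc_le_size C
    have h2 := length_gates_le_size C
    simp only [gatesBound, deg, pow_two]
    linarith
  refine ⟨C', a', fun G => ?_, ?_, ?_⟩
  · choose φ' hφ' hφw using fun i : I => trueWeight_run (k := k) C (a.pair h)
      (Ket.sum_norm_sq_pair a h) f hf (twoCells_self ε) (twoRels ε i.1.1 i.1.2) (adjBits G)
    obtain ⟨h1, h2⟩ := hdec G φ' hφ'
    by_cases hG : HasNontrivialAut G
    · simp only [hG, decide_true]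
      refine h2 ?_
      obtain ⟨i, j, hij, π, hπ, hfix, hiff⟩ := exists_relabel_eq_iff ε hG
      have hgood := hφw ⟨(i, j), hij⟩
      rw [sum_overlap_eq_signAdvantage ⟨π, hπ, hfix⟩ hiff] at hgood
      -- Bad pairs may be biased in any direction, but never raise the probability of differing bits
      -- above one half.
      have hle : ∀ x : ℝ, 2 * x * (1 - x) ≤ 1 / 2 := fun x => by nlinarith [sq_nonneg (x - 1 / 2)]
      -- The good pair has `p = 1/2 + signAdvantage / 4`, so that `2p(1 - p)` is `1/2 -
      -- signAdvantage² / 8`.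
      have hsum : ∑ i, 2 * trueWeight (.inl (.inr (.inr ()))) (φ' i) *
          (1 - trueWeight (.inl (.inr (.inr ()))) (φ' i)) ≤
          Fintype.card I * (1 / 2) - signAdvantage n k C a f h ^ 2 / 8 := by
        rw [← Finset.add_sum_erase _ _ (Finset.mem_univ (⟨(i, j), hij⟩ : I)), hgood]
        have := Finset.sum_le_card_nsmul (Finset.univ.erase (⟨(i, j), hij⟩ : I))
          (fun i => 2 * trueWeight (.inl (.inr (.inr ()))) (φ' i) *
            (1 - trueWeight (.inl (.inr (.inr ()))) (φ' i))) (1 / 2) fun i _ => hle _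
        rw [Finset.card_erase_of_mem (Finset.mem_univ _), Finset.card_univ, nsmul_eq_mul,
          Nat.cast_sub Fintype.card_pos] at this
        push_cast at this
        nlinarith
      have hc : (0 : ℝ) < Fintype.card I := by exact_mod_cast Fintype.card_pos
      have hc2 : (Fintype.card I : ℝ) ≤ (2 * n + 1) ^ 2 := by
        have h3 : (Fintype.card I : ℝ) ≤ ((m * m : ℕ) : ℝ) := by exact_mod_cast hcardI
        have h4 : ((m * m : ℕ) : ℝ) = (2 * n + 1) ^ 2 := by
          rw [hm]
          push_cast
          ring
        exact h3.trans_eq h4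
      have hc3 := mul_le_mul_of_nonneg_right hc2 hδ.le
      rw [inv_mul_le_iff₀ hc]
      linarith
    · simp only [hG, decide_false]
      refine h1 fun i => ?_
      rw [hφw i, sum_overlap_eq_zero (relabel_injective_of_rigid ε hG i.2), mul_zero, sub_zero]
  · refine hC'.trans ?_
    rw [decisionBound, ← hm]
    gcongr
  · have h1 : a'.qubits ≤ R * 2 * wiresBound n k (C.size + a.qubits + h.qubits) +
        (R * (m * m) + (R + 1) * (R + 1)) := by
      rw [ha']
      gcongr
    have h2 : ∀ x y z w : ℕ, x ≤ z → 1 ≤ w → x ≤ 3 + w * (3 * (y + z) + 8) := by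
      intro x y z w hx hw
      nlinarith [Nat.zero_le y, Nat.zero_le z]
    exact h2 _ _ _ _ h1 (by omega)

end QPK

/-! ### Contradiction with the hardness of graph automorphism. -/

namespace QPK

open Equiv KKNY

theorem eval_le_eval_of_le (p : Polynomial ℕ) {x y : ℕ} (h : x ≤ y) : p.eval x ≤ p.eval y := by
  rw [Polynomial.eval_eq_sum_range, Polynomial.eval_eq_sum_range]
  gcongr

theorem decisionBound_mono {n k s s' R : ℕ} (h : s ≤ s') :
    decisionBound n k s R ≤ decisionBound n k s' R := by
  unfold decisionBound gatesBound wiresBound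
  gcongr

theorem two_le_decisionBound (n k s R : ℕ) : 2 ≤ decisionBound n k s R := by
  unfold decisionBound
  omega

/-- Circuits that distinguish the ciphertexts of `0` and `1` for infinitely many security parameters
yield circuits that decide graph automorphism for infinitely many numbers of vertices. -/
theorem not_GAHardAE_of_signAdvantage (k p : Polynomial ℕ) (P : ℕ → ℕ) (hP : ∀ n, 0 < P n)
    (hPp : ∃ q : Polynomial ℕ, ∀ n, P n = q.eval n)
    (C : ℕ → Circuit) (a f h : ℕ → Ket)
    (hs : ∀ n, (C n).size + (a n).qubits + (h n).qubits ≤ p.eval n)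
    (hadv : ∃ᶠ n in Filter.atTop,
      1 / (P n : ℝ) ≤ signAdvantage n (k.eval n) (C n) (a n) (f n) (h n)) :
    ¬ GAHardAE := by
  intro hGA
  obtain ⟨q, hq⟩ := hPp
  -- This is `12 / δ²` for the gap `δ = 1 / (8(2n + 1)²P²)` that an advantage of `1/P` guarantees.
  let Rp : Polynomial ℕ := 12 * (8 * (2 * Polynomial.X + 1) ^ 2 * q ^ 2) ^ 2
  let B : Polynomial ℕ := decisionBound Polynomial.X k p Rp
  have hR : ∀ n, Rp.eval n = 12 * (8 * (2 * n + 1) ^ 2 * P n ^ 2) ^ 2 := by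
    intro n
    simp [Rp, hq]
  have hB : ∀ n, B.eval n = decisionBound n (k.eval n) (p.eval n) (Rp.eval n) := by
    intro n
    have := map_decisionBound (Polynomial.evalRingHom n) Polynomial.X k p Rp
    simpa using this
  -- A family needs a member for every number of vertices; where no good `n` belongs to `m`, an
  -- empty circuit is used and nothing is claimed about its answers.
  have hex : ∀ m, ∃ (C' : Circuit) (a' : Ket), C'.size ≤ B.eval m ∧ a'.qubits ≤ B.eval m ∧
      ∀ n, m = 2 * n + 1 → 0 < n →
        1 / (P n : ℝ) ≤ signAdvantage n (k.eval n) (C n) (a n) (f n) (h n) → SolvesGA m C' a' := by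
    intro m
    by_cases hm : ∃ n, m = 2 * n + 1 ∧ 0 < n ∧
        1 / (P n : ℝ) ≤ signAdvantage n (k.eval n) (C n) (a n) (f n) (h n)
    · obtain ⟨n, rfl, hn, hle⟩ := hm
      have hPn : (0 : ℝ) < P n := by exact_mod_cast hP n
      obtain ⟨C', a', hsolve, hC', ha'⟩ := exists_solvesGA hn (k.eval n) (C n) (a n) (f n) (h n)
        (Rp.eval n) (δ := 1 / (8 * (2 * n + 1) ^ 2 * (P n : ℝ) ^ 2)) (by positivity)
        (by
          rw [hR]
          push_cast
          field_simp
          exact le_rfl)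
        (by
          calc _ = (1 / (P n : ℝ)) ^ 2 := by field_simp
            _ ≤ _ := pow_le_pow_left₀ (by positivity) hle 2)
      have hbound : decisionBound n (k.eval n) ((C n).size + (a n).qubits + (h n).qubits) (Rp.eval n) ≤
          B.eval (2 * n + 1) := by
        refine (decisionBound_mono (hs n)).trans ?_
        rw [← hB]
        exact eval_le_eval_of_le _ (by omega)
      refine ⟨C', a', hC'.trans hbound, ha'.trans hbound, fun n' hn' _ _ => hsolve⟩
    · refine ⟨⟨0, 0, []⟩, Ket.ofBits [], ?_, Nat.zero_le _, fun n h1 h2 h3 => (hm ⟨n, h1, h2, h3⟩).elim⟩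
      rw [hB]
      exact two_le_decisionBound _ _ _ _
  choose C' a' hC' ha' hsolve using hex
  have hev := hGA C' a' ⟨B, fun m => ⟨hC' m, ha' m⟩⟩
  obtain ⟨m₀, hm₀⟩ := Filter.eventually_atTop.1 hev
  -- Starting at `m₀ + 1` ensures both `0 < n` and `m₀ ≤ 2n + 1`.
  obtain ⟨n, hn, hle⟩ := Filter.frequently_atTop.1 hadv (m₀ + 1)
  exact hm₀ (2 * n + 1) (by omega) (hsolve _ n rfl (by omega) hle)

/-- Negligibility is tested with real polynomials, while numbers of repetitions and sizes need
natural ones. Rounding up the absolute values of the coefficients dominates `p`, and adding 1 gives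
positivity. -/
theorem exists_nat_polynomial_ge (p : Polynomial ℝ) :
    ∃ q : Polynomial ℕ, ∀ n : ℕ, 0 < q.eval n ∧ p.eval (n : ℝ) ≤ q.eval n := by
  refine ⟨∑ i ∈ Finset.range (p.natDegree + 1), Polynomial.C ⌈|p.coeff i|⌉₊ * Polynomial.X ^ i + 1,
    fun n => ⟨by simp, ?_⟩⟩
  have h : p.eval (n : ℝ) ≤ ∑ i ∈ Finset.range (p.natDegree + 1), (⌈|p.coeff i|⌉₊ : ℝ) * (n : ℝ) ^ i := by
    rw [Polynomial.eval_eq_sum_range]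
    refine Finset.sum_le_sum fun i _ => ?_
    gcongr
    exact (le_abs_self _).trans (Nat.le_ceil _)
  simp only [Polynomial.eval_add, Polynomial.eval_finsetSum, Polynomial.eval_mul, Polynomial.eval_C,
    Polynomial.eval_pow, Polynomial.eval_X, Polynomial.eval_one]
  push_cast
  linarith

end QPK

theorem corollary4p1 (hGA : QPK.GAHardAE) : QPK.KKNY.system.SemanticallyQSecure := by
  refine ⟨QPK.keepAdversary, fun k => ⟨k + 1, fun C a ⟨r, hr⟩ X f h _ _ p hp => ?_⟩⟩
  by_contra hcon
  obtain ⟨P, hP⟩ := QPK.exists_nat_polynomial_ge p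
  -- One `r` bounds the circuit and one the advice. The strings `f [true]` and `h [true]` do not
  -- change with `n`, so the auxiliary input adds only a constant.
  refine QPK.not_GAHardAE_of_signAdvantage k (r + r + Polynomial.C (h [true]).qubits)
    (fun n => P.eval n) (fun n => (hP n).1) ⟨P, fun _ => rfl⟩ C a (fun _ => f [true])
    (fun _ => h [true]) (fun n => ?_) ?_ hGA
  · have := hr n
    simp only [Polynomial.eval_add, Polynomial.eval_C]
    omega
  · refine (Filter.not_eventually.1 hcon).mono fun n hn => ?_
    simp only [not_lt, Polynomial.eval_add, Polynomial.eval_one, QPK.realSuccess_sub_idealSuccess] at hn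
    have hpos : 0 < 1 / p.eval (n : ℝ) := one_div_pos.2 (hp n)
    have h1 : ((X n) ⟨[true], by simp [QPK.KKNY.system]⟩).toReal ≤ 1 :=
      ENNReal.toReal_mono ENNReal.one_ne_top (PMF.coe_le_one _ _)
    -- The difference is a probability times the advantage. It is positive, so the advantage is
    -- positive and at least as large as the difference.
    have h2 := pos_of_mul_pos_right (hpos.trans_le hn) ENNReal.toReal_nonneg
    exact (one_div_le_one_div_of_le (hp n) (hP n).2).trans
      (hn.trans (mul_le_of_le_one_left h2.le h1))
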